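/- **Theorem 2.1 (Graphical Kazhdan–Lusztig basis).** Let $n\ge 4$ and let $W$ be the Coxeter group of type $D_n$ with simple reflections $s_0,\dots,s_{n-1}$, where in the Dynkin diagram the nodes $0$ and $1$ are both joined to $2$, followed by the chain $2,3,\dots,n-1$. Let $l$ be the length function, $W_{\mathfrak p}=\langle s_1,\dots,s_{n-1}\rangle$ (of type $A_{n-1}$), and let $W^{\mathfrak p}=\{w\in W: l(s_iw)>l(w)\text{ for }1\le i\le n-1\}$ be the set of shortest representatives of $W_{\mathfrak p}\backslash W$. *Algebra.* Let $\mathcal L=\mathbb Z[q,q^{-1}]$. Let $\mathcal H$ be the Hecke algebra of $W$, the $\mathcal L$-algebra with basis $H_w$ $(w\in W)$, unit $H_e$, and relations $H_xH_y=H_{xy}$ if $l(xy)=l(x)+l(y)$ and $H_s^2=(q^{-1}-q)H_s+H_e$ for simple $s$. Put $C_s=H_s+q$, let $\mathcal H_{\mathfrak p}\subset\mathcal H$ be the subalgebra generated by $C_{s_1},\dots,C_{s_{n-1}}$, let these generators act on $\mathcal L$ by zero, and let $\mathcal N=\mathcal L\otimes_{\mathcal H_{\mathfrak p}}\mathcal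 H$, with standard basis $N_w=1\otimes H_w$ $(w\in W^{\mathfrak p})$. The ring involution $H_w\mapsto (H_{w^{-1}})^{-1}$, $q\mapsto q^{-1}$ of $\mathcal H$ induces an involution of $\mathcal N$. The Kazhdan–Lusztig basis $(\underline N_w)_{w\in W^{\mathfrak p}}$ of $\mathcal N$ is the unique family such that each $\underline N_w$ is fixed by this involution and $\underline N_w\in N_w+\sum_{v\ne w}q\mathbb Z[q]N_v$; the Kazhdan–Lusztig polynomials $n_{v,w}$ are defined by $\underline N_w=\sum_v n_{v,w}N_v$. *Weights.* Let $W$ act on $\{\pm1,\dots,\pm n\}$ by the homomorphism $\Psi$ for which $\Psi(s_0)$ exchanges $1\leftrightarrow-2$ and $2\leftrightarrow -1$, and $\Psi(s_i)$, $i\ge1$, exchanges $i\leftrightarrow i+1$ and $-i\leftrightarrow -(i+1)$. To $w\in W^{\mathfrak p}$ attach the sequence of signs $\alpha_w$ which has at the place $k\in\{\pm1,\dots,\pm n\}$ the sign of $\Psi(w)(k)$, and extend it to the places $\pm1,\dots,\pm2n$ by pluses at $-2n,\dots,-n-1$ and minuses at $n+1,\dots,2n$. The weight of $w$ is obtained from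 this extended sequence by replacing every $+$ by $\vee$ and every $-$ by $\wedge$. *Cup diagrams.* For $w\in W^{\mathfrak p}$ there is exactly one way to join the $4n$ places $-2n,\dots,-1,1,\dots,2n$ on the number line in pairs by non-intersecting arcs in the lower half plane such that for the extended sequence of $w$ each arc has a $+$ at its left end and a $-$ at its right end. The number of arcs crossing the middle (from a negative to a positive place) is even. Pair these arcs, starting with the two innermost ones, then the next two, and so on, and replace the two arcs $(a,b)$, $(a',b')$ (left end, right end) of each pair by two linked arcs $(a,b')$, $(a',b)$. The result is the cup diagram $C(w)$; its $2n$ arcs, linked or not, are called cups. For $v,w\in W^{\mathfrak p}$, label the places of $C(w)$ with the weight of $v$; the diagram $vC(w)$ is *oriented* if every cup has exactly one end labeled $\vee$ and one labeled $\wedge$. In this case $\operatorname{cl}(vC(w))$ denotes the number of clockwise cups, i.e. of cups with $\wedge$ at the left and $\vee$ at the right end (each of two linked cups is counted). Let $M_D$ be the free $\mathcal L$-module with basis the weights of the elements of $W^{\mathfrak p}$, let $\Phi:M_D\to\mathcal N$ be the isomorphism that sends the weight of $w$ to $N_w$, and let $$C(w)_{M_D}=\sum_{v\in W^{\mathfrak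 p},\ vC(w)\text{ oriented}}q^{\operatorname{cl}(vC(w))/2}\,v .$$ Then $\Phi(C(w)_{M_D})=\underline N_w$ for all $w\in W^{\mathfrak p}$. That is, for all $v,w\in W^{\mathfrak p}$: if $vC(w)$ is oriented, then $\operatorname{cl}(vC(w))$ is even and $n_{v,w}=q^{\operatorname{cl}(vC(w))/2}$; otherwise $n_{v,w}=0$. -/

import Mathlib

namespace GraphicalKL

open LaurentPolynomial TensorProduct

/-- `i` and `j` are joined in the Dynkin diagram of type `D_n` with nodes `0, 1, …, n - 1`: the nodes
`0` and `1` are the two ends of the fork, both joined to `2`, followed by the chain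
`2, 3, …, n - 1`. -/
def adj (i j : ℕ) : Prop :=
  (1 ≤ i ∧ j = i + 1) ∨ (1 ≤ j ∧ i = j + 1) ∨ (i = 0 ∧ j = 2) ∨ (i = 2 ∧ j = 0)

instance (i j : ℕ) : Decidable (adj i j) := by unfold adj; infer_instance

/-- The Coxeter matrix of type `D_n`. -/
def coxeterMatrix (n : ℕ) : CoxeterMatrix (Fin n) where
  M := Matrix.of fun i j => if i = j then 1 else if adj i j then 3 else 2
  isSymm := by
    ext i j
    simp only [Matrix.transpose_apply, Matrix.of_apply, adj]
    grind
  diagonal := by simp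
  off_diagonal := by
    intro i j h
    simp only [Matrix.of_apply, if_neg h]
    split_ifs <;> simp

/-- The Weyl group of type `D_n`, by its Coxeter presentation. -/
abbrev W (n : ℕ) : Type := (coxeterMatrix n).Group
/-- The simple reflection `s_i`. -/
abbrev s {n : ℕ} (i : Fin n) : W n := (coxeterMatrix n).simple i
/-- The length function `l`. -/
noncomputable abbrev len {n : ℕ} (w : W n) : ℕ := (coxeterMatrix n).toCoxeterSystem.length w

/-- The transpositions `t_0 = (-1, 1)`, `t_i = (i, i + 1)` and `t_{-i} = (-i - 1, -i)` for `i > 0`. -/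
def t (i : ℤ) : Equiv.Perm ℤ :=
  if i = 0 then Equiv.swap (-1) 1 else if 0 < i then Equiv.swap i (i + 1) else Equiv.swap (i - 1) i

/-- The signed permutation attached to `s_i`: `t_0 t_1 t_{-1} t_0` for `i = 0` (it exchanges `1` with
`-2` and `2` with `-1`) and `t_i t_{-i}` for `i > 0`. -/
def gen (i : ℕ) : Equiv.Perm ℤ :=
  if i = 0 then t 0 * t 1 * t (-1) * t 0 else t i * t (-i)

lemma gen_zero_apply (x : ℤ) : gen 0 x =
    if x = 1 then -2 else if x = 2 then -1 else if x = -1 then 2 else if x = -2 then 1 else x := by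
  simp [gen, t, Equiv.swap_apply_def]
  grind

lemma gen_pos_apply {i : ℕ} (hi : i ≠ 0) (x : ℤ) : gen i x =
    if x = i then (i + 1 : ℤ) else if x = i + 1 then (i : ℤ) else
      if x = -i then (-i - 1 : ℤ) else if x = -i - 1 then (-i : ℤ) else x := by
  have h1 : (0 : ℤ) < i := by omega
  have h2 : ¬ (0 : ℤ) < -i := by omega
  have h3 : ¬ -(i : ℤ) = 0 := by omega
  rw [gen, if_neg hi, t, t, if_neg h1.ne', if_pos h1, if_neg h3, if_neg h2,
    Equiv.Perm.mul_apply, Equiv.swap_apply_def, Equiv.swap_apply_def]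
  grind

lemma gen_sq (i : ℕ) : gen i * gen i = 1 := by
  ext x
  rw [Equiv.Perm.mul_apply, Equiv.Perm.one_apply]
  rcases eq_or_ne i 0 with rfl | h
  · rw [gen_zero_apply, gen_zero_apply]; grind
  · rw [gen_pos_apply h, gen_pos_apply h]; grind

lemma gen_comm {i j : ℕ} (hij : i < j) (h : ¬ adj i j) : gen i * gen j = gen j * gen i := by
  have hj : j ≠ 0 := by omega
  by_cases h01 : i = 0 ∧ j = 1
  · obtain ⟨rfl, rfl⟩ := h01
    ext x
    rw [Equiv.Perm.mul_apply, Equiv.Perm.mul_apply]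
    by_cases hx : x = 1 ∨ x = -1 ∨ x = 2 ∨ x = -2
    · rcases hx with rfl | rfl | rfl | rfl <;> simp [gen_zero_apply, gen_pos_apply hj]
    · have e0 : gen 0 x = x := by rw [gen_zero_apply]; grind
      have e1 : gen 1 x = x := by rw [gen_pos_apply hj]; grind
      simp only [e0, e1]
  · refine Equiv.Perm.Disjoint.commute fun x => ?_
    rw [gen_pos_apply hj]
    simp only [adj] at h
    rcases eq_or_ne i 0 with rfl | hi
    · rw [gen_zero_apply]
      by_cases hx : x = 1 ∨ x = -1 ∨ x = 2 ∨ x = -2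
      · right
        rw [if_neg (by omega), if_neg (by omega), if_neg (by omega), if_neg (by omega)]
      · left
        rw [if_neg (by omega), if_neg (by omega), if_neg (by omega), if_neg (by omega)]
    · rw [gen_pos_apply hi]
      by_cases hx : x = i ∨ x = i + 1 ∨ x = -i ∨ x = -i - 1
      · right
        rw [if_neg (by omega), if_neg (by omega), if_neg (by omega), if_neg (by omega)]
      · left
        rw [if_neg (by omega), if_neg (by omega), if_neg (by omega), if_neg (by omega)]

lemma gen_braid_zero : gen 0 * gen 2 * gen 0 = gen 2 * gen 0 * gen 2 := by
  have h2 : (2 : ℕ) ≠ 0 := by omega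
  ext x
  simp only [Equiv.Perm.mul_apply]
  by_cases hx : x = 1 ∨ x = -1 ∨ x = 2 ∨ x = -2 ∨ x = 3 ∨ x = -3
  · rcases hx with rfl | rfl | rfl | rfl | rfl | rfl <;> simp [gen_zero_apply, gen_pos_apply h2]
  · have e0 : gen 0 x = x := by rw [gen_zero_apply]; grind
    have e2 : gen 2 x = x := by rw [gen_pos_apply h2]; grind
    simp only [e0, e2]

lemma gen_braid_pos {i : ℕ} (hi : i ≠ 0) :
    gen i * gen (i + 1) * gen i = gen (i + 1) * gen i * gen (i + 1) := by
  have a1 : gen i i = i + 1 := by rw [gen_pos_apply hi]; grind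
  have a2 : gen i (i + 1) = i := by rw [gen_pos_apply hi]; grind
  have a3 : gen i (i + 2) = i + 2 := by rw [gen_pos_apply hi]; grind
  have a4 : gen i (-i) = -i - 1 := by rw [gen_pos_apply hi]; grind
  have a5 : gen i (-i - 1) = -i := by rw [gen_pos_apply hi]; grind
  have a6 : gen i (-i - 2) = -i - 2 := by rw [gen_pos_apply hi]; grind
  have b1 : gen (i + 1) i = i := by rw [gen_pos_apply (by omega)]; grind
  have b2 : gen (i + 1) (i + 1) = i + 2 := by rw [gen_pos_apply (by omega)]; grind
  have b3 : gen (i + 1) (i + 2) = i + 1 := by rw [gen_pos_apply (by omega)]; grind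
  have b4 : gen (i + 1) (-i) = -i := by rw [gen_pos_apply (by omega)]; grind
  have b5 : gen (i + 1) (-i - 1) = -i - 2 := by rw [gen_pos_apply (by omega)]; grind
  have b6 : gen (i + 1) (-i - 2) = -i - 1 := by rw [gen_pos_apply (by omega)]; grind
  ext x
  simp only [Equiv.Perm.mul_apply]
  by_cases hx : x = i ∨ x = i + 1 ∨ x = i + 2 ∨ x = -i ∨ x = -i - 1 ∨ x = -i - 2
  · rcases hx with rfl | rfl | rfl | rfl | rfl | rfl <;>
      simp only [a1, a2, a3, a4, a5, a6, b1, b2, b3, b4, b5, b6]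
  · have e0 : gen i x = x := by rw [gen_pos_apply hi]; grind
    have e2 : gen (i + 1) x = x := by rw [gen_pos_apply (by omega)]; grind
    simp only [e0, e2]

lemma gen_liftable (n : ℕ) : (coxeterMatrix n).IsLiftable (fun i : Fin n => gen i) := by
  have three {a b : Equiv.Perm ℤ} (ha : a * a = 1) (hb : b * b = 1) (h : a * b * a = b * a * b) :
      (a * b) ^ 3 = 1 := by
    calc (a * b) ^ 3 = (a * b * a) * (b * a * b) := by simp only [pow_succ, pow_zero]; group
      _ = a * b * (a * a) * b * a := by rw [← h]; group
      _ = 1 := by rw [ha, mul_one, mul_assoc a b b, hb, mul_one, ha]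
  have two {a b : Equiv.Perm ℤ} (ha : a * a = 1) (hb : b * b = 1) (h : a * b = b * a) :
      (a * b) ^ 2 = 1 := by
    calc (a * b) ^ 2 = a * b * (a * b) := sq _
      _ = a * b * (b * a) := by rw [← h]
      _ = a * (b * b) * a := by group
      _ = 1 := by rw [hb, mul_one, ha]
  intro i j
  change (gen i * gen j) ^ (if i = j then 1 else if adj i j then 3 else 2) = 1
  split_ifs with h1 h2
  · rw [h1, pow_one, gen_sq]
  · apply three (gen_sq _) (gen_sq _)
    rcases h2 with ⟨h, h'⟩ | ⟨h, h'⟩ | ⟨h, h'⟩ | ⟨h, h'⟩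
    · rw [h', gen_braid_pos (by omega)]
    · rw [h', gen_braid_pos (by omega)]
    · rw [h', h, gen_braid_zero]
    · rw [h', h, gen_braid_zero]
  · apply two (gen_sq _) (gen_sq _)
    rcases lt_or_gt_of_ne (fun h => h1 (Fin.ext h) : (i : ℕ) ≠ j) with h | h
    · exact gen_comm h h2
    · exact (gen_comm h (fun h' => h2 (by simp only [adj] at h' ⊢; omega))).symm

/-- The homomorphism `Ψ` from `W` to the permutations of `{±1, …, ±n}`, which are viewed as
permutations of `ℤ` fixing everything else. -/
def Psi (n : ℕ) : W n →* Equiv.Perm ℤ :=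
  (coxeterMatrix n).toCoxeterSystem.lift ⟨fun i : Fin n => gen i, gen_liftable n⟩

lemma Psi_neg {n : ℕ} (w : W n) (k : ℤ) : Psi n w (-k) = -Psi n w k := by
  induction w using (coxeterMatrix n).toCoxeterSystem.simple_induction_left generalizing k with
  | one => simp
  | mul_simple_left w i ih =>
    rw [map_mul, Equiv.Perm.mul_apply, Equiv.Perm.mul_apply, ih]
    generalize Psi n w k = y
    have : Psi n ((coxeterMatrix n).toCoxeterSystem.simple i) = gen i :=
      CoxeterSystem.lift_apply_simple _ _ _
    rw [this]
    rcases eq_or_ne (i : ℕ) 0 with h | h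
    · rw [h]; simp [gen_zero_apply]; grind
    · simp [gen_pos_apply h]; grind

/-- The ring `ℤ[q, q⁻¹]`. -/
abbrev L : Type := LaurentPolynomial ℤ
noncomputable abbrev q : L := T 1

/-- The defining relations of the Hecke algebra in the generators `H_w`, `w ∈ W`: `H_e` is the unit,
`H_x H_y = H_{xy}` if the lengths add up, and `H_s² = (q⁻¹ - q) H_s + H_e`. -/
inductive HeckeRel (n : ℕ) : FreeAlgebra L (W n) → FreeAlgebra L (W n) → Prop
  | one : HeckeRel n (FreeAlgebra.ι L 1) 1
  | mul (x y : W n) (h : len (x * y) = len x + len y) :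
      HeckeRel n (FreeAlgebra.ι L x * FreeAlgebra.ι L y) (FreeAlgebra.ι L (x * y))
  | quad (i : Fin n) : HeckeRel n (FreeAlgebra.ι L (s i) * FreeAlgebra.ι L (s i))
      ((T (-1) - q : L) • FreeAlgebra.ι L (s i) + FreeAlgebra.ι L 1)

/-- The Hecke algebra of `W` over `ℤ[q, q⁻¹]`. -/
def Hecke (n : ℕ) : Type := RingQuot (HeckeRel n)

noncomputable instance (n : ℕ) : Ring (Hecke n) := inferInstanceAs (Ring (RingQuot (HeckeRel n)))

noncomputable instance (n : ℕ) : Algebra L (Hecke n) :=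
  inferInstanceAs (Algebra L (RingQuot (HeckeRel n)))

/-- The quotient map from the free algebra on the symbols `H_w`. -/
noncomputable def toHecke (n : ℕ) : FreeAlgebra L (W n) →ₐ[L] Hecke n :=
  RingQuot.mkAlgHom L (HeckeRel n)

lemma toHecke_rel {n : ℕ} {x y : FreeAlgebra L (W n)} (h : HeckeRel n x y) :
    toHecke n x = toHecke n y := RingQuot.mkAlgHom_rel L h

/-- The standard generator `H_w`. -/
noncomputable def H {n : ℕ} (w : W n) : Hecke n := toHecke n (FreeAlgebra.ι L w)

/-- `C_s = H_s + q` for `s = s_i`. -/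
noncomputable def C {n : ℕ} (i : Fin n) : Hecke n := H (s i) + algebraMap L (Hecke n) q

lemma H_one (n : ℕ) : H (1 : W n) = 1 := by
  simpa [H] using toHecke_rel (HeckeRel.one (n := n))
lemma H_mul {n : ℕ} (x y : W n) (h : len (x * y) = len x + len y) : H x * H y = H (x * y) := by
  simpa [H] using toHecke_rel (HeckeRel.mul x y h)
lemma H_quad {n : ℕ} (i : Fin n) :
    H (s i) * H (s i) = (T (-1) - q : L) • H (s i) + (1 : Hecke n) := by
  rw [← H_one]
  simpa only [H, map_mul, map_add, map_smul] using toHecke_rel (HeckeRel.quad i)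


lemma isUnit_H_simple {n : ℕ} (i : Fin n) : IsUnit (H (s i)) := by
  have h := H_quad i
  have h1 : H (s i) * (H (s i) - (T (-1) - q : L) • (1 : Hecke n)) = 1 := by
    rw [mul_sub, h, mul_smul_comm, mul_one]; abel
  have h2 : (H (s i) - (T (-1) - q : L) • (1 : Hecke n)) * H (s i) = 1 := by
    rw [sub_mul, h, smul_mul_assoc, one_mul]; abel
  exact ⟨⟨_, _, h1, h2⟩, rfl⟩

lemma isUnit_H {n : ℕ} (w : W n) : IsUnit (H w) := by
  induction hk : len w using Nat.strong_induction_on generalizing w with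
  | _ k ih =>
    by_cases hw : w = 1
    · rw [hw, H_one]; exact isUnit_one
    · obtain ⟨i, hi⟩ := (coxeterMatrix n).toCoxeterSystem.exists_leftDescent_of_ne_one hw
      have hi' := ((coxeterMatrix n).toCoxeterSystem.isLeftDescent_iff).1 hi
      have e : w = s i * (s i * w) :=
        ((coxeterMatrix n).toCoxeterSystem.simple_mul_simple_cancel_left i).symm
      have hl : len (s i) = 1 := (coxeterMatrix n).toCoxeterSystem.length_simple i
      have hm : H (s i) * H (s i * w) = H w := by
        rw [H_mul, ← e]
        rw [← e, hl]
        exact hi'.symm.trans (add_comm _ _)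
      rw [← hm]
      refine (isUnit_H_simple i).mul (ih _ ?_ _ rfl)
      rw [← hk]; exact hi

/-- The inverse of `H_w`. -/
noncomputable def invH {n : ℕ} (w : W n) : Hecke n := ((isUnit_H w).unit⁻¹ : (Hecke n)ˣ)

lemma H_mul_invH {n : ℕ} (w : W n) : H w * invH w = 1 := (isUnit_H w).mul_val_inv
lemma invH_mul_H {n : ℕ} (w : W n) : invH w * H w = 1 := (isUnit_H w).val_inv_mul

/-- The ring involution `q ↦ q⁻¹` of `ℤ[q, q⁻¹]`. -/
noncomputable abbrev sigma : L →+* L := (LaurentPolynomial.invert (R := ℤ) : L →+* L)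

/-- The ring homomorphism from the free algebra with `H_w ↦ (H_{w⁻¹})⁻¹` and `q ↦ q⁻¹`. -/
noncomputable def barFree (n : ℕ) : FreeAlgebra L (W n) →+* Hecke n :=
  letI : Algebra L (Hecke n) := Algebra.compHom (Hecke n) sigma
  (FreeAlgebra.lift L fun w : W n => invH w⁻¹).toRingHom

lemma barFree_ι {n : ℕ} (w : W n) : barFree n (FreeAlgebra.ι L w) = invH w⁻¹ := by
  let _ : Algebra L (Hecke n) := Algebra.compHom (Hecke n) sigma
  exact FreeAlgebra.lift_ι_apply _ _

lemma barFree_algebraMap {n : ℕ} (a : L) :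
    barFree n (algebraMap L _ a) = algebraMap L (Hecke n) (sigma a) := by
  let _ : Algebra L (Hecke n) := Algebra.compHom (Hecke n) sigma
  exact (FreeAlgebra.lift L fun w : W n => invH w⁻¹).commutes a

lemma barFree_rel {n : ℕ} ⦃x y : FreeAlgebra L (W n)⦄ (h : HeckeRel n x y) :
    barFree n x = barFree n y := by
  have inv_eq {a b b' : Hecke n} (h1 : a * b = 1) (h2 : b' * a = 1) : b' = b := by
    rw [← mul_one b', ← h1, ← mul_assoc, h2, one_mul]
  cases h with
  | one =>
    rw [barFree_ι, map_one, inv_one, ← H_mul_invH 1, H_one, one_mul]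
  | mul x y h =>
    rw [map_mul, barFree_ι, barFree_ι, barFree_ι]
    have hl : len (y⁻¹ * x⁻¹) = len y⁻¹ + len x⁻¹ := by
      rw [← mul_inv_rev]
      simp only [len, CoxeterSystem.length_inv] at h ⊢
      rw [h, add_comm]
    refine inv_eq (a := H (x * y)⁻¹) (H_mul_invH _) ?_
    rw [mul_inv_rev, ← H_mul _ _ hl, mul_assoc, ← mul_assoc (invH y⁻¹), invH_mul_H, one_mul,
      invH_mul_H]
  | quad i =>
    rw [Algebra.smul_def]
    simp only [map_mul, map_add, barFree_ι, barFree_algebraMap, inv_one]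
    have e1 : invH (1 : W n) = 1 := by rw [← H_mul_invH 1, H_one, one_mul]
    have e2 : (s i)⁻¹ = s i := (coxeterMatrix n).toCoxeterSystem.inv_simple i
    have e3 : sigma (T (-1) - q) = -(T (-1) - q) := by simp [sigma, q]
    rw [e1, e2, e3, map_neg, neg_mul, ← Algebra.smul_def]
    have h := congrArg (fun z => invH (s i) * z * invH (s i)) (H_quad i)
    simp only [mul_add, add_mul, mul_one, mul_smul_comm, smul_mul_assoc] at h
    rw [← mul_assoc, invH_mul_H, one_mul, H_mul_invH, one_mul] at h
    rw [h]; abel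

/-- The bar involution of the Hecke algebra: the ring homomorphism with `H_w ↦ (H_{w⁻¹})⁻¹` and
`q ↦ q⁻¹`. -/
noncomputable def bar (n : ℕ) : Hecke n →+* Hecke n :=
  (RingQuot.lift ⟨barFree n, barFree_rel⟩ : RingQuot (HeckeRel n) →+* Hecke n)

lemma bar_mk {n : ℕ} (x : FreeAlgebra L (W n)) :
    bar n (toHecke n x) = barFree n x := by
  have h : toHecke n x = RingQuot.mkRingHom (HeckeRel n) x :=
    DFunLike.congr_fun (RingQuot.mkAlgHom_coe L (HeckeRel n)) x
  rw [h]
  exact RingQuot.lift_mkRingHom_apply _ _ _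

lemma bar_H {n : ℕ} (w : W n) : bar n (H w) = invH w⁻¹ := by rw [H, bar_mk, barFree_ι]

lemma bar_algebraMap {n : ℕ} (a : L) :
    bar n (algebraMap L _ a) = algebraMap L _ (sigma a) := by
  rw [← (toHecke n).commutes, bar_mk, barFree_algebraMap]

/-- The bar involution as a semilinear map. -/
noncomputable def barLinear (n : ℕ) : Hecke n →ₛₗ[sigma] Hecke n where
  toFun := bar n
  map_add' := map_add _
  map_smul' a x := by rw [Algebra.smul_def, map_mul, bar_algebraMap, ← Algebra.smul_def]

/-- The character `H_w ↦ (-q)^{l(w)}` of the Hecke algebra; it kills every `C_s`. -/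
noncomputable def signChar (n : ℕ) : Hecke n →ₐ[L] L :=
  (RingQuot.liftAlgHom L ⟨FreeAlgebra.lift L fun w : W n => (-q) ^ len w, by
    intro x y h
    cases h with
    | one => simp [len, CoxeterSystem.length_one]
    | mul x y h => simp [h, pow_add]
    | quad i =>
      have hl : len (s i) = 1 := (coxeterMatrix n).toCoxeterSystem.length_simple i
      have h1 : len (1 : W n) = 0 := (coxeterMatrix n).toCoxeterSystem.length_one
      have hT : (T (-1) : L) * T 1 = 1 := by rw [← T_add]; simp
      simp only [map_mul, map_add, map_smul, FreeAlgebra.lift_ι_apply, hl, h1, pow_one, pow_zero,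
        smul_eq_mul]
      linear_combination hT⟩ : RingQuot (HeckeRel n) →ₐ[L] L)

lemma signChar_H {n : ℕ} (w : W n) : signChar n (H w) = (-q) ^ len w := by
  have h : signChar n (toHecke n (FreeAlgebra.ι L w)) =
      FreeAlgebra.lift L (fun w : W n => (-q) ^ len w) (FreeAlgebra.ι L w) :=
    RingQuot.liftAlgHom_mkAlgHom_apply _ _ _ _
  rw [H, h, FreeAlgebra.lift_ι_apply]

lemma signChar_C {n : ℕ} (i : Fin n) : signChar n (C i) = 0 := by
  have hl : len (s i) = 1 := (coxeterMatrix n).toCoxeterSystem.length_simple i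
  rw [C, map_add, signChar_H, hl, AlgHom.commutes]
  simp

lemma bar_C {n : ℕ} (i : Fin n) : bar n (C i) = C i := by
  have e2 : (s i)⁻¹ = s i := (coxeterMatrix n).toCoxeterSystem.inv_simple i
  have h := congrArg (fun z => invH (s i) * z) (H_quad i)
  simp only [mul_add, mul_one, mul_smul_comm] at h
  rw [← mul_assoc, invH_mul_H, one_mul] at h
  have h2 : sigma q = T (-1) := by simp [sigma, q]
  rw [C, map_add, bar_H, bar_algebraMap, e2, h2, h, sub_smul, Algebra.smul_def, Algebra.smul_def,
    mul_one, mul_one]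
  abel

/-- The Hecke algebra of the parabolic subgroup generated by `s_1, …, s_{n-1}`: the subalgebra
generated by the corresponding `C_s`. -/
noncomputable def Hp (n : ℕ) : Subalgebra L (Hecke n) :=
  Algebra.adjoin L {x | ∃ i : Fin n, (i : ℕ) ≠ 0 ∧ x = C i}

/-- The action of `Hp` on its right module `L`: every generator `C_s` of `Hp` acts by zero, so
`h` acts by multiplication with `chi h`. -/
noncomputable def chi (n : ℕ) : Hp n →ₐ[L] L := (signChar n).comp (Hp n).val

lemma bar_mem_Hp {n : ℕ} {h : Hecke n} (hh : h ∈ Hp n) :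
    bar n h ∈ Hp n ∧ signChar n (bar n h) = sigma (signChar n h) := by
  induction hh using Algebra.adjoin_induction with
  | mem x hx =>
    obtain ⟨i, hi, rfl⟩ := hx
    rw [bar_C, signChar_C, map_zero]
    exact ⟨Algebra.subset_adjoin ⟨i, hi, rfl⟩, rfl⟩
  | algebraMap a =>
    rw [bar_algebraMap, AlgHom.commutes, AlgHom.commutes]
    exact ⟨Subalgebra.algebraMap_mem _ _, rfl⟩
  | add x y _ _ hx hy =>
    rw [map_add, map_add, map_add, map_add, hx.2, hy.2]
    exact ⟨add_mem hx.1 hy.1, rfl⟩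
  | mul x y _ _ hx hy =>
    rw [map_mul, map_mul, map_mul, map_mul, hx.2, hy.2]
    exact ⟨mul_mem hx.1 hy.1, rfl⟩

lemma chi_C {n : ℕ} (i : Fin n) (hi : (i : ℕ) ≠ 0) :
    chi n ⟨C i, Algebra.subset_adjoin ⟨i, hi, rfl⟩⟩ = 0 := signChar_C i

/-- The relations `a h ⊗ x = a ⊗ h x` with `h ∈ Hp` that turn `L ⊗_L Hecke` into `L ⊗_{Hp} Hecke`. -/
noncomputable def balanced (n : ℕ) : Submodule L (L ⊗[L] Hecke n) :=
  Submodule.span L {z | ∃ (a : L) (h : Hp n) (x : Hecke n),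
    z = (a * chi n h) ⊗ₜ[L] x - a ⊗ₜ[L] ((h : Hecke n) * x)}

/-- The parabolic Hecke module `L ⊗_{Hp} Hecke`. -/
abbrev ParabolicModule (n : ℕ) : Type := (L ⊗[L] Hecke n) ⧸ balanced n

lemma balanced_le_comap (n : ℕ) : balanced n ≤ (balanced n).comap
    (TensorProduct.map sigma.toSemilinearMap (barLinear n)) := by
  refine Submodule.span_le.2 ?_
  rintro _ ⟨a, h, x, rfl⟩
  refine Submodule.subset_span
    ⟨sigma a, ⟨bar n h, (bar_mem_Hp h.2).1⟩, bar n x, ?_⟩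
  have e : sigma (chi n h) = chi n ⟨bar n h, (bar_mem_Hp h.2).1⟩ := (bar_mem_Hp h.2).2.symm
  rw [map_sub, TensorProduct.map_tmul, TensorProduct.map_tmul, ← e]
  simp [barLinear]

/-- The involution of the parabolic Hecke module induced by the bar involution:
`a ⊗ x ↦ bar a ⊗ bar x`. -/
noncomputable def barParabolic (n : ℕ) : ParabolicModule n →ₛₗ[sigma] ParabolicModule n :=
  Submodule.mapQ (balanced n) (balanced n)
    (TensorProduct.map sigma.toSemilinearMap (barLinear n)) (balanced_le_comap n)

/-- The set `W^p` of shortest representatives of the cosets of the parabolic subgroup generated by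
`s_1, …, s_{n-1}`: all `w` with `l(s w) > l(w)` for these `s`. -/
def MinCosetRep (n : ℕ) : Type := {w : W n // ∀ i : Fin n, (i : ℕ) ≠ 0 → len w < len (s i * w)}

/-- The standard element `N_w = 1 ⊗ H_w` of the parabolic Hecke module. -/
noncomputable def N {n : ℕ} (w : MinCosetRep n) : ParabolicModule n :=
  (balanced n).mkQ (1 ⊗ₜ[L] H w.1)

/-- The characterization of the Kazhdan-Lusztig basis: each element is fixed by the involution and
the element of index `w` lies in `N_w + ∑_{v ≠ w} q ℤ[q] N_v`. -/
def IsKLFamily (n : ℕ) (B : MinCosetRep n → ParabolicModule n) : Prop :=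
  ∀ w, barParabolic n (B w) = B w ∧
    ∃ c : MinCosetRep n →₀ Polynomial ℤ, c w = 0 ∧
      B w = N w + c.sum fun v p => (q * Polynomial.toLaurent p) • N v

/-- The points `-2n, …, -1, 1, …, 2n` on the number line. -/
noncomputable def points (n : ℕ) : Finset ℤ := (Finset.Icc (-2 * n : ℤ) (2 * n)).erase 0

/-- `A` is the set of arcs `(left end, right end)` of a matching of the `4n` points, drawn without
intersections in the lower half plane, that corresponds to the sign sequence `f` (`1` stands for `+`
and `-1` for `-`): the left end of each arc is labeled `+`, the right end `-`. -/
structure IsMatching (n : ℕ) (f : ℤ → ℤ) (A : Finset (ℤ × ℤ)) : Prop where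
  mem_points : ∀ p ∈ A, p.1 ∈ points n ∧ p.2 ∈ points n
  label : ∀ p ∈ A, p.1 < p.2 ∧ f p.1 = 1 ∧ f p.2 = -1
  cover : ∀ k ∈ points n, ∃! p, p ∈ A ∧ (p.1 = k ∨ p.2 = k)
  noncrossing : ∀ p ∈ A, ∀ p' ∈ A, ¬ (p.1 < p'.1 ∧ p'.1 < p.2 ∧ p.2 < p'.2)

/-- The matching that corresponds to the sign sequence `f`: a `+` is joined to the first `-` to its
right such that the signs from the one to the other add up to zero. By `isMatching_matching` and
`IsMatching.eq_matching` this is the one and only matching corresponding to `f`. -/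
noncomputable def matching (n : ℕ) (f : ℤ → ℤ) : Finset (ℤ × ℤ) :=
  (points n ×ˢ points n).filter fun p =>
    p.1 < p.2 ∧ f p.1 = 1 ∧ f p.2 = -1 ∧ ∑ k ∈ Finset.Icc p.1 p.2, f k = 0 ∧
      ∀ c ∈ Finset.Ico p.1 p.2, 0 < ∑ k ∈ Finset.Icc p.1 c, f k

/-- The sign sequences on the `4n` points that have a corresponding matching. -/
structure IsBallot (n : ℕ) (f : ℤ → ℤ) : Prop where
  sign : ∀ k ∈ points n, f k = 1 ∨ f k = -1
  zero : f 0 = 0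
  total : ∑ k ∈ Finset.Icc (-2 * n : ℤ) (2 * n), f k = 0
  nonneg : ∀ c ≤ (2 * n : ℤ), 0 ≤ ∑ k ∈ Finset.Icc (-2 * n : ℤ) c, f k

lemma sum_Icc_step (f : ℤ → ℤ) {m k : ℤ} (h : m ≤ k) :
    ∑ j ∈ Finset.Icc m k, f j = ∑ j ∈ Finset.Icc m (k - 1), f j + f k := by
  have : Finset.Icc m k = insert k (Finset.Icc m (k - 1)) := by
    ext x; simp only [Finset.mem_Icc, Finset.mem_insert]; omega
  rw [this, Finset.sum_insert (by simp), add_comm]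

lemma sum_Icc_split (f : ℤ → ℤ) {m a c : ℤ} (h : m ≤ a) (h' : a ≤ c + 1) :
    ∑ j ∈ Finset.Icc a c, f j =
      ∑ j ∈ Finset.Icc m c, f j - ∑ j ∈ Finset.Icc m (a - 1), f j := by
  have : Finset.Icc m c = Finset.Icc m (a - 1) ∪ Finset.Icc a c := by
    ext x; simp only [Finset.mem_Icc, Finset.mem_union]; omega
  rw [this, Finset.sum_union, add_sub_cancel_left]
  rw [Finset.disjoint_left]
  intro x
  simp only [Finset.mem_Icc]; omega

lemma mem_points_iff {n : ℕ} {k : ℤ} : k ∈ points n ↔ k ≠ 0 ∧ -2 * n ≤ k ∧ k ≤ 2 * n := by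
  simp [points]

lemma mem_matching_iff {n : ℕ} {f : ℤ → ℤ} {F : ℤ → ℤ}
    (hF : F = fun c => ∑ k ∈ Finset.Icc (-2 * n : ℤ) c, f k) {p : ℤ × ℤ} :
    p ∈ matching n f ↔ p.1 ∈ points n ∧ p.2 ∈ points n ∧ p.1 < p.2 ∧ f p.1 = 1 ∧ f p.2 = -1 ∧
      F p.2 = F (p.1 - 1) ∧ ∀ c, p.1 ≤ c → c < p.2 → F (p.1 - 1) < F c := by
  subst hF
  simp only [matching, Finset.mem_filter, Finset.mem_product, and_assoc]
  refine and_congr_right fun h1 => and_congr_right fun h2 => and_congr_right fun h3 =>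
    and_congr_right fun _ => and_congr_right fun _ => ?_
  have hm := (mem_points_iff.1 h1).2.1
  rw [sum_Icc_split f hm (by omega), sub_eq_zero]
  refine and_congr_right fun _ => ?_
  constructor
  · intro h c hc hc'
    have := h c (Finset.mem_Ico.2 ⟨hc, hc'⟩)
    rw [sum_Icc_split f hm (by omega)] at this
    linarith
  · intro h c hc
    obtain ⟨hc, hc'⟩ := Finset.mem_Ico.1 hc
    have := h c hc hc'
    rw [sum_Icc_split f hm (by omega)]
    linarith

theorem isMatching_matching {n : ℕ} {f : ℤ → ℤ} (hf : IsBallot n f) :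
    IsMatching n f (matching n f) := by
  obtain ⟨F, hF⟩ : ∃ F : ℤ → ℤ, F = fun c => ∑ k ∈ Finset.Icc (-2 * n : ℤ) c, f k := ⟨_, rfl⟩
  have step : ∀ k, -2 * (n : ℤ) ≤ k → F k = F (k - 1) + f k := fun k hk => by
    rw [hF]; exact sum_Icc_step f hk
  have F0 : F (-2 * n - 1) = 0 := by rw [hF]; simp
  have F1 : F (2 * n) = 0 := by rw [hF]; exact hf.total
  have Fn : ∀ c ≤ (2 * n : ℤ), 0 ≤ F c := by rw [hF]; exact hf.nonneg
  have bd : ∀ k, -2 * (n : ℤ) ≤ k → k ≤ 2 * n → -1 ≤ f k ∧ f k ≤ 1 := by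
    intro k h1 h2
    by_cases h0 : k = 0
    · rw [h0, hf.zero]; omega
    · have := hf.sign k (mem_points_iff.2 ⟨h0, h1, h2⟩); omega
  have mem := fun p : ℤ × ℤ => mem_matching_iff hF (p := p)
  refine ⟨fun p hp => ?_, fun p hp => ?_, fun k hk => ?_, fun p hp p' hp' h => ?_⟩
  · have := (mem p).1 hp; exact ⟨this.1, this.2.1⟩
  · have := (mem p).1 hp; exact ⟨this.2.2.1, this.2.2.2.1, this.2.2.2.2.1⟩
  · obtain ⟨k0, k1, k2⟩ := mem_points_iff.1 hk
    rcases hf.sign k hk with hs | hs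
    · obtain ⟨b, ⟨hb1, hb2, hb3⟩, hb⟩ := Int.exists_least_of_bdd
        (P := fun z => k ≤ z ∧ z ≤ 2 * n ∧ F z ≤ F (k - 1)) ⟨k, fun z h => h.1⟩
        ⟨2 * n, k2, le_rfl, by rw [F1]; exact Fn _ (by omega)⟩
      have hlt : ∀ c, k ≤ c → c < b → F (k - 1) < F c := by
        intro c h1 h2
        by_contra h3
        have := hb c ⟨h1, by omega, by omega⟩
        omega
      have hkb : k ≠ b := by
        rintro rfl
        have := step k k1; omega
      have h4 := hlt (b - 1) (by omega) (by omega)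
      have h5 := step b (by omega)
      have h6 := bd b (by omega) hb2
      have h7 : f b = -1 := by omega
      have hb0 : b ≠ 0 := by rintro rfl; rw [hf.zero] at h7; omega
      have hm : (k, b) ∈ matching n f := (mem _).2 ⟨hk, mem_points_iff.2 ⟨hb0, by omega, hb2⟩,
        by simp only; omega, hs, h7, by simp only; omega, hlt⟩
      refine ⟨(k, b), ⟨hm, Or.inl rfl⟩, ?_⟩
      rintro ⟨x, y⟩ ⟨hp, h | h⟩
      · simp only at h; subst h
        obtain ⟨-, -, g1, -, -, g2, g3⟩ := (mem _).1 hp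
        simp only at g1 g2 g3
        rcases lt_trichotomy y b with h | h | h
        · have := hlt y (by omega) h; omega
        · rw [h]
        · have := g3 b (by omega) h; omega
      · simp only at h; subst h
        have := ((mem _).1 hp).2.2.2.2.1
        simp only at this; omega
    · obtain ⟨z, ⟨hz1, hz2, hz3⟩, hz⟩ := Int.exists_greatest_of_bdd
        (P := fun z => z ≤ k - 1 ∧ -2 * (n : ℤ) - 1 ≤ z ∧ F z ≤ F k) ⟨k - 1, fun z h => h.1⟩
        ⟨-2 * n - 1, by omega, le_rfl, by rw [F0]; exact Fn _ (by omega)⟩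
      have hlt : ∀ c, z + 1 ≤ c → c < k → F k < F c := by
        intro c h1 h2
        by_contra h3
        have := hz c ⟨by omega, by omega, by omega⟩
        omega
      have hkb : z ≠ k - 1 := by
        rintro rfl
        have := step k k1; omega
      have h4 := hlt (z + 1) (by omega) (by omega)
      have h5 := step (z + 1) (by omega)
      have h6 := bd (z + 1) (by omega) (by omega)
      rw [add_sub_cancel_right] at h5
      have h7 : f (z + 1) = 1 := by omega
      have hb0 : z + 1 ≠ 0 := by intro h; rw [h, hf.zero] at h7; omega
      have hm : (z + 1, k) ∈ matching n f :=
        (mem _).2 ⟨mem_points_iff.2 ⟨hb0, by omega, by omega⟩, hk,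
        by simp only; omega, h7, hs, by simp only [add_sub_cancel_right]; omega,
        fun c h1 h2 => by
          have := hlt c h1 h2
          simp only [add_sub_cancel_right]; omega⟩
      refine ⟨(z + 1, k), ⟨hm, Or.inr rfl⟩, ?_⟩
      rintro ⟨x, y⟩ ⟨hp, h | h⟩
      · simp only at h; subst h
        have := ((mem _).1 hp).2.2.2.1
        simp only at this; omega
      · simp only at h; subst h
        obtain ⟨g0, -, g1, -, -, g2, g3⟩ := (mem _).1 hp
        simp only at g1 g2 g3
        rcases lt_trichotomy x (z + 1) with h | h | h
        · have := g3 z (by omega) (by omega); omega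
        · rw [h]
        · have := hlt (x - 1) (by omega) (by omega); omega
  · obtain ⟨-, -, g1, -, -, g2, g3⟩ := (mem _).1 hp
    obtain ⟨-, -, g1', -, -, g2', g3'⟩ := (mem _).1 hp'
    have a1 := g3 (p'.1 - 1) (by omega) (by omega)
    have a2 := g3' p.2 (by omega) (by omega)
    omega

theorem IsMatching.eq_matching {n : ℕ} {f : ℤ → ℤ} (hf : IsBallot n f) {A : Finset (ℤ × ℤ)}
    (hA : IsMatching n f A) : A = matching n f := by
  obtain ⟨F, hF⟩ : ∃ F : ℤ → ℤ, F = fun c => ∑ k ∈ Finset.Icc (-2 * n : ℤ) c, f k := ⟨_, rfl⟩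
  have step : ∀ k, -2 * (n : ℤ) ≤ k → F k = F (k - 1) + f k := fun k hk => by
    rw [hF]; exact sum_Icc_step f hk
  have key : ∀ d : ℕ, ∀ a b : ℤ, (a, b) ∈ A → b - a = d →
      F b = F (a - 1) ∧ ∀ c, a ≤ c → c < b → F (a - 1) < F c := by
    intro d
    induction d using Nat.strong_induction_on with
    | _ d ih =>
    intro a b hab hd
    obtain ⟨pa, pb⟩ := hA.mem_points _ hab
    obtain ⟨hlt, fa, fb⟩ := hA.label _ hab
    simp only at pa pb hlt fa fb
    have pa' := mem_points_iff.1 pa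
    have pb' := mem_points_iff.1 pb
    have up : ∀ m : ℕ, a + m < b → F a ≤ F (a + m) := by
      intro m
      induction m using Nat.strong_induction_on with
      | _ m ihm =>
      intro hm
      rcases Nat.eq_zero_or_pos m with h0 | h0
      · simp [h0]
      have st := step (a + m) (by omega)
      have pr := ihm (m - 1) (by omega) (by omega)
      rw [show a + ((m - 1 : ℕ) : ℤ) = a + m - 1 by omega] at pr
      by_cases hz : a + (m : ℤ) = 0
      · rw [hz, hf.zero] at st; rw [hz] at pr ⊢; omega
      have pc : a + (m : ℤ) ∈ points n := mem_points_iff.2 ⟨hz, by omega, by omega⟩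
      rcases hf.sign _ pc with h | h
      · omega
      obtain ⟨⟨l, r⟩, ⟨hp, hp'⟩, -⟩ := hA.cover _ pc
      obtain ⟨k1, k2, k3⟩ := hA.label _ hp
      simp only at k1 k2 k3 hp'
      have hr : r = a + m := by
        rcases hp' with h' | h'
        · rw [h'] at k2; omega
        · exact h'
      subst hr
      have n1 := hA.noncrossing _ hp _ hab
      simp only at n1
      have hla : l ≠ a := by
        rintro rfl
        have := (hA.cover _ pa).unique ⟨hp, Or.inl rfl⟩ ⟨hab, Or.inl rfl⟩
        simp only [Prod.mk.injEq] at this; omega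
      have := (ih (a + m - l).toNat (by omega) l _ hp (by omega)).1
      have q := ihm (l - 1 - a).toNat (by omega) (by omega)
      rw [show a + (((l - 1 - a).toNat : ℕ) : ℤ) = l - 1 by omega] at q
      omega
    have down : ∀ m : ℕ, a ≤ b - 1 - m → F (b - 1) ≤ F (b - 1 - m) := by
      intro m
      induction m using Nat.strong_induction_on with
      | _ m ihm =>
      intro hm
      rcases Nat.eq_zero_or_pos m with h0 | h0
      · simp [h0]
      have st := step (b - m) (by omega)
      have pr := ihm (m - 1) (by omega) (by omega)
      rw [show b - 1 - ((m - 1 : ℕ) : ℤ) = b - m by omega] at pr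
      rw [show b - 1 - (m : ℤ) = b - m - 1 by omega]
      by_cases hz : b - (m : ℤ) = 0
      · rw [hz, hf.zero] at st; rw [hz] at pr ⊢; omega
      have pc : b - (m : ℤ) ∈ points n := mem_points_iff.2 ⟨hz, by omega, by omega⟩
      rcases hf.sign _ pc with h | h
      swap
      · omega
      obtain ⟨⟨l, r⟩, ⟨hp, hp'⟩, -⟩ := hA.cover _ pc
      obtain ⟨k1, k2, k3⟩ := hA.label _ hp
      simp only at k1 k2 k3 hp'
      have hr : l = b - m := by
        rcases hp' with h' | h'
        · exact h'
        · rw [h'] at k3; omega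
      subst hr
      have n1 := hA.noncrossing _ hab _ hp
      simp only at n1
      have hla : r ≠ b := by
        rintro rfl
        have := (hA.cover _ pb).unique ⟨hp, Or.inr rfl⟩ ⟨hab, Or.inr rfl⟩
        simp only [Prod.mk.injEq] at this; omega
      have := (ih (r - (b - m)).toNat (by omega) _ _ hp (by omega)).1
      have q := ihm (b - 1 - r).toNat (by omega) (by omega)
      rw [show b - 1 - (((b - 1 - r).toNat : ℕ) : ℤ) = r by omega] at q
      omega
    have u := up (b - 1 - a).toNat (by omega)
    have v := down (b - 1 - a).toNat (by omega)
    rw [show a + (((b - 1 - a).toNat : ℕ) : ℤ) = b - 1 by omega] at u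
    rw [show b - 1 - (((b - 1 - a).toNat : ℕ) : ℤ) = a by omega] at v
    have sa := step a (by omega)
    have sb := step b (by omega)
    refine ⟨by omega, fun c h1 h2 => ?_⟩
    have w := up (c - a).toNat (by omega)
    rw [show a + (((c - a).toNat : ℕ) : ℤ) = c by omega] at w
    omega
  have sub : A ⊆ matching n f := by
    rintro ⟨a, b⟩ hab
    obtain ⟨pa, pb⟩ := hA.mem_points _ hab
    obtain ⟨hlt, fa, fb⟩ := hA.label _ hab
    obtain ⟨k1, k2⟩ := key (b - a).toNat a b hab (by simp only at hlt; omega)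
    exact (mem_matching_iff hF).2 ⟨pa, pb, hlt, fa, fb, k1, k2⟩
  refine sub.antisymm ?_
  rintro ⟨a, b⟩ hab
  have hM := isMatching_matching hf
  obtain ⟨pa, -⟩ := hM.mem_points _ hab
  obtain ⟨-, fa, -⟩ := hM.label _ hab
  obtain ⟨⟨l, r⟩, ⟨hp, h | h⟩, -⟩ := hA.cover _ pa
  · have := (hM.cover _ pa).unique ⟨sub hp, Or.inl h⟩ ⟨hab, Or.inl rfl⟩
    rwa [← this]
  · have := (hA.label _ hp).2.2
    simp only at h this fa
    rw [h] at this; omega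

lemma isBallot_of_odd {n : ℕ} {f : ℤ → ℤ} (hs : ∀ k ∈ points n, f k = 1 ∨ f k = -1)
    (hodd : ∀ k, f (-k) = -f k) (hfr : ∀ k : ℤ, -2 * n ≤ k → k < -n → f k = 1) :
    IsBallot n f := by
  have h0 : f 0 = 0 := by have := hodd 0; rw [neg_zero] at this; omega
  have sym : ∀ m : ℤ, ∑ k ∈ Finset.Icc (-m) m, f k = 0 := by
    intro m
    have : ∑ k ∈ Finset.Icc (-m) m, f k = ∑ k ∈ Finset.Icc (-m) m, f (-k) :=
      Finset.sum_nbij' (fun k => -k) (fun k => -k)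
        (fun k hk => by simp only [Finset.mem_Icc] at hk ⊢; omega)
        (fun k hk => by simp only [Finset.mem_Icc] at hk ⊢; omega) (by simp) (by simp) (by simp)
    simp only [hodd, Finset.sum_neg_distrib] at this
    omega
  have neg : ∀ m : ℕ, -2 * (n : ℤ) - 1 + m < 0 →
      0 ≤ ∑ k ∈ Finset.Icc (-2 * n : ℤ) (-2 * n - 1 + m), f k := by
    have aux : ∀ m : ℕ, -2 * (n : ℤ) - 1 + m < 0 →
      min (m : ℤ) (2 * n - m) ≤ ∑ k ∈ Finset.Icc (-2 * n : ℤ) (-2 * n - 1 + m), f k := by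
      intro m
      induction m with
      | zero => simp
      | succ m ih =>
        intro hm
        have ih' := ih (by push_cast at hm; omega)
        rw [sum_Icc_step f (by push_cast; omega)]
        push_cast at hm ⊢
        rw [show -2 * (n : ℤ) - 1 + (m + 1) - 1 = -2 * n - 1 + m by ring]
        have hk := hs (-2 * (n : ℤ) - 1 + (m + 1)) (mem_points_iff.2 ⟨by omega, by omega, by omega⟩)
        by_cases hlt : -2 * (n : ℤ) - 1 + (m + 1) < -n
        · have := hfr _ (by omega) hlt
          omega
        · omega
    intro m hm
    have := aux m hm
    omega
  have neg' : ∀ c : ℤ, c < 0 → 0 ≤ ∑ k ∈ Finset.Icc (-2 * n : ℤ) c, f k := by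
    intro c hc
    by_cases h : c < -2 * n
    · rw [Finset.Icc_eq_empty (by omega)]; simp
    · have := neg (c + 2 * n + 1).toNat (by omega)
      rwa [show -2 * (n : ℤ) - 1 + ((c + 2 * n + 1).toNat : ℤ) = c by omega] at this
  refine ⟨hs, h0, ?_, fun c hc => ?_⟩
  · have := sym (2 * n); rwa [← neg_mul] at this
  · by_cases h : c < 0
    · exact neg' c h
    · have h1 := sum_Icc_split f (m := -2 * n) (a := -c) (c := c) (by omega) (by omega)
      have h2 := neg' (-c - 1) (by omega)
      have h3 := sym c
      omega

/-- The sign sequence `α_w` on `{±1, …, ±n}` attached to the coset of `w` (`1` stands for `+` and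
`-1` for `-`). It is `[- ⋯ - | + ⋯ +]` for the identity, and passing from `w` to `w s_i` permutes the
places by `Ψ(s_i)`. It is extended to the left by `n` frozen pluses and to the right by `n` frozen
minuses; the value at the remaining integers, including `0`, is `0`. -/
def extSeq {n : ℕ} (w : W n) (k : ℤ) : ℤ :=
  if |k| ≤ n then (Psi n w k).sign else if |k| ≤ 2 * n then -k.sign else 0

lemma isBallot_extSeq {n : ℕ} (w : W n) : IsBallot n (extSeq w) := by
  have h0 : Psi n w 0 = 0 := by have := Psi_neg w 0; rw [neg_zero] at this; omega
  apply isBallot_of_odd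
  · intro k hk
    obtain ⟨k0, k1, k2⟩ := mem_points_iff.1 hk
    unfold extSeq
    have hk' : |k| ≤ 2 * n := abs_le.2 ⟨by omega, k2⟩
    have h1 : Psi n w k ≠ 0 := fun h => k0 ((Psi n w).injective (h.trans h0.symm))
    split_ifs
    · rcases lt_or_gt_of_ne h1 with h | h
      · exact Or.inr (Int.sign_eq_neg_one_of_neg h)
      · exact Or.inl (Int.sign_eq_one_of_pos h)
    · rcases lt_or_gt_of_ne k0 with h | h
      · left; rw [Int.sign_eq_neg_one_of_neg h]; rfl
      · right; rw [Int.sign_eq_one_of_pos h]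
  · intro k
    unfold extSeq
    rw [abs_neg, Psi_neg, Int.sign_neg, Int.sign_neg]
    split_ifs <;> simp
  · intro k h1 h2
    have h3 : |k| = -k := abs_of_neg (by omega)
    unfold extSeq
    rw [h3, if_neg (by omega), if_pos (by omega), Int.sign_eq_neg_one_of_neg (by omega)]
    rfl

/-- The arcs of a matching that cross the middle. -/
def crossing (A : Finset (ℤ × ℤ)) : Finset (ℤ × ℤ) := A.filter fun p => p.1 < 0 ∧ 0 < p.2

/-- The number of arcs crossing the middle that lie between `(0, 0)` and the crossing arc `p`. -/
def depth (A : Finset (ℤ × ℤ)) (p : ℤ × ℤ) : ℕ := ((crossing A).filter fun p' => p'.2 < p.2).card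

/-- The cups of the cup diagram `C(w)`, as pairs (left end, right end). The arcs of the matching that
do not cross the middle are kept. The arcs crossing the middle are paired, starting with the two
innermost ones, and the two arcs `(a, b)`, `(a', b')` of a pair are replaced by the two linked cups
`(a, b')`, `(a', b)`. So the linked cups are exactly those that cross the middle, and the decorations
contain no further information. -/
noncomputable def cupDiagram {n : ℕ} (w : W n) : Finset (ℤ × ℤ) :=
  let A := matching n (extSeq w)
  (A \ crossing A) ∪ ((crossing A ×ˢ crossing A).filter fun z =>
    z.1 ≠ z.2 ∧ depth A z.1 / 2 = depth A z.2 / 2).image fun z => (z.1.1, z.2.2)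

/-- The labels of diagrammatical weights. -/
inductive Arrow : Type
  | up
  | down
  deriving DecidableEq

/-- The label of the extended diagrammatical weight of `w` at one of the `4n` points: every `+` is
replaced by `down` and every `-` by `up`. -/
def diagWeight {n : ℕ} (w : W n) (k : ℤ) : Arrow := if extSeq w k = 1 then Arrow.down else Arrow.up

/-- The diagram `vC(w)` is oriented: each cup has exactly one end labeled `up` and exactly one end
labeled `down`. -/
def IsOriented {n : ℕ} (v w : MinCosetRep n) : Prop :=
  ∀ p ∈ cupDiagram w.1, diagWeight v.1 p.1 ≠ diagWeight v.1 p.2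

/-- The number `cl(vC(w))` of clockwise oriented cups, i.e. cups whose left end is labeled `up` and
whose right end is labeled `down`. Each of two linked cups counts as a cup. -/
noncomputable def cl {n : ℕ} (v w : MinCosetRep n) : ℕ :=
  ((cupDiagram w.1).filter fun p =>
    diagWeight v.1 p.1 = Arrow.up ∧ diagWeight v.1 p.2 = Arrow.down).card

/-- The free `ℤ[q, q⁻¹]`-module with the weights of the elements of `W^p` as its basis. -/
abbrev MD (n : ℕ) : Type := MinCosetRep n →₀ L

/-- The element `C(w)_{M_D}`: the sum of `q^{cl(vC(w))/2} v` over all weights `v` such that `vC(w)` is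
oriented. -/
noncomputable def cupElement {n : ℕ} (w : MinCosetRep n) : MD n :=
  ∑ᶠ (v : MinCosetRep n) (_ : IsOriented v w), Finsupp.single v (q ^ (cl v w / 2))

/-- The canonical map `Φ` sending the weight of `w` to `N_w`. -/
noncomputable def Phi (n : ℕ) : MD n →ₗ[L] ParabolicModule n := Finsupp.linearCombination L N

end GraphicalKL

namespace GraphicalKL

open LaurentPolynomial TensorProduct

/-! ### The exchange condition. -/

section Coxeter

variable {n : ℕ}

/-! A coset of `W_p` is determined by the signs of `Ψ(w)` at the places `1, …, n`, a sequence with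
an even number of minuses, and its shortest representative has length the sum of `k - 1` over the
places `k` with a minus (`isGood_of_len_lt`, `IsGood.eq_of_signSeq_eq`). In these terms right
multiplication by `C_s` is explicit: `N_w C_s` is `N_{ws} + q N_w` if `s` raises the sequence,
`N_{ws} + q⁻¹ N_w` if `s` lowers it, and `0` if `s` fixes it, because then `ws = rw` with a simple
`r` in `W_p`.

The cup diagram is symmetric under `k ↦ -k`, so it can be folded onto the positive places. A cup and
its mirror image become one folded cup, oriented if its ends carry opposite signs; two linked cups
become one folded cup, oriented if its ends carry equal signs. A folded cup is clockwise exactly if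
it is oriented with a plus at its right end. Each stands for two cups of the diagram, which is why
`cl` is even and is halved (`isOriented_iff`, `cl_eq`). The function `scan` evaluates the folded
diagram with a stack of open cups, and `scan_eq_ite` identifies its value with the coefficient in
the theorem.

If `w = u s_i` is longer than `u`, then `C(w)` has a small folded cup at `i, i + 1` (a linked one at
`1, 2` for `i = 0`). Comparing the diagrams of `w` and `u` gives three local rules,
`cupCoeff_eq_zero`, `cupCoeff_of_isAsc` and `cupCoeff_act_act`. Together they say that the diagram
element of `w` is that of `u` times `C_i`, with no correction terms (`klElement_eq_rightMul`). Since
`C_i` is fixed by the bar involution, so are all diagram elements, by induction from `N_e`. Their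
coefficients are visibly `1` on the diagonal and zero or positive powers of `q` elsewhere.
Uniqueness is the usual argument: the bar involution is unitriangular with respect to length, and
`qℤ[q]` has no nonzero element fixed by `q ↦ q⁻¹` (`eq_zero_of_barParabolic_eq`).

As the Hecke algebra is given by a presentation, the independence of the `N_w` needs an argument
too. The exchange condition makes left and right multiplication operators on the free module on `W`
commute, which yields the regular representation; the functional `H_w ↦ (-q)^{l(w)}` times the sign
sequence of `w` then descends to the parabolic module and separates the `N_w`
(`linearIndependent_N`). -/

lemma s_eq_simple (i : Fin n) : (coxeterMatrix n).toCoxeterSystem.simple i = s i := rfl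

lemma s_mul_self (i : Fin n) : (s i * s i : W n) = 1 :=
  (coxeterMatrix n).toCoxeterSystem.simple_mul_simple_self i

lemma s_inv (i : Fin n) : (s i : W n)⁻¹ = s i :=
  (coxeterMatrix n).toCoxeterSystem.inv_simple i

lemma s_mul_cancel_left (i : Fin n) (w : W n) : s i * (s i * w) = w := by
  rw [← mul_assoc, s_mul_self, one_mul]

lemma s_mul_cancel_right (i : Fin n) (w : W n) : w * s i * s i = w := by
  rw [mul_assoc, s_mul_self, mul_one]

lemma s_commute {i j : Fin n} (h : ¬ adj i j) : (s i * s j : W n) = s j * s i := by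
  by_cases hij : i = j
  · rw [hij]
  have := (coxeterMatrix n).toCoxeterSystem.simple_mul_simple_pow i j
  rw [show (coxeterMatrix n).M i j = 2 by simp [coxeterMatrix, hij, h]] at this
  rw [s_eq_simple, s_eq_simple, pow_two] at this
  rw [mul_eq_one_iff_eq_inv.1 this, mul_inv_rev, s_inv, s_inv]

lemma adj_irrefl (i : ℕ) : ¬ adj i i := by simp only [adj]; omega

lemma s_braid {i j : Fin n} (h : adj i j) : (s i * s j * s i : W n) = s j * s i * s j := by
  have hij : i ≠ j := by rintro rfl; exact adj_irrefl _ h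
  have := (coxeterMatrix n).toCoxeterSystem.simple_mul_simple_pow i j
  rw [show (coxeterMatrix n).M i j = 3 by simp [coxeterMatrix, hij, h]] at this
  rw [s_eq_simple, s_eq_simple] at this
  have h2 : (s i * s j * s i) * (s j * s i * s j : W n) = 1 := by
    rw [← this]; simp only [pow_succ, pow_zero, one_mul, mul_assoc]
  rw [mul_eq_one_iff_eq_inv.1 h2]; simp only [mul_inv_rev, s_inv, mul_assoc]

lemma len_one : len (1 : W n) = 0 := (coxeterMatrix n).toCoxeterSystem.length_one

lemma len_s (i : Fin n) : len (s i : W n) = 1 := (coxeterMatrix n).toCoxeterSystem.length_simple i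

lemma len_mul_s (w : W n) (i : Fin n) : len (w * s i) = len w + 1 ∨ len (w * s i) + 1 = len w :=
  (coxeterMatrix n).toCoxeterSystem.length_mul_simple w i

lemma len_s_mul (w : W n) (i : Fin n) : len (s i * w) = len w + 1 ∨ len (s i * w) + 1 = len w :=
  (coxeterMatrix n).toCoxeterSystem.length_simple_mul w i

lemma exists_left_factor {w : W n} (hw : w ≠ 1) :
    ∃ (i : Fin n) (u : W n), w = s i * u ∧ len w = len u + 1 := by
  obtain ⟨i, hi⟩ := (coxeterMatrix n).toCoxeterSystem.exists_leftDescent_of_ne_one hw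
  exact ⟨i, s i * w, (s_mul_cancel_left i w).symm,
    (((coxeterMatrix n).toCoxeterSystem.isLeftDescent_iff).1 hi).symm⟩

lemma exists_right_factor {w : W n} (hw : w ≠ 1) :
    ∃ (i : Fin n) (u : W n), w = u * s i ∧ len w = len u + 1 := by
  obtain ⟨i, hi⟩ := (coxeterMatrix n).toCoxeterSystem.exists_rightDescent_of_ne_one hw
  exact ⟨i, w * s i, (s_mul_cancel_right i w).symm,
    (((coxeterMatrix n).toCoxeterSystem.isRightDescent_iff).1 hi).symm⟩

open Classical in
/-- Conjugation by `s_i` on the first component; the second component records the parity of how often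
the first one has been equal to the conjugating reflection. -/
noncomputable def signedConj (i : Fin n) : Function.End (W n × ZMod 2) :=
  fun p => (s i * p.1 * s i, p.2 + if p.1 = s i then 1 else 0)

open Classical in
lemma signedConj_apply (i : Fin n) (x : W n) (e : ZMod 2) :
    signedConj i (x, e) = (s i * x * s i, e + if x = s i then 1 else 0) := rfl

lemma end_mul_apply {X : Type*} (f g : Function.End X) (x : X) : (f * g) x = f (g x) := rfl

lemma end_one_apply {X : Type*} (x : X) : (1 : Function.End X) x = x := rfl

lemma conj_s_eq_iff (i : Fin n) (x y : W n) : s i * x * s i = y ↔ x = s i * y * s i := by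
  constructor <;> rintro rfl <;> simp only [mul_assoc, s_mul_self, mul_one, s_mul_cancel_left]

/-- Along the relator of `i` and `j` each reflection of the dihedral group they generate is met
exactly twice, so the parities cancel modulo two. -/
lemma signedConj_liftable (n : ℕ) : (coxeterMatrix n).IsLiftable (signedConj (n := n)) := by
  classical
  intro i j
  have z2 : ∀ a : ZMod 2, a + a = 0 := fun a => CharTwo.add_self_eq_zero a
  change (signedConj i * signedConj j) ^ (if i = j then 1 else if adj i j then 3 else 2) = 1
  split_ifs with h1 h2
  · subst h1
    rw [pow_one]
    funext ⟨x, e⟩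
    simp only [end_mul_apply, end_one_apply, signedConj_apply, conj_s_eq_iff]
    simp only [mul_assoc, s_mul_self, mul_one, one_mul, s_mul_cancel_left, add_assoc, z2,
      add_zero]
  · have hb := s_braid h2
    have e1 : s j * (s i * s j) = s i * (s j * s i) := by simpa only [mul_assoc] using hb.symm
    have e2 (y : W n) : s j * (s i * (s j * y)) = s i * (s j * (s i * y)) := by
      simpa only [mul_assoc] using congrArg (· * y) hb.symm
    funext ⟨x, e⟩
    simp only [pow_succ, pow_zero, one_mul]
    simp only [end_mul_apply, end_one_apply, signedConj_apply, conj_s_eq_iff]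
    simp only [mul_assoc, s_mul_self, mul_one, one_mul, s_mul_cancel_left, e1, e2]
    congr 1
    generalize (if x = s j then (1 : ZMod 2) else 0) = a
    generalize (if x = s i then (1 : ZMod 2) else 0) = b
    generalize (if x = s i * (s j * s i) then (1 : ZMod 2) else 0) = c
    linear_combination z2 a + z2 b + z2 c
  · have hb := s_commute h2
    have e2 (y : W n) : s j * (s i * y) = s i * (s j * y) := by
      simpa only [mul_assoc] using congrArg (· * y) hb.symm
    funext ⟨x, e⟩
    simp only [pow_succ, pow_zero, one_mul]
    simp only [end_mul_apply, end_one_apply, signedConj_apply, conj_s_eq_iff]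
    simp only [mul_assoc, s_mul_self, mul_one, one_mul, s_mul_cancel_left, ← hb, e2]
    congr 1
    generalize (if x = s j then (1 : ZMod 2) else 0) = a
    generalize (if x = s i then (1 : ZMod 2) else 0) = b
    linear_combination z2 a + z2 b

/-- The action of `W` on pairs by signed conjugation. -/
noncomputable def signedConjHom (n : ℕ) : W n →* Function.End (W n × ZMod 2) :=
  (coxeterMatrix n).toCoxeterSystem.lift ⟨signedConj, signedConj_liftable n⟩

lemma signedConjHom_s (i : Fin n) : signedConjHom n (s i) = signedConj i :=
  CoxeterSystem.lift_apply_simple _ _ _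

/-- The parity of the number of times the reflection `x` occurs in the right inversion sequence of an
expression of `w`. -/
noncomputable def inversionParity (w x : W n) : ZMod 2 := (signedConjHom n w (x, 0)).2

lemma signedConjHom_apply (w x : W n) (e : ZMod 2) :
    signedConjHom n w (x, e) = (w * x * w⁻¹, e + inversionParity w x) := by
  induction w using (coxeterMatrix n).toCoxeterSystem.simple_induction_left generalizing x e with
  | one => simp [inversionParity, end_one_apply]
  | mul_simple_left w i ih =>
    have key : ∀ e', signedConjHom n (s i * w) (x, e') = signedConj i (signedConjHom n w (x, e')) := by
      intro e'
      rw [map_mul, signedConjHom_s]; rfl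
    rw [s_eq_simple, inversionParity, key, key, ih, ih]
    simp [signedConj, mul_assoc, s_inv, add_assoc]

open Classical in
lemma inversionParity_s_mul (i : Fin n) (w x : W n) :
    inversionParity (s i * w) x =
      inversionParity w x + if w * x * w⁻¹ = s i then 1 else 0 := by
  have key : signedConjHom n (s i * w) (x, 0) = signedConj i (signedConjHom n w (x, 0)) := by
    rw [map_mul, signedConjHom_s]; rfl
  rw [inversionParity, key, signedConjHom_apply]
  simp [signedConj]

lemma inversionParity_mul_s (w : W n) (i : Fin n) :
    inversionParity (w * s i) (s i) = 1 + inversionParity w (s i) := by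
  have key : signedConjHom n (w * s i) (s i, 0) = signedConjHom n w (signedConj i (s i, 0)) := by
    rw [map_mul, signedConjHom_s]; rfl
  rw [inversionParity, key]
  simp [signedConj, signedConjHom_apply, s_mul_self]

/-- Odd parity means that `x` occurs among the inversions of a reduced expression, and the
corresponding letter can be deleted. With `w = s_i u`: either `u x u⁻¹ = s_i`, and then `w x = u`,
or the parity is already odd for `u`. -/
lemma len_mul_lt_of_inversionParity {w x : W n} (h : inversionParity w x ≠ 0) :
    len (w * x) < len w := by
  classical
  induction hk : len w generalizing w with
  | zero =>
    rw [(coxeterMatrix n).toCoxeterSystem.length_eq_zero_iff] at hk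
    subst hk
    simp [inversionParity, end_one_apply] at h
  | succ k ih =>
    have hw : w ≠ 1 := by rintro rfl; rw [len_one] at hk; omega
    obtain ⟨i, u, rfl, hu⟩ := exists_left_factor hw
    rw [inversionParity_s_mul] at h
    by_cases hx : u * x * u⁻¹ = s i
    · have : s i * u * x = u := by
        rw [mul_assoc, show u * x = s i * u by rw [← hx]; simp [mul_assoc], s_mul_cancel_left]
      rw [this]; omega
    · rw [if_neg hx, add_zero] at h
      have := ih h (by omega)
      rw [mul_assoc]
      have := len_s_mul (u * x) i
      omega

/-- Multiplication by `s_i` flips the parity at `s_i`, so exactly one of `w`, `w s_i` has odd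
parity, and it is the longer one. -/
lemma inversionParity_ne_zero_iff {w : W n} {i : Fin n} :
    inversionParity w (s i) ≠ 0 ↔ len (w * s i) < len w := by
  refine ⟨len_mul_lt_of_inversionParity, fun h h0 => ?_⟩
  have h1 := inversionParity_mul_s w i
  rw [h0, add_zero] at h1
  have := len_mul_lt_of_inversionParity (x := s i) (h1 ▸ one_ne_zero)
  rw [s_mul_cancel_right] at this
  omega

/-- A case of the exchange condition. -/
lemma s_mul_eq_mul_s {w : W n} {i j : Fin n}
    (h : ¬ (len (w * s j) < len w ↔ len (s i * w * s j) < len (s i * w))) :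
    s i * w = w * s j := by
  classical
  by_contra hne
  apply h
  -- Passing from `w` to `s_i w` changes the parity at `s_j` only if `w s_j w⁻¹ = s_i`.
  rw [← inversionParity_ne_zero_iff, ← inversionParity_ne_zero_iff, inversionParity_s_mul, if_neg,
    add_zero]
  intro h'
  exact hne (by rw [← h']; simp [mul_assoc])

end Coxeter

/-! ### The regular representation of the Hecke algebra. -/

section RegularRepresentation

variable {n : ℕ}

/-- The first equivalence is the exchange condition. In the square `w, s_i w, w s_j, s_i w s_j`
lengths change by one along each edge, so agreement on one pair of parallel edges forces it on the
other. -/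
lemma len_lt_iff_of_ne {w : W n} {i j : Fin n} (h : s i * w ≠ w * s j) :
    (len (w * s j) < len w ↔ len (s i * w * s j) < len (s i * w)) ∧
      (len (s i * w) < len w ↔ len (s i * (w * s j)) < len (w * s j)) := by
  have h1 : len (w * s j) < len w ↔ len (s i * w * s j) < len (s i * w) :=
    not_not.1 (mt s_mul_eq_mul_s h)
  refine ⟨h1, ?_⟩
  have a1 := len_s_mul w i
  have a2 := len_mul_s w j
  have a3 := len_s_mul (w * s j) i
  have a4 := len_mul_s (s i * w) j
  rw [mul_assoc] at a4 h1
  omega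

/-- Left multiplication by `H_{s_i}` on the free module on `W`. -/
noncomputable def leftOp (i : Fin n) : Module.End L (W n →₀ L) :=
  Finsupp.lift _ L _ fun w => Finsupp.single (s i * w) 1 +
    (if len (s i * w) < len w then (T (-1) - q : L) else 0) • Finsupp.single w 1

/-- Right multiplication by `H_{s_i}` on the free module on `W`. -/
noncomputable def rightOp (i : Fin n) : Module.End L (W n →₀ L) :=
  Finsupp.lift _ L _ fun w => Finsupp.single (w * s i) 1 +
    (if len (w * s i) < len w then (T (-1) - q : L) else 0) • Finsupp.single w 1

lemma leftOp_single (i : Fin n) (w : W n) : leftOp i (Finsupp.single w 1) =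
    Finsupp.single (s i * w) 1 +
      (if len (s i * w) < len w then (T (-1) - q : L) else 0) • Finsupp.single w 1 := by
  simp [leftOp]

lemma rightOp_single (i : Fin n) (w : W n) : rightOp i (Finsupp.single w 1) =
    Finsupp.single (w * s i) 1 +
      (if len (w * s i) < len w then (T (-1) - q : L) else 0) • Finsupp.single w 1 := by
  simp [rightOp]

lemma end_ext_single {M : Type*} [AddCommGroup M] [Module L M] {f g : (W n →₀ L) →ₗ[L] M}
    (h : ∀ w, f (Finsupp.single w 1) = g (Finsupp.single w 1)) : f = g :=
  Finsupp.lhom_ext' fun w => LinearMap.ext_ring (h w)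

/-- If `s_i w ≠ w s_j`, the coefficients agree by `len_lt_iff_of_ne`. If `s_i w = w s_j`, both
operators act on the pair `w`, `w s_j` in the same way. -/
lemma leftOp_mul_rightOp (i j : Fin n) : leftOp i * rightOp j = rightOp j * leftOp i := by
  refine end_ext_single fun w => ?_
  simp only [Module.End.mul_apply, leftOp_single, rightOp_single, map_add, map_smul]
  by_cases h : s i * w = w * s j
  · rw [h, ← mul_assoc, h, s_mul_cancel_right]
  · obtain ⟨h1, h2⟩ := len_lt_iff_of_ne h
    rw [mul_assoc] at h1
    simp only [← h1, ← h2, mul_assoc, smul_add]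
    rw [smul_comm (if len (s i * w) < len w then (T (-1) - q : L) else 0)]
    abel

lemma leftOp_mul_self (i : Fin n) :
    leftOp i * leftOp i = (T (-1) - q : L) • leftOp i + 1 := by
  refine end_ext_single fun w => ?_
  simp only [Module.End.mul_apply, leftOp_single, map_add, map_smul, LinearMap.add_apply,
    LinearMap.smul_apply, Module.End.one_apply, s_mul_cancel_left]
  have := len_s_mul w i
  by_cases h : len (s i * w) < len w
  · rw [if_pos h, if_neg (by omega)]
    module
  · rw [if_neg h, if_pos (by omega)]
    module

/-- The basis vector of `e` generates the free module under the right operators: along a reduced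
word each letter adds no lower term. -/
lemma eq_of_commute_rightOp {f g : Module.End L (W n →₀ L)}
    (hf : ∀ j, f * rightOp j = rightOp j * f) (hg : ∀ j, g * rightOp j = rightOp j * g)
    (h : f (Finsupp.single 1 1) = g (Finsupp.single 1 1)) : f = g := by
  refine end_ext_single fun w => ?_
  induction hk : len w generalizing w with
  | zero =>
    rw [(coxeterMatrix n).toCoxeterSystem.length_eq_zero_iff] at hk
    rw [hk, h]
  | succ k ih =>
    have hw : w ≠ 1 := by rintro rfl; rw [len_one] at hk; omega
    obtain ⟨j, u, rfl, hu⟩ := exists_right_factor hw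
    have e : rightOp j (Finsupp.single u (1 : L)) = Finsupp.single (u * s j) 1 := by
      rw [rightOp_single, if_neg (by omega), zero_smul, add_zero]
    rw [← e, ← Module.End.mul_apply, ← Module.End.mul_apply, hf, hg, Module.End.mul_apply,
      Module.End.mul_apply, ih u (by omega)]

/-- The operator is the product of the `leftOp i` along a reduced word. By `eq_of_commute_rightOp`
it does not depend on the word, so Matsumoto's theorem is not needed. -/
lemma exists_leftOp (w : W n) : ∃ f : Module.End L (W n →₀ L),
    (∀ j, f * rightOp j = rightOp j * f) ∧ f (Finsupp.single 1 1) = Finsupp.single w 1 := by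
  induction hk : len w generalizing w with
  | zero =>
    rw [(coxeterMatrix n).toCoxeterSystem.length_eq_zero_iff] at hk
    exact ⟨1, fun j => by rw [one_mul, mul_one], by rw [hk]; rfl⟩
  | succ k ih =>
    have hw : w ≠ 1 := by rintro rfl; rw [len_one] at hk; omega
    obtain ⟨i, u, rfl, hu⟩ := exists_left_factor hw
    obtain ⟨f, hf, hf'⟩ := ih u (by omega)
    refine ⟨leftOp i * f, fun j => ?_, ?_⟩
    · rw [mul_assoc, hf, ← mul_assoc, leftOp_mul_rightOp, mul_assoc]
    · rw [Module.End.mul_apply, hf', leftOp_single, if_neg (by omega), zero_smul, add_zero]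

/-- Left multiplication by `H_w` on the free module on `W`. -/
noncomputable def leftOpOf (w : W n) : Module.End L (W n →₀ L) := (exists_leftOp w).choose

lemma leftOpOf_commute (w : W n) (j : Fin n) : leftOpOf w * rightOp j = rightOp j * leftOpOf w :=
  (exists_leftOp w).choose_spec.1 j

lemma leftOpOf_single_one (w : W n) : leftOpOf w (Finsupp.single 1 1) = Finsupp.single w 1 :=
  (exists_leftOp w).choose_spec.2

lemma leftOpOf_s (i : Fin n) : leftOpOf (s i) = leftOp i := by
  refine eq_of_commute_rightOp (leftOpOf_commute _) (leftOp_mul_rightOp i) ?_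
  rw [leftOpOf_single_one, leftOp_single, if_neg, zero_smul, add_zero, mul_one]
  rw [len_one]; omega

lemma leftOpOf_one : leftOpOf (1 : W n) = 1 :=
  eq_of_commute_rightOp (leftOpOf_commute _) (fun j => by rw [one_mul, mul_one])
    (by rw [leftOpOf_single_one]; rfl)

lemma leftOpOf_single {x y : W n} (h : len (x * y) = len x + len y) :
    leftOpOf x (Finsupp.single y 1) = Finsupp.single (x * y) 1 := by
  induction hk : len x generalizing x with
  | zero =>
    rw [(coxeterMatrix n).toCoxeterSystem.length_eq_zero_iff] at hk
    rw [hk, leftOpOf_one, one_mul]; rfl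
  | succ k ih =>
    have hw : x ≠ 1 := by rintro rfl; rw [len_one] at hk; omega
    obtain ⟨i, u, rfl, hu⟩ := exists_left_factor hw
    have e : leftOpOf (s i * u) = leftOp i * leftOpOf u := by
      refine eq_of_commute_rightOp (leftOpOf_commute _) (fun j => ?_) ?_
      · rw [mul_assoc, leftOpOf_commute, ← mul_assoc, leftOp_mul_rightOp, mul_assoc]
      · rw [leftOpOf_single_one, Module.End.mul_apply, leftOpOf_single_one, leftOp_single,
          if_neg (by omega), zero_smul, add_zero]
    have h1 : len (u * y) ≤ len u + len y :=
      (coxeterMatrix n).toCoxeterSystem.length_mul_le u y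
    have h2 := len_s_mul (u * y) i
    rw [mul_assoc] at h
    rw [e, Module.End.mul_apply, ih (by omega) (by omega), leftOp_single, if_neg (by omega),
      zero_smul, add_zero, mul_assoc]

/-- The left regular representation of the Hecke algebra on the free module on `W`. -/
noncomputable def regularRep (n : ℕ) : Hecke n →ₐ[L] Module.End L (W n →₀ L) :=
  (RingQuot.liftAlgHom L ⟨FreeAlgebra.lift L leftOpOf, by
    intro x y h
    cases h with
    | one => simp [leftOpOf_one]
    | mul x y h =>
      simp only [map_mul, FreeAlgebra.lift_ι_apply]
      -- Both sides commute with the right operators, so the relation only has to be checked on the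
      -- basis vector of `e`.
      refine eq_of_commute_rightOp (fun j => ?_) (leftOpOf_commute _) ?_
      · rw [mul_assoc, leftOpOf_commute, ← mul_assoc, leftOpOf_commute, mul_assoc]
      · rw [Module.End.mul_apply, leftOpOf_single_one, leftOpOf_single h, leftOpOf_single_one]
    | quad i =>
      simp only [map_mul, map_add, map_smul, FreeAlgebra.lift_ι_apply, leftOpOf_s, leftOpOf_one,
        leftOp_mul_self]⟩ : RingQuot (HeckeRel n) →ₐ[L] _)

lemma regularRep_H (w : W n) : regularRep n (H w) = leftOpOf w := by
  have h : regularRep n (toHecke n (FreeAlgebra.ι L w)) =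
      FreeAlgebra.lift L leftOpOf (FreeAlgebra.ι L w) :=
    RingQuot.liftAlgHom_mkAlgHom_apply _ _ _ _
  rw [H, h, FreeAlgebra.lift_ι_apply]

end RegularRepresentation

/-! ### Linear independence of the standard elements. -/

section CosetFunctional

variable {n : ℕ} {Y : Type*}

/-- The linear map sending the basis element of `w` to `(-q)^{l(w)}` times that of `α w`. -/
noncomputable def signedPushforward (α : W n → Y) : (W n →₀ L) →ₗ[L] (Y →₀ L) :=
  Finsupp.linearCombination L fun w => Finsupp.single (α w) ((-q) ^ len w)

lemma signedPushforward_single (α : W n → Y) (w : W n) :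
    signedPushforward α (Finsupp.single w 1) = Finsupp.single (α w) ((-q) ^ len w) := by
  rw [signedPushforward, Finsupp.linearCombination_single, one_smul]

/-- The linear map on the Hecke algebra sending `H_w` to `(-q)^{l(w)}` times the basis element
of `α w`. -/
noncomputable def heckeFunctional (α : W n → Y) : Hecke n →ₗ[L] (Y →₀ L) :=
  signedPushforward α ∘ₗ (LinearMap.applyₗ (Finsupp.single 1 1)) ∘ₗ (regularRep n).toLinearMap

lemma heckeFunctional_apply (α : W n → Y) (x : Hecke n) :
    heckeFunctional α x = signedPushforward α (regularRep n x (Finsupp.single 1 1)) := rfl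

lemma heckeFunctional_H (α : W n → Y) (w : W n) :
    heckeFunctional α (H w) = Finsupp.single (α w) ((-q) ^ len w) := by
  rw [heckeFunctional_apply, regularRep_H, leftOpOf_single_one, signedPushforward_single]

/-- All terms land on the same basis element. The scalars cancel: `(-q)^{l+1} + q (-q)^l = 0` if
`s_i` lengthens `w`, and `(-q)^{l-1} + q⁻¹ (-q)^l = 0` if it shortens `w`, where `l` is the length
of `w`. -/
lemma heckeFunctional_C_mul {α : W n → Y} {i : Fin n} (h : ∀ w, α (s i * w) = α w)
    (x : Hecke n) : heckeFunctional α (C i * x) = 0 := by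
  have hT : (T (-1) : L) * T 1 = 1 := by rw [← T_add]; simp
  have key : signedPushforward α ∘ₗ (leftOp i + (q : L) • (1 : Module.End L (W n →₀ L))) = 0 := by
    refine end_ext_single fun w => ?_
    simp only [LinearMap.comp_apply, LinearMap.add_apply, LinearMap.smul_apply,
      Module.End.one_apply, leftOp_single, map_add, map_smul, signedPushforward_single, h,
      LinearMap.zero_apply]
    rw [Finsupp.smul_single, Finsupp.smul_single, ← Finsupp.single_add, ← Finsupp.single_add,
      smul_eq_mul, smul_eq_mul, Finsupp.single_eq_zero]
    rcases len_s_mul w i with h | h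
    · rw [if_neg (by omega), h]; ring
    · rw [if_pos (by omega), ← h]
      rw [pow_succ]
      linear_combination (-(-q) ^ len (s i * w)) * hT
  rw [heckeFunctional_apply, map_mul, C, map_add, regularRep_H, leftOpOf_s, AlgHom.commutes,
    Module.End.mul_apply, Algebra.algebraMap_eq_smul_one]
  exact LinearMap.congr_fun key _

lemma heckeFunctional_mul {α : W n → Y} (h : ∀ i : Fin n, (i : ℕ) ≠ 0 → ∀ w, α (s i * w) = α w)
    {a : Hecke n} (ha : a ∈ Hp n) (x : Hecke n) :
    heckeFunctional α (a * x) = signChar n a • heckeFunctional α x := by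
  induction ha using Algebra.adjoin_induction generalizing x with
  | mem a ha =>
    obtain ⟨i, hi, rfl⟩ := ha
    rw [heckeFunctional_C_mul (h i hi), signChar_C, zero_smul]
  | algebraMap a => rw [← Algebra.smul_def, map_smul, AlgHom.commutes]; rfl
  | add a b _ _ ha hb => rw [add_mul, map_add, map_add, ha, hb, add_smul]
  | mul a b _ _ ha hb => rw [mul_assoc, ha, hb, map_mul, mul_smul]

lemma balanced_le_ker {α : W n → Y}
    (h : ∀ i : Fin n, (i : ℕ) ≠ 0 → ∀ w, α (s i * w) = α w) :
    balanced n ≤ (heckeFunctional α ∘ₗ (TensorProduct.lid L (Hecke n)).toLinearMap).ker := by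
  refine Submodule.span_le.2 ?_
  rintro _ ⟨a, b, x, rfl⟩
  simp only [SetLike.mem_coe, LinearMap.mem_ker, map_sub, LinearMap.comp_apply,
    LinearEquiv.coe_coe, TensorProduct.lid_tmul, map_smul, heckeFunctional_mul h b.2]
  rw [mul_smul]
  exact sub_self _

/-- The linear map on the parabolic module sending `N_w` to `(-q)^{l(w)}` times the basis element
of `α w`. -/
noncomputable def cosetFunctional {α : W n → Y}
    (h : ∀ i : Fin n, (i : ℕ) ≠ 0 → ∀ w, α (s i * w) = α w) :
    ParabolicModule n →ₗ[L] (Y →₀ L) :=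
  (balanced n).liftQ (heckeFunctional α ∘ₗ (TensorProduct.lid L (Hecke n)).toLinearMap)
    (balanced_le_ker h)

lemma cosetFunctional_N {α : W n → Y}
    (h : ∀ i : Fin n, (i : ℕ) ≠ 0 → ∀ w, α (s i * w) = α w) (w : MinCosetRep n) :
    cosetFunctional h (N w) = Finsupp.single (α w.1) ((-q) ^ len w.1) := by
  rw [N, cosetFunctional, Submodule.mkQ_apply, Submodule.liftQ_apply, LinearMap.comp_apply,
    LinearEquiv.coe_coe, TensorProduct.lid_tmul, one_smul, heckeFunctional_H]

/-- The `cosetFunctional` sends the `N_w` to multiples of distinct basis elements by units, namely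
by powers of `-q`. -/
lemma linearIndependent_N {α : W n → Y}
    (h : ∀ i : Fin n, (i : ℕ) ≠ 0 → ∀ w, α (s i * w) = α w)
    (hα : Function.Injective fun w : MinCosetRep n => α w.1) :
    LinearIndependent L (N : MinCosetRep n → ParabolicModule n) := by
  refine LinearIndependent.of_comp (cosetFunctional h) ?_
  have hu : ∀ w : MinCosetRep n, IsUnit ((-q : L) ^ len w.1) := fun w =>
    (IsUnit.neg (isUnit_T (R := ℤ) 1)).pow _
  have h1 : LinearIndependent L fun y : Y => Finsupp.single y (1 : L) := by
    simpa only [← Finsupp.coe_basisSingleOne] using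
      (Finsupp.basisSingleOne (R := L) (ι := Y)).linearIndependent
  have h2 := (h1.comp _ hα).units_smul fun w => (hu w).unit
  convert h2 using 1
  funext w
  rw [Function.comp_apply, cosetFunctional_N]
  simp [Units.smul_def]

end CosetFunctional

/-! ### Combinatorics of sign sequences. -/

section SignSequences

/-- The right action of `s_i` on sign sequences (`true` stands for `+`). -/
def act (i : ℕ) (ε : ℕ → Bool) (k : ℕ) : Bool :=
  if i = 0 then if k = 1 then !ε 2 else if k = 2 then !ε 1 else ε k
  else if k = i then ε (i + 1) else if k = i + 1 then ε i else ε k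

/-- Acting by `s_i` decreases the length of `ε`. -/
def IsDesc (i : ℕ) (ε : ℕ → Bool) : Prop :=
  if i = 0 then ε 1 = false ∧ ε 2 = false else ε i = true ∧ ε (i + 1) = false

/-- Acting by `s_i` increases the length of `ε`. -/
def IsAsc (i : ℕ) (ε : ℕ → Bool) : Prop :=
  if i = 0 then ε 1 = true ∧ ε 2 = true else ε i = false ∧ ε (i + 1) = true

lemma act_eq_self_iff (i : ℕ) (ε : ℕ → Bool) :
    act i ε = ε ↔ if i = 0 then ε 1 = !ε 2 else ε i = ε (i + 1) := by
  constructor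
  · intro h
    have h1 := congrFun h 1
    have h2 := congrFun h i
    simp only [act] at h1 h2
    grind
  · intro h
    have h' : ε 1 = !ε 2 → ε 2 = !ε 1 := fun h => by rw [h, Bool.not_not]
    funext k
    simp only [act]
    grind

lemma isDesc_or_isAsc_or_eq (i : ℕ) (ε : ℕ → Bool) : IsDesc i ε ∨ IsAsc i ε ∨ act i ε = ε := by
  rw [act_eq_self_iff]
  simp only [IsDesc, IsAsc]
  grind

lemma act_act (i : ℕ) (ε : ℕ → Bool) : act i (act i ε) = ε := by
  funext k
  rcases eq_or_ne i 0 with rfl | hi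
  · by_cases h1 : k = 1
    · simp [act, h1]
    · by_cases h2 : k = 2 <;> simp [act, h1, h2]
  · simp only [act]
    grind

lemma IsDesc.isAsc_act {i : ℕ} {ε : ℕ → Bool} (h : IsDesc i ε) : IsAsc i (act i ε) := by
  simp only [IsDesc, IsAsc, act] at *; grind

lemma IsAsc.isDesc_act {i : ℕ} {ε : ℕ → Bool} (h : IsAsc i ε) : IsDesc i (act i ε) := by
  simp only [IsDesc, IsAsc, act] at *; grind

lemma IsDesc.ne {i : ℕ} {ε : ℕ → Bool} (h : IsDesc i ε) : act i ε ≠ ε := by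
  rw [Ne, act_eq_self_iff]; simp only [IsDesc] at h; grind

lemma IsAsc.ne {i : ℕ} {ε : ℕ → Bool} (h : IsAsc i ε) : act i ε ≠ ε := by
  rw [Ne, act_eq_self_iff]; simp only [IsAsc] at h; grind

lemma IsDesc.not_isAsc {i : ℕ} {ε : ℕ → Bool} (h : IsDesc i ε) : ¬ IsAsc i ε := by
  simp only [IsDesc, IsAsc] at *; grind

lemma act_comm {i j : ℕ} (h : ¬ adj i j) (ε : ℕ → Bool) : act i (act j ε) = act j (act i ε) := by
  funext k; simp only [act, adj] at *; grind

/-- Adjacent nodes share one place, and descents at both would require opposite signs there. -/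
lemma IsDesc.not_adj {i j : ℕ} {ε : ℕ → Bool} (hi : IsDesc i ε) (hj : IsDesc j ε) : ¬ adj i j := by
  simp only [IsDesc, adj] at *; grind

lemma IsDesc.act_of_ne {i j : ℕ} {ε : ℕ → Bool} (hi : IsDesc i ε) (hj : IsDesc j ε) (hij : i ≠ j) :
    IsDesc i (act j ε) := by
  simp only [IsDesc, act] at *; grind

/-- This prepares the braid relation in `IsGood.exists_mul_s_eq`. Example with `j = i + 1`: the
signs `+ + -` become `+ - +` and then `- + +`, which is fixed by `j`. -/
lemma IsDesc.of_adj {i j : ℕ} {ε : ℕ → Bool} (hj : IsDesc j ε) (hi : act i ε = ε)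
    (h : adj i j) : IsDesc i (act j ε) ∧ act j (act i (act j ε)) = act i (act j ε) := by
  rw [act_eq_self_iff] at *
  simp only [IsDesc, act, adj] at *
  grind

/-- The sum of the numbers `c k` over the places `k` with sign `-`. -/
def minusSum (n : ℕ) (c : ℕ → ℕ) (ε : ℕ → Bool) : ℕ :=
  ∑ k ∈ Finset.Icc 1 n, if ε k then 0 else c k

lemma minusSum_split {n : ℕ} (c : ℕ → ℕ) (ε : ℕ → Bool) {a : ℕ} (ha : 1 ≤ a) (ha' : a + 1 ≤ n) :
    minusSum n c ε = (if ε a then 0 else c a) + ((if ε (a + 1) then 0 else c (a + 1)) +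
      ∑ k ∈ ((Finset.Icc 1 n).erase a).erase (a + 1), if ε k then 0 else c k) := by
  rw [minusSum, ← Finset.add_sum_erase _ _ (Finset.mem_Icc.2 ⟨ha, by omega⟩ : a ∈ Finset.Icc 1 n),
    ← Finset.add_sum_erase _ _ (show a + 1 ∈ (Finset.Icc 1 n).erase a by simp; omega)]

/-- Only the places `a` and `a + 1` change; the nodes `0` and `1` both act at the places `1, 2`. The
remaining sum `r` is common to both sides. -/
lemma minusSum_act {n i : ℕ} (hn : 2 ≤ n) (hi : i < n) (c : ℕ → ℕ) (ε : ℕ → Bool) :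
    ∃ a r, a = (if i = 0 then 1 else i) ∧
      minusSum n c ε = (if ε a then 0 else c a) + ((if ε (a + 1) then 0 else c (a + 1)) + r) ∧
      minusSum n c (act i ε) =
        (if act i ε a then 0 else c a) + ((if act i ε (a + 1) then 0 else c (a + 1)) + r) := by
  refine ⟨_, _, rfl, minusSum_split c ε (by split_ifs <;> omega) (by split_ifs <;> omega), ?_⟩
  rw [minusSum_split c (act i ε) (a := if i = 0 then 1 else i) (by split_ifs <;> omega)
    (by split_ifs <;> omega)]
  congr 2
  refine Finset.sum_congr rfl fun k hk => ?_
  have : act i ε k = ε k := by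
    simp only [Finset.mem_erase] at hk
    simp only [act]; grind
  rw [this]

/-- The length of the shortest coset representative with sign sequence `ε`. -/
def seqLen (n : ℕ) (ε : ℕ → Bool) : ℕ := minusSum n (fun k => k - 1) ε

/-- The weights `k - 1` are made for this: moving a minus one place to the left saves one, and
removing the minuses at `1` and `2` saves `0 + 1`. -/
lemma IsDesc.seqLen {n i : ℕ} (hn : 2 ≤ n) (hi : i < n) {ε : ℕ → Bool} (h : IsDesc i ε) :
    seqLen n ε = seqLen n (act i ε) + 1 := by
  obtain ⟨a, r, ha, h1, h2⟩ := minusSum_act hn hi (fun k => k - 1) ε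
  rw [GraphicalKL.seqLen, GraphicalKL.seqLen, h1, h2]
  simp only [act, IsDesc] at *
  grind

lemma IsAsc.seqLen {n i : ℕ} (hn : 2 ≤ n) (hi : i < n) {ε : ℕ → Bool} (h : IsAsc i ε) :
    seqLen n (act i ε) = seqLen n ε + 1 := by
  rw [h.isDesc_act.seqLen hn hi, act_act]

/-- The sign sequences of the elements of `W`. -/
structure IsSignSeq (n : ℕ) (ε : ℕ → Bool) : Prop where
  zero : ε 0 = false
  large : ∀ k, n < k → ε k = true
  even : Even (minusSum n 1 ε)

lemma IsSignSeq.act {n i : ℕ} (hn : 2 ≤ n) (hi : i < n) {ε : ℕ → Bool} (h : IsSignSeq n ε) :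
    IsSignSeq n (act i ε) := by
  refine ⟨?_, fun k hk => ?_, ?_⟩
  · have := h.zero; simp only [GraphicalKL.act]; grind
  · have := h.large k hk; simp only [GraphicalKL.act]; grind
  · obtain ⟨a, r, ha, h1, h2⟩ := minusSum_act hn hi 1 ε
    have h3 := h.even
    rw [h1] at h3
    rw [h2]
    clear h1 h2
    simp only [GraphicalKL.act, Pi.one_apply] at *
    by_cases h0 : i = 0
    · subst h0
      rw [if_pos rfl] at ha
      subst ha
      rcases Bool.eq_false_or_eq_true (ε 1) with h5 | h5 <;>
        rcases Bool.eq_false_or_eq_true (ε 2) with h6 | h6 <;> simp_all [Nat.even_add]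
    · rw [if_neg h0] at ha
      subst ha
      rcases Bool.eq_false_or_eq_true (ε a) with h5 | h5 <;>
        rcases Bool.eq_false_or_eq_true (ε (a + 1)) with h6 | h6 <;> simp_all [Nat.even_add]

/-- Take the first minus at a place `a ≥ 2`. If `a > 2`, a plus precedes it; if `a = 2`, the sign at
`1` decides between the nodes `0` and `1`. A single minus at the place `1` is excluded by parity. -/
lemma IsSignSeq.exists_isDesc {n : ℕ} (hn : 2 ≤ n) {ε : ℕ → Bool} (h : IsSignSeq n ε)
    (hε : ∃ k ≠ 0, ε k = false) : ∃ i < n, IsDesc i ε := by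
  classical
  obtain ⟨k, hk0, hk⟩ := hε
  have hkn : k ≤ n := by
    by_contra h'
    rw [h.large k (by omega)] at hk; simp at hk
  by_cases h2 : ∃ k, 2 ≤ k ∧ ε k = false
  · have h3 := Nat.find_spec h2
    have h4 := fun m => Nat.find_min h2 (m := m)
    set a := Nat.find h2
    have han : a ≤ n := by
      by_contra h'
      have := h3.2
      rw [h.large a (by omega)] at this; simp at this
    by_cases ha : a = 2
    · by_cases h1 : ε 1 = true
      · exact ⟨1, by omega, by simp [IsDesc, h1, ← ha, h3.2]⟩
      · exact ⟨0, by omega, by simp [IsDesc, h1, ← ha, h3.2]⟩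
    · refine ⟨a - 1, by omega, ?_⟩
      have := h4 (a - 1) (by omega)
      have h5 : a - 1 + 1 = a := by omega
      rw [IsDesc, if_neg (by omega), h5]
      exact ⟨by grind, h3.2⟩
  · exfalso
    push Not at h2
    have hk1 : k = 1 := by
      by_contra h'
      exact h2 k (by omega) hk
    subst hk1
    have h3 := h.even
    rw [minusSum_split _ _ le_rfl (by omega), hk, Finset.sum_eq_zero] at h3
    · have := h2 2 (by omega)
      simp [this] at h3
    · intro x hx
      simp only [Finset.mem_erase, Finset.mem_Icc] at hx
      have := h2 x (by omega)
      simp [this]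

/-! ### Sign sequences of group elements and shortest coset representatives. -/

variable {n : ℕ}

/-- The sign sequence of `w` at the positive places. -/
def signSeq (w : W n) (k : ℕ) : Bool := decide (0 < Psi n w k)

lemma Psi_s (i : Fin n) : Psi n (s i) = gen i := CoxeterSystem.lift_apply_simple _ _ _

lemma Psi_zero (w : W n) : Psi n w 0 = 0 := by
  have := Psi_neg w 0; rw [neg_zero] at this; omega

lemma Psi_ne_zero (w : W n) {k : ℤ} (hk : k ≠ 0) : Psi n w k ≠ 0 :=
  fun h => hk ((Psi n w).injective (h.trans (Psi_zero w).symm))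

lemma signSeq_one (k : ℕ) : signSeq (1 : W n) k = decide (k ≠ 0) := by
  simp [signSeq, Nat.pos_iff_ne_zero]

lemma signSeq_mul_s (w : W n) (i : Fin n) : signSeq (w * s i) = act i (signSeq w) := by
  funext k
  have hneg : ∀ m : ℕ, m ≠ 0 → decide (0 < Psi n w (-(m : ℤ))) = !signSeq w m := by
    intro m hm
    have := Psi_ne_zero w (k := m) (by omega)
    rw [signSeq, Psi_neg]
    by_cases h : 0 < Psi n w m
    · simp [h]; omega
    · simp [h]; omega
  rw [signSeq, map_mul, Psi_s, Equiv.Perm.mul_apply, act]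
  by_cases hi : (i : ℕ) = 0
  · rw [if_pos hi, hi, gen_zero_apply]
    by_cases h1 : k = 1
    · subst h1; simpa using hneg 2 (by omega)
    by_cases h2 : k = 2
    · subst h2; simpa using hneg 1 (by omega)
    rw [if_neg (by omega), if_neg (by omega), if_neg (by omega), if_neg (by omega), if_neg h1,
      if_neg h2, signSeq]
  · rw [if_neg hi, gen_pos_apply hi]
    by_cases h1 : k = i
    · rw [if_pos h1, if_pos (by omega), signSeq]; push_cast; rfl
    by_cases h2 : k = i + 1
    · rw [if_neg h1, if_pos h2, if_neg (by omega), if_pos (by omega), signSeq]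
    rw [if_neg (by omega), if_neg (by omega), if_neg (by omega), if_neg (by omega), if_neg h1,
      if_neg h2, signSeq]

/-- `Ψ(s_i)` with `i ≠ 0` moves values without changing their signs, so the sequence is an invariant
of the coset. -/
lemma signSeq_s_mul {i : Fin n} (hi : (i : ℕ) ≠ 0) (w : W n) : signSeq (s i * w) = signSeq w := by
  funext k
  rw [signSeq, signSeq, map_mul, Psi_s, Equiv.Perm.mul_apply, gen_pos_apply hi]
  generalize Psi n w k = y
  rw [decide_eq_decide]
  split_ifs <;> omega

lemma isSignSeq_signSeq (hn : 2 ≤ n) (w : W n) : IsSignSeq n (signSeq w) := by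
  induction w using (coxeterMatrix n).toCoxeterSystem.simple_induction_right with
  | one =>
    refine ⟨by simp [signSeq_one], fun k hk => by simp [signSeq_one]; omega, ?_⟩
    rw [minusSum, Finset.sum_eq_zero]
    · exact Even.zero
    · intro k hk
      rw [Finset.mem_Icc] at hk
      rw [signSeq_one, if_pos (by simp; omega)]
  | mul_simple_right w i ih => rw [s_eq_simple, signSeq_mul_s]; exact ih.act hn i.2

lemma seqLen_one : seqLen n (signSeq (1 : W n)) = 0 := by
  rw [seqLen, minusSum, Finset.sum_eq_zero]
  intro k hk
  rw [Finset.mem_Icc] at hk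
  rw [signSeq_one, if_pos (by simp; omega)]

lemma seqLen_act_le (hn : 2 ≤ n) (i : Fin n) (ε : ℕ → Bool) :
    seqLen n (act i ε) ≤ seqLen n ε + 1 := by
  rcases isDesc_or_isAsc_or_eq i ε with h | h | h
  · have := h.seqLen hn i.2; omega
  · have := h.seqLen hn i.2; omega
  · rw [h]; omega

lemma seqLen_le_len (hn : 2 ≤ n) (w : W n) : seqLen n (signSeq w) ≤ len w := by
  induction hk : len w generalizing w with
  | zero =>
    rw [(coxeterMatrix n).toCoxeterSystem.length_eq_zero_iff] at hk
    rw [hk, seqLen_one]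
  | succ k ih =>
    have hw : w ≠ 1 := by rintro rfl; rw [len_one] at hk; omega
    obtain ⟨i, u, rfl, hu⟩ := exists_right_factor hw
    have := ih u (by omega)
    have := seqLen_act_le hn i (signSeq u)
    rw [signSeq_mul_s]; omega

/-- `w` is as short as its sign sequence allows. -/
def IsGood (w : W n) : Prop := len w = seqLen n (signSeq w)

lemma isGood_mul_s (hn : 2 ≤ n) {w : W n} (hw : IsGood w) {i : Fin n} (h : IsAsc i (signSeq w)) :
    IsGood (w * s i) := by
  have h1 := seqLen_le_len hn (w * s i)
  have h2 := h.seqLen hn i.2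
  have h3 := len_mul_s w i
  rw [IsGood] at *
  rw [signSeq_mul_s] at *
  omega

/-- Descents lead from `ε` down to the all-plus sequence of the identity; the reversed path consists
of ascents, each of which preserves `IsGood`. -/
lemma exists_isGood (hn : 2 ≤ n) {ε : ℕ → Bool} (hε : IsSignSeq n ε) :
    ∃ w : W n, IsGood w ∧ signSeq w = ε := by
  induction hk : seqLen n ε generalizing ε with
  | zero =>
    refine ⟨1, by rw [IsGood, len_one, seqLen_one], ?_⟩
    by_cases h : ∃ k ≠ 0, ε k = false
    · obtain ⟨i, hi, hd⟩ := hε.exists_isDesc hn h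
      have := hd.seqLen hn hi
      omega
    · push Not at h
      funext k
      rw [signSeq_one]
      have h0 := hε.zero
      by_cases hk : k = 0
      · simp [hk, h0]
      · simp [hk]; have := h k hk; grind
  | succ m ih =>
    have h : ∃ k ≠ 0, ε k = false := by
      by_contra h
      push Not at h
      rw [seqLen, minusSum, Finset.sum_eq_zero] at hk
      · omega
      · intro k hk
        rw [Finset.mem_Icc] at hk
        have := h k (by omega)
        simp [this]
    obtain ⟨i, hi, hd⟩ := hε.exists_isDesc hn h
    have h1 := hd.seqLen hn hi
    obtain ⟨w, hw, hw'⟩ := ih (hε.act hn hi) (by omega)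
    refine ⟨w * s ⟨i, hi⟩, isGood_mul_s hn hw ?_, ?_⟩
    · rw [hw']; exact hd.isAsc_act
    · rw [signSeq_mul_s, hw', act_act]

/-- The last letter of a reduced word must be a descent of the sequence: otherwise the remaining
factor would be shorter than `seqLen_le_len` permits. -/
lemma IsGood.exists_factor (hn : 2 ≤ n) {w : W n} (hw : IsGood w) (h1 : w ≠ 1) :
    ∃ (i : Fin n) (u : W n), w = u * s i ∧ IsGood u ∧ IsDesc i (signSeq w) ∧
      signSeq u = act i (signSeq w) := by
  obtain ⟨i, u, rfl, hu⟩ := exists_right_factor h1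
  have e : signSeq u = act i (signSeq (u * s i)) := by rw [signSeq_mul_s, act_act]
  have h2 := seqLen_le_len hn u
  have hd : IsDesc i (signSeq (u * s i)) := by
    rcases isDesc_or_isAsc_or_eq i (signSeq (u * s i)) with h | h | h
    · exact h
    · have := h.seqLen hn i.2
      rw [← e] at this; rw [IsGood] at hw; omega
    · rw [e, h] at h2; rw [IsGood] at hw; omega
  refine ⟨i, u, rfl, ?_, hd, e⟩
  have := hd.seqLen hn i.2
  rw [← e] at this
  rw [IsGood] at *
  omega

/-- A diamond argument: two different last letters are both descents of the common sequence, hence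
commute, and both elements can be compared with an element from which both letters are stripped. -/
lemma IsGood.eq_of_signSeq_eq (hn : 2 ≤ n) {w w' : W n} (hw : IsGood w) (hw' : IsGood w')
    (h : signSeq w = signSeq w') : w = w' := by
  induction hk : len w using Nat.strong_induction_on generalizing w w' with
  | _ m ih =>
  have hl : len w = len w' := by rw [IsGood] at *; rw [hw, hw', h]
  by_cases h1 : w = 1
  · subst h1
    rw [len_one] at hl
    exact ((coxeterMatrix n).toCoxeterSystem.length_eq_zero_iff.1 hl.symm).symm
  have h2 : w' ≠ 1 := by
    rintro rfl
    exact h1 ((coxeterMatrix n).toCoxeterSystem.length_eq_zero_iff.1 (hl.trans len_one))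
  obtain ⟨i, u, hu, gu, di, su⟩ := hw.exists_factor hn h1
  obtain ⟨j, v, hv, gv, dj, sv⟩ := hw'.exists_factor hn h2
  rw [← h] at dj sv
  have hul : len u < m := by
    have := di.seqLen hn i.2
    rw [← su] at this; rw [IsGood] at *; omega
  have hvl : len v < m := by
    have := dj.seqLen hn j.2
    rw [← sv] at this; rw [IsGood] at *; omega
  by_cases hij : i = j
  · subst hij
    rw [hu, hv, ih _ hul gu gv (by rw [su, sv]) rfl]
  have hij' : (i : ℕ) ≠ j := fun h => hij (Fin.ext h)
  have nadj := di.not_adj dj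
  have dji : IsDesc j (act i (signSeq w)) := dj.act_of_ne di hij'.symm
  have dij : IsDesc i (act j (signSeq w)) := di.act_of_ne dj hij'
  -- `y` is the bottom of the diamond: `u = y s_j` and `v = y s_i` by induction.
  obtain ⟨y, gy, sy⟩ := exists_isGood hn
    (((isSignSeq_signSeq hn w).act hn i.2).act hn j.2)
  have e1 : u = y * s j := by
    refine ih _ hul gu (isGood_mul_s hn gy ?_) ?_ rfl
    · rw [sy]; exact dji.isAsc_act
    · rw [signSeq_mul_s, sy, act_act, su]
  have e2 : v = y * s i := by
    refine ih _ hvl gv (isGood_mul_s hn gy ?_) ?_ rfl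
    · rw [sy, ← act_comm nadj]; exact dij.isAsc_act
    · rw [signSeq_mul_s, sy, ← act_comm nadj, act_act, sv]
  rw [hu, hv, e1, e2, mul_assoc, mul_assoc, s_commute nadj]

lemma IsGood.mul_s_of_isDesc (hn : 2 ≤ n) {w : W n} (hw : IsGood w) {i : Fin n}
    (h : IsDesc i (signSeq w)) : IsGood (w * s i) := by
  obtain ⟨y, gy, sy⟩ := exists_isGood hn ((isSignSeq_signSeq hn w).act hn i.2)
  have : w = y * s i := by
    refine hw.eq_of_signSeq_eq hn (isGood_mul_s hn gy ?_) ?_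
    · rw [sy]; exact h.isAsc_act
    · rw [signSeq_mul_s, sy, act_act]
  rw [this, s_mul_cancel_right]
  exact gy

/-- The letter `s_i` is moved to the left through a reduced word of `w`. It passes commuting letters
unchanged, and an adjacent letter by a braid relation that changes it; it cannot be `s_0` when it
arrives at `e`, since `s_0` does not fix the all-plus sequence. -/
lemma IsGood.exists_mul_s_eq (hn : 2 ≤ n) {w : W n} (hw : IsGood w) {i : Fin n}
    (h : act i (signSeq w) = signSeq w) : ∃ r : Fin n, (r : ℕ) ≠ 0 ∧ w * s i = s r * w := by
  induction hk : len w using Nat.strong_induction_on generalizing w i with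
  | _ m ih =>
  by_cases h1 : w = 1
  · subst h1
    refine ⟨i, fun h0 => ?_, by rw [one_mul, mul_one]⟩
    rw [act_eq_self_iff, if_pos h0, signSeq_one, signSeq_one] at h
    simp at h
  obtain ⟨j, u, hu, gu, dj, su⟩ := hw.exists_factor hn h1
  have hul := dj.seqLen hn j.2
  rw [← su] at hul
  have lw : len w = seqLen n (signSeq w) := hw
  have lu : len u = seqLen n (signSeq u) := gu
  -- In the adjacent case `w = y s_i s_j` with `y = u s_i`, and `y s_i s_j s_i = y s_j s_i s_j`,
  -- where `s_j` fixes the sequence of `y`. The induction hypothesis is applied to `y` and `j`.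
  by_cases ha : adj i j
  · obtain ⟨d, f⟩ := dj.of_adj h ha
    rw [← su] at d f
    have gy := gu.mul_s_of_isDesc hn d
    have ly : len (u * s i) = seqLen n (signSeq (u * s i)) := gy
    have := d.seqLen hn i.2
    rw [← signSeq_mul_s] at f this
    obtain ⟨r, r0, hr⟩ := ih _ (by omega) gy f rfl
    refine ⟨r, r0, ?_⟩
    have hb : s i * (s j * s i) = (s j * (s i * s j) : W n) := by
      simpa only [mul_assoc] using s_braid ha
    have e : u = u * s i * s i := (s_mul_cancel_right i u).symm
    rw [hu]
    calc u * s j * s i = u * s i * (s i * (s j * s i)) := by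
            rw [← mul_assoc (u * s i), s_mul_cancel_right, mul_assoc]
      _ = u * s i * s j * s i * s j := by rw [hb]; simp only [mul_assoc]
      _ = s r * (u * s j) := by rw [hr, mul_assoc (s r), s_mul_cancel_right, mul_assoc]
  · have f : act i (signSeq u) = signSeq u := by rw [su, act_comm ha, h]
    obtain ⟨r, r0, hr⟩ := ih _ (by omega) gu f rfl
    refine ⟨r, r0, ?_⟩
    rw [hu, mul_assoc, ← s_commute ha, ← mul_assoc, hr, mul_assoc]

lemma IsGood.len_lt (hn : 2 ≤ n) {w : W n} (hw : IsGood w) {i : Fin n} (hi : (i : ℕ) ≠ 0) :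
    len w < len (s i * w) := by
  have h1 := seqLen_le_len hn (s i * w)
  rw [signSeq_s_mul hi] at h1
  have h2 := len_s_mul w i
  rw [IsGood] at hw
  omega

/-- Write `w = u s_i` with `u` shorter. Minimality passes to `u`, which is good by induction. If
`s_i` lowered the sequence of `u`, then `u s_i` would be shorter than `u`; if it fixed it, then `u
s_i = s_r u` would not be minimal in its coset. -/
lemma isGood_of_len_lt (hn : 2 ≤ n) {w : W n}
    (hw : ∀ i : Fin n, (i : ℕ) ≠ 0 → len w < len (s i * w)) : IsGood w := by
  induction hk : len w generalizing w with
  | zero =>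
    rw [(coxeterMatrix n).toCoxeterSystem.length_eq_zero_iff] at hk
    rw [hk, IsGood, len_one, seqLen_one]
  | succ k ih =>
    have h1 : w ≠ 1 := by rintro rfl; rw [len_one] at hk; omega
    obtain ⟨i, u, rfl, hu⟩ := exists_right_factor h1
    -- `s_r u s_i` is longer than `u s_i`, hence at least two longer than `u`, so `s_r u` is longer
    -- than `u`.
    have gu : IsGood u := by
      refine ih (fun r hr => ?_) (by omega)
      have h2 := hw r hr
      have h3 := len_mul_s (s r * u) i
      rw [mul_assoc] at h3
      have h4 := len_s_mul u r
      omega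
    rcases isDesc_or_isAsc_or_eq i (signSeq u) with h | h | h
    · have g2 := gu.mul_s_of_isDesc hn h
      have := h.seqLen hn i.2
      rw [← signSeq_mul_s] at this
      rw [IsGood] at gu g2
      omega
    · exact isGood_mul_s hn gu h
    · obtain ⟨r, r0, hr⟩ := gu.exists_mul_s_eq hn h
      have := hw r r0
      rw [hr, s_mul_cancel_left] at this
      rw [hr] at hu
      omega

end SignSequences

/-! ### The right Hecke action and the standard basis of the parabolic module. -/

section ParabolicModule

variable {n : ℕ}

lemma balanced_le_comap_mulRight (h : Hecke n) :
    balanced n ≤ (balanced n).comap (LinearMap.lTensor L (LinearMap.mulRight L h)) := by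
  refine Submodule.span_le.2 ?_
  rintro _ ⟨a, b, x, rfl⟩
  refine Submodule.subset_span ⟨a, b, x * h, ?_⟩
  rw [map_sub, LinearMap.lTensor_tmul, LinearMap.lTensor_tmul, LinearMap.mulRight_apply,
    LinearMap.mulRight_apply, mul_assoc]

/-- The right action of the Hecke algebra on the parabolic module. -/
noncomputable def rightMul (h : Hecke n) : ParabolicModule n →ₗ[L] ParabolicModule n :=
  Submodule.mapQ (balanced n) (balanced n) (LinearMap.lTensor L (LinearMap.mulRight L h))
    (balanced_le_comap_mulRight h)

lemma rightMul_mkQ (h : Hecke n) (a : L) (x : Hecke n) :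
    rightMul h ((balanced n).mkQ (a ⊗ₜ[L] x)) = (balanced n).mkQ (a ⊗ₜ[L] (x * h)) := rfl

lemma parabolic_induction {p : ParabolicModule n → Prop}
    (tmul : ∀ (a : L) (x : Hecke n), p ((balanced n).mkQ (a ⊗ₜ[L] x)))
    (add : ∀ x y, p x → p y → p (x + y)) (x : ParabolicModule n) : p x := by
  obtain ⟨z, rfl⟩ := (balanced n).mkQ_surjective x
  induction z using TensorProduct.induction_on with
  | zero => simpa using tmul 0 0
  | tmul a x => exact tmul a x
  | add x y hx hy => rw [map_add]; exact add _ _ hx hy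

lemma rightMul_mul (h h' : Hecke n) (x : ParabolicModule n) :
    rightMul (h * h') x = rightMul h' (rightMul h x) := by
  induction x using parabolic_induction with
  | tmul a x => rw [rightMul_mkQ, rightMul_mkQ, rightMul_mkQ, mul_assoc]
  | add x y hx hy => simp only [map_add, hx, hy]

lemma rightMul_add (h h' : Hecke n) (x : ParabolicModule n) :
    rightMul (h + h') x = rightMul h x + rightMul h' x := by
  induction x using parabolic_induction with
  | tmul a x => rw [rightMul_mkQ, rightMul_mkQ, rightMul_mkQ, mul_add, TensorProduct.tmul_add,
      map_add]
  | add x y hx hy => simp only [map_add, hx, hy]; abel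

lemma rightMul_algebraMap (a : L) (x : ParabolicModule n) :
    rightMul (algebraMap L (Hecke n) a) x = a • x := by
  induction x using parabolic_induction with
  | tmul b x => rw [rightMul_mkQ, ← Algebra.commutes, ← Algebra.smul_def, TensorProduct.tmul_smul,
      map_smul]
  | add x y hx hy => simp only [map_add, hx, hy, smul_add]

lemma barParabolic_mkQ (a : L) (x : Hecke n) :
    barParabolic n ((balanced n).mkQ (a ⊗ₜ[L] x)) =
      (balanced n).mkQ (sigma a ⊗ₜ[L] bar n x) := rfl

lemma barParabolic_rightMul (h : Hecke n) (x : ParabolicModule n) :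
    barParabolic n (rightMul h x) = rightMul (bar n h) (barParabolic n x) := by
  induction x using parabolic_induction with
  | tmul a x => rw [rightMul_mkQ, barParabolic_mkQ, barParabolic_mkQ, rightMul_mkQ, map_mul]
  | add x y hx hy => simp only [map_add, hx, hy]

lemma mkQ_mul_of_mem_Hp {h : Hecke n} (hh : h ∈ Hp n) (x : Hecke n) :
    (balanced n).mkQ (1 ⊗ₜ[L] (h * x)) = signChar n h • (balanced n).mkQ (1 ⊗ₜ[L] x) := by
  have : ((1 : L) * chi n ⟨h, hh⟩) ⊗ₜ[L] x - (1 : L) ⊗ₜ[L] (h * x) ∈ balanced n :=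
    Submodule.subset_span ⟨1, ⟨h, hh⟩, x, rfl⟩
  rw [← map_smul, eq_comm, ← sub_eq_zero, ← map_sub, Submodule.mkQ_apply,
    Submodule.Quotient.mk_eq_zero]
  convert this using 2
  rw [one_mul, TensorProduct.smul_tmul', smul_eq_mul, mul_one]
  rfl

lemma mkQ_C_mul {i : Fin n} (hi : (i : ℕ) ≠ 0) (x : Hecke n) :
    (balanced n).mkQ (1 ⊗ₜ[L] (C i * x)) = 0 := by
  rw [mkQ_mul_of_mem_Hp (Algebra.subset_adjoin ⟨i, hi, rfl⟩), signChar_C, zero_smul]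

lemma H_mul_s {w : W n} {i : Fin n} (h : len (w * s i) = len w + 1) :
    H w * H (s i) = H (w * s i) := H_mul _ _ (by rw [h, len_s])

lemma MinCosetRep.isGood (hn : 2 ≤ n) (w : MinCosetRep n) : IsGood w.1 := isGood_of_len_lt hn w.2

lemma MinCosetRep.eq_of_signSeq_eq (hn : 2 ≤ n) {v w : MinCosetRep n}
    (h : signSeq v.1 = signSeq w.1) : v = w :=
  Subtype.ext ((v.isGood hn).eq_of_signSeq_eq hn (w.isGood hn) h)

lemma MinCosetRep.exists_of_isSignSeq (hn : 2 ≤ n) {ε : ℕ → Bool} (h : IsSignSeq n ε) :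
    ∃ w : MinCosetRep n, signSeq w.1 = ε := by
  obtain ⟨w, hw, hw'⟩ := exists_isGood hn h
  exact ⟨⟨w, fun i hi => hw.len_lt hn hi⟩, hw'⟩

lemma MinCosetRep.eq_mul_s (hn : 2 ≤ n) {v w : MinCosetRep n} {i : Fin n}
    (h : signSeq v.1 = act i (signSeq w.1)) (hne : act i (signSeq w.1) ≠ signSeq w.1) :
    v.1 = w.1 * s i := by
  refine (v.isGood hn).eq_of_signSeq_eq hn ?_ (by rw [h, signSeq_mul_s])
  rcases isDesc_or_isAsc_or_eq i (signSeq w.1) with h' | h' | h'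
  · exact (w.isGood hn).mul_s_of_isDesc hn h'
  · exact isGood_mul_s hn (w.isGood hn) h'
  · exact absurd h' hne

lemma rightMul_C (i : Fin n) (x : ParabolicModule n) :
    rightMul (C i) x = rightMul (H (s i)) x + (q : L) • x := by
  rw [C, rightMul_add, rightMul_algebraMap]

lemma rightMul_C_of_isAsc (hn : 2 ≤ n) {v w : MinCosetRep n} {i : Fin n}
    (hi : IsAsc i (signSeq w.1)) (h : signSeq v.1 = act i (signSeq w.1)) :
    rightMul (C i) (N w) = N v + (q : L) • N w := by
  have e := MinCosetRep.eq_mul_s hn h hi.ne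
  have l1 := v.isGood hn
  have l2 := w.isGood hn
  have l3 := hi.seqLen hn i.2
  rw [← h] at l3
  rw [IsGood] at l1 l2
  rw [rightMul_C, N, N, rightMul_mkQ, e, H_mul_s]
  rw [← e]; omega

lemma rightMul_C_of_isDesc (hn : 2 ≤ n) {v w : MinCosetRep n} {i : Fin n}
    (hi : IsDesc i (signSeq w.1)) (h : signSeq v.1 = act i (signSeq w.1)) :
    rightMul (C i) (N w) = N v + (T (-1) : L) • N w := by
  have e := MinCosetRep.eq_mul_s hn h hi.ne
  have l1 := v.isGood hn
  have l2 := w.isGood hn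
  have l3 := hi.seqLen hn i.2
  rw [← h] at l3
  rw [IsGood] at l1 l2
  have e' : w.1 = v.1 * s i := by rw [e, s_mul_cancel_right]
  have hH : H w.1 * H (s i) = (T (-1) - q : L) • H w.1 + H v.1 := by
    rw [e', ← H_mul_s (by rw [← e']; omega), mul_assoc, H_quad, mul_add, mul_one, mul_smul_comm]
  rw [rightMul_C, N, N, rightMul_mkQ, hH, TensorProduct.tmul_add, map_add, TensorProduct.tmul_smul,
    map_smul, sub_smul]
  abel

/-- Here `w s_i = s_r w` with `r ≠ 0`, so `H_w C_{s_i} = C_{s_r} H_w`, and `C_{s_r}` can be moved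
across the tensor sign, where it acts by zero. -/
lemma rightMul_C_of_eq (hn : 2 ≤ n) {w : MinCosetRep n} {i : Fin n}
    (h : act i (signSeq w.1) = signSeq w.1) : rightMul (C i) (N w) = 0 := by
  obtain ⟨r, hr, e⟩ := (w.isGood hn).exists_mul_s_eq hn h
  have l1 := w.2 r hr
  have l2 := len_s_mul w.1 r
  have hH : H w.1 * H (s i) = H (s r) * H w.1 := by
    rw [H_mul_s (by rw [e]; omega), e, H_mul _ _ (by rw [len_s]; omega)]
  have h2 := mkQ_C_mul hr (H w.1)
  rw [C, add_mul, TensorProduct.tmul_add, map_add, ← Algebra.smul_def, TensorProduct.tmul_smul,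
    map_smul] at h2
  rw [rightMul_C, N, rightMul_mkQ, hH, h2]

/-- The coset of the identity. -/
def oneRep (n : ℕ) : MinCosetRep n :=
  ⟨1, fun i _ => by rw [mul_one, len_one, len_s]; exact Nat.zero_lt_one⟩

lemma N_oneRep : N (oneRep n) = (balanced n).mkQ (1 ⊗ₜ[L] 1) := by
  rw [N, oneRep, H_one]

/-- The three multiplication rules give stability under each `C_i`, hence under `H_{s_i} = C_i - q`,
hence under every `H_w`, and these generate the algebra. Since `N_e` generates the module, spanning
follows. -/
lemma rightMul_mem_span_N (hn : 2 ≤ n) (h : Hecke n) {x : ParabolicModule n}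
    (hx : x ∈ Submodule.span L (Set.range (N (n := n)))) :
    rightMul h x ∈ Submodule.span L (Set.range (N (n := n))) := by
  set S := Submodule.span L (Set.range (N (n := n)))
  have hN : ∀ w, N w ∈ S := fun w => Submodule.subset_span ⟨w, rfl⟩
  have hC : ∀ i : Fin n, ∀ x ∈ S, rightMul (C i) x ∈ S := by
    intro i
    suffices S ≤ S.comap (rightMul (C i)) from this
    refine Submodule.span_le.2 ?_
    rintro _ ⟨w, rfl⟩
    obtain ⟨v, hv⟩ := MinCosetRep.exists_of_isSignSeq hn
      ((isSignSeq_signSeq hn w.1).act hn i.2)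
    rw [SetLike.mem_coe, Submodule.mem_comap]
    rcases isDesc_or_isAsc_or_eq i (signSeq w.1) with h' | h' | h'
    · rw [rightMul_C_of_isDesc hn h' hv]
      exact S.add_mem (hN v) (S.smul_mem _ (hN w))
    · rw [rightMul_C_of_isAsc hn h' hv]
      exact S.add_mem (hN v) (S.smul_mem _ (hN w))
    · rw [rightMul_C_of_eq hn h']
      exact S.zero_mem
  have hH : ∀ w : W n, ∀ x ∈ S, rightMul (H w) x ∈ S := by
    intro w
    induction hk : len w generalizing w with
    | zero =>
      intro x hx
      rw [(coxeterMatrix n).toCoxeterSystem.length_eq_zero_iff] at hk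
      rw [hk, H_one, ← map_one (algebraMap L (Hecke n)), rightMul_algebraMap, one_smul]
      exact hx
    | succ k ih =>
      intro x hx
      have hw : w ≠ 1 := by rintro rfl; rw [len_one] at hk; omega
      obtain ⟨i, u, rfl, hu⟩ := exists_right_factor hw
      have h1 := ih u (by omega) x hx
      have h2 := S.sub_mem (hC i _ h1) (S.smul_mem q h1)
      rw [rightMul_C, add_sub_cancel_right] at h2
      rw [← H_mul_s hu, rightMul_mul]
      exact h2
  obtain ⟨z, rfl⟩ : ∃ z, toHecke n z = h := RingQuot.mkAlgHom_surjective _ _ h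
  induction z using FreeAlgebra.induction generalizing x with
  | grade0 a => rw [AlgHom.commutes, rightMul_algebraMap]; exact S.smul_mem _ hx
  | grade1 w => exact hH w x hx
  | mul a b ha hb => rw [map_mul, rightMul_mul]; exact hb (ha hx)
  | add a b ha hb => rw [map_add, rightMul_add]; exact S.add_mem (ha hx) (hb hx)

lemma span_N (hn : 2 ≤ n) : Submodule.span L (Set.range (N (n := n))) = ⊤ := by
  refine eq_top_iff.2 fun x _ => ?_
  induction x using parabolic_induction with
  | tmul a x =>
    have h1 := rightMul_mem_span_N hn x
      (Submodule.subset_span (Set.mem_range_self (oneRep n)))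
    have h2 := Submodule.smul_mem _ a h1
    rwa [N_oneRep, rightMul_mkQ, one_mul, ← map_smul, TensorProduct.smul_tmul', smul_eq_mul,
      mul_one] at h2
  | add x y hx hy => exact Submodule.add_mem _ (hx trivial) (hy trivial)

lemma linearIndependent_N_signSeq (hn : 2 ≤ n) :
    LinearIndependent L (N : MinCosetRep n → ParabolicModule n) :=
  linearIndependent_N (α := signSeq) (fun _ hi w => signSeq_s_mul hi w)
    fun _ _ h => MinCosetRep.eq_of_signSeq_eq hn h

/-- The standard basis of the parabolic module. -/
noncomputable def stdBasis (hn : 2 ≤ n) : Module.Basis (MinCosetRep n) L (ParabolicModule n) :=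
  Module.Basis.mk (linearIndependent_N_signSeq hn) (span_N hn).ge

lemma stdBasis_apply (hn : 2 ≤ n) (w : MinCosetRep n) : stdBasis hn w = N w :=
  Module.Basis.mk_apply _ _ w

lemma barParabolic_N_oneRep : barParabolic n (N (oneRep n)) = N (oneRep n) := by
  rw [N_oneRep, barParabolic_mkQ, map_one, map_one]

lemma finite_minCosetRep (hn : 2 ≤ n) : Finite (MinCosetRep n) := by
  refine Finite.of_injective
    (fun (w : MinCosetRep n) (k : Fin (n + 1)) => signSeq w.1 k) fun v w h => ?_
  refine MinCosetRep.eq_of_signSeq_eq hn (funext fun k => ?_)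
  by_cases hk : k ≤ n
  · exact congrFun h ⟨k, by omega⟩
  · rw [(isSignSeq_signSeq hn v.1).large k (by omega),
      (isSignSeq_signSeq hn w.1).large k (by omega)]

end ParabolicModule

/-! ### Evaluating folded cup diagrams from left to right. -/

section Scan

/-- The weight of an oriented folded cup with sign `y` at its right end. -/
noncomputable def cupWeight (y : Bool) : L := if y then q else 1

/-- Reads the folded cup diagram of a sign sequence from left to right. The entries of the list are the
signs of the diagram and of the weight at the successive places. The stack holds the signs of the weight
at the left ends of the open cups, the option that at the left end of an open linked cup. The result
is the product of the weights of the cups closed on the way, or zero if one of them is not oriented. -/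
noncomputable def scan : List (Bool × Bool) → List Bool → Option Bool → L
  | [], _, _ => 1
  | (true, y) :: l, S, p => scan l (y :: S) p
  | (false, y) :: l, x :: S, p => if y = !x then cupWeight y * scan l S p else 0
  | (false, y) :: l, [], none => scan l [] (some y)
  | (false, y) :: l, [], some x => if y = x then cupWeight y * scan l [] none else 0

/-- All cups are closed at the end of the list if initially `m` cups are open. -/
def Closes : List (Bool × Bool) → ℕ → Prop
  | [], m => m = 0
  | (true, _) :: l, m => Closes l (m + 1)
  | (false, _) :: l, m => Closes l (m - 1)

/-- At worst every entry of `l` opens a cup. -/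
lemma closes_append_replicate {l : List (Bool × Bool)} {m k : ℕ} (h : k + l.length ≤ m) (y : Bool) :
    Closes (l ++ List.replicate m (false, y)) k := by
  induction l generalizing k with
  | nil =>
    simp only [List.length_nil, add_zero, List.nil_append] at *
    induction m generalizing k with
    | zero => simp only [List.replicate_zero, Closes]; omega
    | succ m ih => rw [List.replicate_succ, Closes]; exact ih (by omega)
  | cons e l ih =>
    obtain ⟨e, z⟩ := e
    rw [List.length_cons] at h
    cases e
    · rw [List.cons_append, Closes]; exact ih (by omega)
    · rw [List.cons_append, Closes]; exact ih (by omega)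

lemma T_neg_one_mul_q : (T (-1) : L) * q = 1 := by
  rw [← T_add]; simp

/-- The outermost unlinked cup with left sign `!x` and a pending linked cup with sign `x` are closed
by the same place and both require the sign `x` there. The hypothesis ensures that this place is
reached. -/
lemma scan_append_not {l : List (Bool × Bool)} {S : List Bool} {x : Bool}
    (h : Closes l (S.length + 1)) : scan l (S ++ [!x]) none = scan l S (some x) := by
  induction l generalizing S with
  | nil => simp [Closes] at h
  | cons e l ih =>
    obtain ⟨e, y⟩ := e
    cases e
    · rw [Closes] at h
      cases S with
      | nil => simp only [List.nil_append, scan, Bool.not_not]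
      | cons t S => simp only [List.cons_append, scan]; rw [ih h]
    · rw [Closes] at h
      simp only [scan]
      rw [← List.cons_append, ih (S := y :: S) h]

/-- The place that closes the bottom entry decides. A minus there leaves only the first term, with
weight `1`, a plus only the second, with weight `q` cancelled by `q⁻¹`. In both cases the surviving
pending sign is the sign of that place, as if it opened the linked cup itself. -/
lemma scan_append_add_scan_append {l : List (Bool × Bool)} {S : List Bool}
    (h : Closes l (S.length + 1)) :
    scan l (S ++ [true]) (some false) + T (-1) * scan l (S ++ [false]) (some true) =
      scan l S none := by
  induction l generalizing S with
  | nil => simp [Closes] at h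
  | cons e l ih =>
    obtain ⟨e, y⟩ := e
    cases e
    · rw [Closes] at h
      cases S with
      | nil =>
        cases y
        · simp [scan, cupWeight]
        · simp only [List.nil_append, scan, cupWeight]
          rw [if_neg (by simp), if_pos (by simp), if_pos trivial, ← mul_assoc, T_neg_one_mul_q]
          ring
      | cons t S =>
        simp only [List.cons_append, scan]
        rw [← ih h]
        split_ifs <;> ring
    · rw [Closes] at h
      simp only [scan]
      rw [← List.cons_append, ← List.cons_append, ih (S := y :: S) (by
        rw [List.length_cons]; convert h using 1)]

/-- The inner of the two bottom cups is treated as in `scan_append_add_scan_append`; the outer one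
then acts as a pending linked cup by `scan_append_not`. This is the case of the node `0`. -/
lemma scan_append_two_add_scan_append_two {l : List (Bool × Bool)} {S : List Bool}
    (h : Closes l (S.length + 2)) :
    scan l (S ++ [true, true]) none + T (-1) * scan l (S ++ [false, false]) none =
      scan l S none := by
  induction l generalizing S with
  | nil => simp [Closes] at h
  | cons e l ih =>
    obtain ⟨e, y⟩ := e
    cases e
    · rw [Closes] at h
      cases S with
      | nil =>
        have h' : Closes l (([] : List Bool).length + 1) := h
        have h1 := scan_append_not (x := false) h'
        have h2 := scan_append_not (x := true) h'
        rw [List.nil_append] at h1 h2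
        cases y
        · simp only [List.nil_append, scan, cupWeight]
          rw [if_pos (by simp), if_neg (by simp), ← h1]
          simp
        · simp only [List.nil_append, scan, cupWeight]
          rw [if_neg (by simp), if_pos (by simp), if_pos trivial, ← mul_assoc, T_neg_one_mul_q, ← h2]
          simp
      | cons t S =>
        simp only [List.cons_append, scan]
        rw [← ih h]
        split_ifs <;> ring
    · rw [Closes] at h
      simp only [scan]
      rw [← List.cons_append, ← List.cons_append, ih (S := y :: S) (by
        rw [List.length_cons]; convert h using 1)]

/-- A common prefix changes the state and multiplies by a common weight, so a local identity valid
for all states survives any prefix. -/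
lemma scan_append_linear {a b c : L} {l₁ l₂ l₃ : List (Bool × Bool)}
    (h : ∀ S p, a * scan l₁ S p + b * scan l₂ S p = c * scan l₃ S p)
    (l : List (Bool × Bool)) (S : List Bool) (p : Option Bool) :
    a * scan (l ++ l₁) S p + b * scan (l ++ l₂) S p = c * scan (l ++ l₃) S p := by
  induction l generalizing S p with
  | nil => exact h S p
  | cons e l ih =>
    obtain ⟨e, y⟩ := e
    rcases e with _ | _
    · rcases S with _ | ⟨x, S⟩
      · rcases p with _ | x
        · simp only [List.cons_append, scan]; exact ih _ _
        · simp only [List.cons_append, scan]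
          have := ih [] none
          split_ifs
          · linear_combination cupWeight y * this
          · ring
      · simp only [List.cons_append, scan]
        have := ih S p
        split_ifs
        · linear_combination cupWeight y * this
        · ring
    · simp only [List.cons_append, scan]; exact ih _ _

lemma scan_plus_minus (a b : Bool) (l : List (Bool × Bool)) (S : List Bool) (p : Option Bool) :
    scan ((true, a) :: (false, b) :: l) S p =
      if b = !a then cupWeight b * scan l S p else 0 := rfl

/-- If a cup is open on the stack, the minus closes it and the plus opens a new one; exactly one
term is oriented, and it puts the old sign back on the stack with total weight `1`. With an empty
stack the linked cups come in, and `scan_append_not` or `scan_append_add_scan_append` applies. -/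
lemma scan_minus_plus_add {l : List (Bool × Bool)} (h : Closes l 1) (S : List Bool)
    (p : Option Bool) :
    scan ((false, false) :: (true, true) :: l) S p +
      T (-1) * scan ((false, true) :: (true, false) :: l) S p = scan l S p := by
  rcases S with _ | ⟨x, S⟩
  · rcases p with _ | x
    · simp only [scan]
      exact scan_append_add_scan_append (S := []) h
    · simp only [scan, cupWeight]
      have h1 := scan_append_not (S := []) (x := x) h
      rw [List.nil_append] at h1
      rw [← h1]
      cases x
      · simp
      · rw [if_neg (by simp), if_pos (by simp), if_pos trivial, ← mul_assoc, T_neg_one_mul_q]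
        simp
  · simp only [scan, cupWeight]
    cases x
    · rw [if_neg (by simp), if_pos (by simp), if_pos trivial, ← mul_assoc, T_neg_one_mul_q]
      simp
    · simp

lemma scan_self {l : List (Bool × Bool)} (hl : ∀ e ∈ l, e.1 = e.2) {S : List Bool}
    (hS : ∀ x ∈ S, x = true) {p : Option Bool} (hp : ∀ x ∈ p, x = false) : scan l S p = 1 := by
  induction l generalizing S p with
  | nil => rfl
  | cons e l ih =>
    obtain ⟨e, y⟩ := e
    have h1 := hl _ List.mem_cons_self
    have h2 := fun e he => hl e (List.mem_cons_of_mem _ he)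
    simp only at h1
    subst h1
    rcases e with _ | _
    · rcases S with _ | ⟨x, S⟩
      · rcases p with _ | x
        · rw [scan]; exact ih h2 (by simp) (by simp)
        · obtain rfl : x = false := hp x rfl
          rw [scan, if_pos rfl, ih h2 (by simp) (by simp)]
          simp [cupWeight]
      · obtain rfl : x = true := hS x List.mem_cons_self
        rw [scan, if_pos (by simp), ih h2 (fun x hx => hS x (List.mem_cons_of_mem _ hx)) hp]
        simp [cupWeight]
    · rw [scan]
      refine ih h2 (fun x hx => ?_) hp
      rcases List.mem_cons.1 hx with rfl | hx
      · rfl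
      · exact hS x hx

/-- A scan results in zero, in a positive power of `q`, or in one; the latter happens for the weight
of the diagram only. -/
lemma scan_trichotomy {l : List (Bool × Bool)} {S : List Bool} {p : Option Bool}
    (h : Closes l S.length) (he : Even (l.length + S.length + p.toList.length)) :
    scan l S p = 0 ∨ (∃ j : ℕ, scan l S p = q ^ (j + 1)) ∨
      ((∀ e ∈ l, e.1 = e.2) ∧ (∀ x ∈ S, x = true) ∧ (∀ x ∈ p, x = false) ∧ scan l S p = 1) := by
  have step {y : Bool} {r : L} {P Q : Prop} (h : r = 0 ∨ (∃ j : ℕ, r = q ^ (j + 1)) ∨ (P ∧ r = 1))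
      (hQ : y = false → P → Q) : cupWeight y * r = 0 ∨ (∃ j : ℕ, cupWeight y * r = q ^ (j + 1)) ∨
        (Q ∧ cupWeight y * r = 1) := by
    cases y
    · rw [cupWeight, if_neg (by simp), one_mul]
      exact h.imp_right (Or.imp_right fun h => ⟨hQ rfl h.1, h.2⟩)
    · rw [cupWeight, if_pos rfl]
      rcases h with h | ⟨j, h⟩ | h
      · left; rw [h, mul_zero]
      · right; left; exact ⟨j + 1, by rw [h]; ring⟩
      · right; left; exact ⟨0, by rw [h.2]; ring⟩
  simp only [← and_assoc] at *
  induction l generalizing S p with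
  | nil =>
    rw [Closes, List.length_eq_zero_iff] at h
    subst h
    right; right
    rcases p with _ | x
    · simp [scan]
    -- A linked cup left open at the end contradicts the parity assumption.
    · simp at he
  | cons e l ih =>
    obtain ⟨e, y⟩ := e
    rw [List.length_cons] at he
    rcases e with _ | _
    · rw [Closes] at h
      rcases S with _ | ⟨x, S⟩
      · rcases p with _ | x
        · have := ih (S := []) (p := some y) h (by simpa using he)
          rw [scan]
          refine this.imp_right (Or.imp_right fun h => ⟨⟨⟨?_, by simp⟩, by simp⟩, h.2⟩)
          intro e he
          rcases List.mem_cons.1 he with rfl | he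
          · exact (h.1.2 y rfl).symm
          · exact h.1.1.1 e he
        · have := ih (S := []) (p := none) h (by
            simp [Nat.even_add_one] at he ⊢; exact he)
          rw [scan]
          split_ifs with hy
          · refine step this fun y0 h => ⟨⟨?_, by simp⟩, ?_⟩
            · intro e he
              rcases List.mem_cons.1 he with rfl | he
              · exact y0.symm
              · exact h.1.1 e he
            · intro x' hx'
              obtain rfl : x = x' := by simpa using hx'
              rw [← hy, y0]
          · left; rfl
      · have := ih (S := S) (p := p) h (by
          rw [List.length_cons] at he
          rw [show l.length + 1 + (S.length + 1) + p.toList.length =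
            l.length + S.length + p.toList.length + 2 by ring] at he
          exact (Nat.even_add.1 he).2 even_two)
        rw [scan]
        split_ifs with hy
        · refine step this fun y0 h => ⟨⟨?_, ?_⟩, h.2⟩
          · intro e he
            rcases List.mem_cons.1 he with rfl | he
            · exact y0.symm
            · exact h.1.1 e he
          · intro x' hx'
            rcases List.mem_cons.1 hx' with rfl | hx'
            · rw [y0] at hy; simpa using hy.symm
            · exact h.1.2 x' hx'
        · left; rfl
    · rw [Closes] at h
      have := ih (S := y :: S) (p := p) h (by
        rw [List.length_cons]
        rwa [show l.length + (S.length + 1) + p.toList.length =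
            l.length + 1 + S.length + p.toList.length by ring])
      rw [scan]
      refine this.imp_right (Or.imp_right fun h => ⟨⟨⟨?_, ?_⟩, h.1.2⟩, h.2⟩)
      · intro e he
        rcases List.mem_cons.1 he with rfl | he
        · exact (h.1.1.2 y List.mem_cons_self).symm
        · exact h.1.1.1 e he
      · exact fun x hx => h.1.1.2 x (List.mem_cons_of_mem _ hx)

/-! ### Local rules for the coefficients of the cup diagrams. -/

/-- The signs of `ε` and `v` at the places `1, …, n`, followed by `n` frozen minuses. -/
def placeList (n : ℕ) (ε v : ℕ → Bool) : List (Bool × Bool) :=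
  (List.range' 1 n).map (fun k => (ε k, v k)) ++ List.replicate n (false, false)

/-- The coefficient of the weight `v` in the element defined by the cup diagram of `ε`. -/
noncomputable def cupCoeff (n : ℕ) (ε v : ℕ → Bool) : L := scan (placeList n ε v) [] none

/-- The places to the left of `i`. -/
def placesBefore (i : ℕ) (ε v : ℕ → Bool) : List (Bool × Bool) :=
  (List.range' 1 (i - 1)).map (fun k => (ε k, v k))

/-- The places to the right of `i + 1`. -/
def placesAfter (n i : ℕ) (ε v : ℕ → Bool) : List (Bool × Bool) :=
  (List.range' (i + 2) (n - i - 1)).map (fun k => (ε k, v k)) ++ List.replicate n (false, false)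

lemma placeList_eq {n i : ℕ} (hi : 1 ≤ i) (hn : i + 1 ≤ n) (ε v : ℕ → Bool) :
    placeList n ε v = placesBefore i ε v ++
      ((ε i, v i) :: (ε (i + 1), v (i + 1)) :: placesAfter n i ε v) := by
  have h : List.range' 1 n =
      List.range' 1 (i - 1) ++ (i :: (i + 1) :: List.range' (i + 2) (n - i - 1)) := by
    have h2 : List.range' i (n - i - 1 + 1 + 1) = i :: (i + 1) :: List.range' (i + 2) (n - i - 1) := by
      rw [List.range'_succ, List.range'_succ]
    have := List.range'_append_1 (s := 1) (m := i - 1) (n := n - i - 1 + 1 + 1)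
    rw [show 1 + (i - 1) = i by omega] at this
    rw [← h2, this]; congr 1; omega
  rw [placeList, h, placesBefore, placesAfter]
  simp

lemma placesBefore_congr {i : ℕ} {ε v ε' v' : ℕ → Bool} (h : ∀ k, 1 ≤ k → k < i → ε k = ε' k)
    (h' : ∀ k, 1 ≤ k → k < i → v k = v' k) : placesBefore i ε v = placesBefore i ε' v' := by
  refine List.map_congr_left fun k hk => ?_
  rw [List.mem_range'_1] at hk
  rw [h k (by omega) (by omega), h' k (by omega) (by omega)]

lemma placesAfter_congr {n i : ℕ} {ε v ε' v' : ℕ → Bool} (h : ∀ k, i + 1 < k → ε k = ε' k)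
    (h' : ∀ k, i + 1 < k → v k = v' k) : placesAfter n i ε v = placesAfter n i ε' v' := by
  rw [placesAfter, placesAfter, List.append_left_inj]
  refine List.map_congr_left fun k hk => ?_
  rw [List.mem_range'_1] at hk
  rw [h k (by omega), h' k (by omega)]

/-- The `n` frozen minuses just suffice: `i + 1` cups are open and `n - i - 1` more places follow.
-/
lemma closes_placesAfter {n i : ℕ} (hn : i + 1 ≤ n) (ε v : ℕ → Bool) :
    Closes (placesAfter n i ε v) (i + 1) :=
  closes_append_replicate (by simp; omega) _

lemma Closes.mono {l : List (Bool × Bool)} {m k : ℕ} (h : Closes l m) (hk : k ≤ m) : Closes l k := by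
  induction l generalizing m k with
  | nil => simp only [Closes] at *; omega
  | cons e l ih =>
    obtain ⟨_ | _, y⟩ := e
    · rw [Closes] at *; exact ih h (by omega)
    · rw [Closes] at *; exact ih h (by omega)

lemma act_of_ne {i k : ℕ} (ε : ℕ → Bool) (h : if i = 0 then k ≠ 1 ∧ k ≠ 2 else k ≠ i ∧ k ≠ i + 1) :
    act i ε k = ε k := by
  rw [act]; grind

lemma cupCoeff_act_pos {n i : ℕ} (hi : 1 ≤ i) (hn : i + 1 ≤ n) (ε v : ℕ → Bool) {δ u : ℕ → Bool}
    (hδ : δ = ε ∨ δ = act i ε) (hu : u = v ∨ u = act i v) :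
    cupCoeff n δ u = scan (placesBefore i ε v ++
      ((δ i, u i) :: (δ (i + 1), u (i + 1)) :: placesAfter n i ε v)) [] none := by
  have key {δ ε : ℕ → Bool} (hδ : δ = ε ∨ δ = act i ε) (k : ℕ) (hk : k ≠ i ∧ k ≠ i + 1) :
      δ k = ε k := by
    rcases hδ with rfl | rfl
    · rfl
    · exact act_of_ne _ (by rw [if_neg (by omega)]; exact hk)
  rw [cupCoeff, placeList_eq hi hn,
    placesBefore_congr (fun k _ h => key hδ k (by omega)) (fun k _ h => key hu k (by omega)),
    placesAfter_congr (fun k h => key hδ k (by omega)) (fun k h => key hu k (by omega))]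

lemma cupCoeff_act_zero {n : ℕ} (hn : 2 ≤ n) (ε v : ℕ → Bool) {δ u : ℕ → Bool}
    (hδ : δ = ε ∨ δ = act 0 ε) (hu : u = v ∨ u = act 0 v) :
    cupCoeff n δ u = scan ((δ 1, u 1) :: (δ 2, u 2) :: placesAfter n 1 ε v) [] none := by
  have key {δ ε : ℕ → Bool} (hδ : δ = ε ∨ δ = act 0 ε) (k : ℕ) (hk : k ≠ 1 ∧ k ≠ 2) :
      δ k = ε k := by
    rcases hδ with rfl | rfl
    · rfl
    · exact act_of_ne _ (by rw [if_pos rfl]; exact hk)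
  rw [cupCoeff, placeList_eq le_rfl hn,
    placesAfter_congr (fun k h => key hδ k (by omega)) (fun k h => key hu k (by omega))]
  rfl

/-- The small cup at `i, i + 1` sees equal signs, or for `i = 0` the linked small cup at `1, 2` sees
different ones, so it is not oriented. -/
lemma cupCoeff_eq_zero {n i : ℕ} (hn : 2 ≤ n) (hi : i < n) {ε v : ℕ → Bool} (hε : IsDesc i ε)
    (hv : act i v = v) : cupCoeff n ε v = 0 := by
  rw [act_eq_self_iff] at hv
  rw [IsDesc] at hε
  by_cases h0 : i = 0
  · subst h0
    rw [if_pos rfl] at hε hv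
    rw [cupCoeff_act_zero hn ε v (Or.inl rfl) (Or.inl rfl), hε.1, hε.2, scan, scan, if_neg]
    rw [hv]; cases v 2 <;> simp
  · rw [if_neg h0] at hε hv
    rw [cupCoeff_act_pos (by omega) hi ε v (Or.inl rfl) (Or.inl rfl), hε.1, hε.2]
    -- The terms with coefficient `0` only bring the identity into the form of `scan_append_linear`.
    have h : ∀ S p, (1 : L) * scan ((true, v i) :: (false, v (i + 1)) :: placesAfter n i ε v) S p +
        0 * scan [] S p = 0 * scan [] S p := by
      intro S p
      rw [scan_plus_minus, if_neg]
      · ring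
      · rw [hv]; cases v (i + 1) <;> simp
    simpa using scan_append_linear h (placesBefore i ε v) [] none

/-- The small cup is clockwise in `v` and anticlockwise in `act i v`; nothing else changes. -/
lemma cupCoeff_of_isAsc {n i : ℕ} (hn : 2 ≤ n) (hi : i < n) {ε v : ℕ → Bool} (hε : IsDesc i ε)
    (hv : IsAsc i v) : cupCoeff n ε v = q * cupCoeff n ε (act i v) := by
  have hv' := hv.isDesc_act
  rw [IsDesc] at hε hv'
  rw [IsAsc] at hv
  by_cases h0 : i = 0
  · subst h0
    rw [if_pos rfl] at hε hv hv'
    rw [cupCoeff_act_zero hn ε v (Or.inl rfl) (Or.inl rfl),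
      cupCoeff_act_zero hn ε v (Or.inl rfl) (Or.inr rfl), hε.1, hε.2, hv.1, hv.2, hv'.1, hv'.2]
    simp [scan, cupWeight]
  · rw [if_neg h0] at hε hv hv'
    rw [cupCoeff_act_pos (by omega) hi ε v (Or.inl rfl) (Or.inl rfl),
      cupCoeff_act_pos (by omega) hi ε v (Or.inl rfl) (Or.inr rfl), hε.1, hε.2, hv.1, hv.2, hv'.1,
      hv'.2]
    have h : ∀ S p, (1 : L) * scan ((true, false) :: (false, true) :: placesAfter n i ε v) S p +
        0 * scan [] S p = q * scan ((true, true) :: (false, false) :: placesAfter n i ε v) S p := by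
      intro S p
      rw [scan_plus_minus, scan_plus_minus]
      simp [cupWeight]
    simpa using scan_append_linear h (placesBefore i ε v) [] none

/-- On the left the small cup is anticlockwise and can be deleted. On the right the same two places
join other cups, and the two weights sum up to the value of the diagram without these places, by
`scan_minus_plus_add` or, for `i = 0`, `scan_append_two_add_scan_append_two`. -/
lemma cupCoeff_act_act {n i : ℕ} (hn : 2 ≤ n) (hi : i < n) {ε v : ℕ → Bool} (hε : IsAsc i ε)
    (hv : IsAsc i v) : cupCoeff n (act i ε) (act i v) =
      cupCoeff n ε v + T (-1) * cupCoeff n ε (act i v) := by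
  have hv' := hv.isDesc_act
  have hε' := hε.isDesc_act
  rw [IsDesc] at hε' hv'
  rw [IsAsc] at hv hε
  by_cases h0 : i = 0
  · subst h0
    rw [if_pos rfl] at hε hv hv' hε'
    rw [cupCoeff_act_zero hn ε v (Or.inl rfl) (Or.inl rfl),
      cupCoeff_act_zero hn ε v (Or.inl rfl) (Or.inr rfl),
      cupCoeff_act_zero hn ε v (Or.inr rfl) (Or.inr rfl), hε.1, hε.2, hv.1, hv.2, hv'.1, hv'.2,
      hε'.1, hε'.2]
    have := scan_append_two_add_scan_append_two (S := []) (closes_placesAfter hn ε v)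
    simp only [scan, cupWeight]
    rw [List.nil_append, List.nil_append] at this
    rw [this]
    simp
  · rw [if_neg h0] at hε hv hv' hε'
    rw [cupCoeff_act_pos (by omega) hi ε v (Or.inl rfl) (Or.inl rfl),
      cupCoeff_act_pos (by omega) hi ε v (Or.inl rfl) (Or.inr rfl),
      cupCoeff_act_pos (by omega) hi ε v (Or.inr rfl) (Or.inr rfl), hε.1, hε.2, hv.1, hv.2, hv'.1,
      hv'.2, hε'.1, hε'.2]
    have h : ∀ S p, (1 : L) * scan ((false, false) :: (true, true) :: placesAfter n i ε v) S p +
        T (-1) * scan ((false, true) :: (true, false) :: placesAfter n i ε v) S p =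
          1 * scan ((true, true) :: (false, false) :: placesAfter n i ε v) S p := by
      intro S p
      rw [one_mul, scan_minus_plus_add ((closes_placesAfter hi ε v).mono (by omega)),
        scan_plus_minus]
      simp [cupWeight]
    simpa using (scan_append_linear h (placesBefore i ε v) [] none).symm

lemma cupCoeff_self {n : ℕ} (ε : ℕ → Bool) : cupCoeff n ε ε = 1 := by
  refine scan_self (fun e he => ?_) (by simp) (by simp)
  rw [placeList, List.mem_append] at he
  rcases he with he | he
  · obtain ⟨k, -, rfl⟩ := List.mem_map.1 he
    rfl
  · rw [List.eq_of_mem_replicate he]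

lemma cupCoeff_trichotomy {n : ℕ} {ε v : ℕ → Bool} (hε : IsSignSeq n ε) (hv : IsSignSeq n v) :
    ε = v ∨ cupCoeff n ε v = 0 ∨ ∃ j : ℕ, cupCoeff n ε v = q ^ (j + 1) := by
  rcases scan_trichotomy (l := placeList n ε v) (S := []) (p := none)
    (closes_append_replicate (by simp) _) (by simp [placeList]) with h | h | h
  · exact Or.inr (Or.inl h)
  · exact Or.inr (Or.inr h)
  · left
    funext k
    by_cases hk : k = 0
    · rw [hk, hε.zero, hv.zero]
    by_cases hk' : k ≤ n
    · refine h.1 (ε k, v k) (List.mem_append_left _ (List.mem_map.2 ⟨k, ?_, rfl⟩))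
      rw [List.mem_range'_1]; omega
    · rw [hε.large k (by omega), hv.large k (by omega)]

/-- The diagram of the identity is oriented by the weight of the identity only. -/
lemma cupCoeff_all_plus {n : ℕ} {ε v : ℕ → Bool} (hε : ∀ k, 1 ≤ k → ε k = true)
    (h : cupCoeff n ε v ≠ 0) (k : ℕ) (hk : 1 ≤ k) (hk' : k ≤ n) : v k = true := by
  -- All places are pushed on the stack, and every stack entry is closed by a frozen minus, which
  -- forces a plus.
  have key : ∀ (l : List ℕ) (S : List Bool) (m : ℕ), (∀ k ∈ l, 1 ≤ k) → l.length + S.length ≤ m →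
      scan (l.map (fun k => (ε k, v k)) ++ List.replicate m (false, false)) S none ≠ 0 →
        (∀ k ∈ l, v k = true) ∧ ∀ x ∈ S, x = true := by
    intro l
    induction l with
    | nil =>
      intro S m _ hm h
      refine ⟨by simp, ?_⟩
      induction S generalizing m with
      | nil => simp
      | cons x S ih =>
        obtain ⟨m, rfl⟩ : ∃ m', m = m' + 1 := ⟨m - 1, by simp at hm; omega⟩
        simp only [List.map_nil, List.nil_append, List.replicate_succ, scan] at h
        split_ifs at h with hx
        · have := ih m (by simp at hm ⊢; omega) (right_ne_zero_of_mul h)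
          intro y hy
          rcases List.mem_cons.1 hy with rfl | hy
          · simpa using hx
          · exact this y hy
        · exact absurd rfl h
    | cons a l ih =>
      intro S m hl hm h
      simp only [List.map_cons, List.cons_append, hε a (hl a List.mem_cons_self), scan] at h
      have := ih (v a :: S) m (fun k hk => hl k (List.mem_cons_of_mem _ hk))
        (by simp at hm ⊢; omega) h
      refine ⟨fun k hk => ?_, fun x hx => this.2 x (List.mem_cons_of_mem _ hx)⟩
      rcases List.mem_cons.1 hk with rfl | hk
      · exact this.2 _ List.mem_cons_self
      · exact this.1 k hk
  refine (key (List.range' 1 n) [] n (fun k hk => ?_) (by simp) h).1 k ?_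
  · rw [List.mem_range'_1] at hk; omega
  · rw [List.mem_range'_1]; omega

end Scan

/-! ### The diagram elements form the Kazhdan–Lusztig basis. -/

section KazhdanLusztig

lemma coeff_q_mul_toLaurent (p : Polynomial ℤ) {k : ℤ} (hk : k ≤ 0) :
    (q * Polynomial.toLaurent p : L).coeff k = 0 := by
  induction p using Polynomial.induction_on' with
  | add p₁ p₂ h₁ h₂ =>
    rw [map_add, mul_add, AddMonoidAlgebra.coeff_add, Finsupp.add_apply, h₁, h₂, add_zero]
  | monomial m a =>
    rw [Polynomial.toLaurent_C_mul_T, mul_left_comm, ← T_add, ← single_eq_C_mul_T]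
    exact Finsupp.single_eq_of_ne (by omega)

/-- Coefficients in degrees `≤ 0` vanish, and the symmetry carries this over to the degrees `≥ 0`.
-/
lemma eq_zero_of_sigma_eq {c : L} {p : Polynomial ℤ} (hc : c = q * Polynomial.toLaurent p)
    (h : sigma c = c) : c = 0 := by
  refine LaurentPolynomial.ext fun k => ?_
  rcases le_total k 0 with hk | hk
  · rw [hc, coeff_q_mul_toLaurent p hk]; rfl
  · rw [← h]
    change (LaurentPolynomial.invert c).coeff k = _
    rw [invert_apply, hc, coeff_q_mul_toLaurent p (by omega)]; rfl

variable {n : ℕ}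

/-- The coefficient of `N_v` in the basis element of `w`. -/
noncomputable def repCoeff (v w : MinCosetRep n) : L := cupCoeff n (signSeq w.1) (signSeq v.1)

lemma signSeq_oneRep (k : ℕ) : signSeq (oneRep n).1 k = decide (k ≠ 0) := signSeq_one k

lemma MinCosetRep.exists_isDesc (hn : 2 ≤ n) {w : MinCosetRep n} (hw : w ≠ oneRep n) :
    ∃ (i : Fin n) (u : MinCosetRep n), IsAsc i (signSeq u.1) ∧
      signSeq w.1 = act i (signSeq u.1) ∧ signSeq u.1 = act i (signSeq w.1) := by
  obtain ⟨i, u, -, gu, hd, e⟩ := (w.isGood hn).exists_factor hn fun h => hw (Subtype.ext h)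
  refine ⟨i, ⟨u, fun r hr => gu.len_lt hn hr⟩, ?_, ?_, e⟩
  · rw [e]; exact hd.isAsc_act
  · rw [e, act_act]

/-- The representative with the sign sequence of `w s_i`. -/
noncomputable def actRep (hn : 2 ≤ n) (i : Fin n) (w : MinCosetRep n) : MinCosetRep n :=
  (MinCosetRep.exists_of_isSignSeq hn ((isSignSeq_signSeq hn w.1).act hn i.2)).choose

lemma signSeq_actRep (hn : 2 ≤ n) (i : Fin n) (w : MinCosetRep n) :
    signSeq (actRep hn i w).1 = act i (signSeq w.1) :=
  (MinCosetRep.exists_of_isSignSeq hn ((isSignSeq_signSeq hn w.1).act hn i.2)).choose_spec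

lemma actRep_actRep (hn : 2 ≤ n) (i : Fin n) (w : MinCosetRep n) :
    actRep hn i (actRep hn i w) = w :=
  MinCosetRep.eq_of_signSeq_eq hn (by rw [signSeq_actRep, signSeq_actRep, act_act])

lemma repCoeff_self (w : MinCosetRep n) : repCoeff w w = 1 := cupCoeff_self _

lemma repCoeff_oneRep (hn : 2 ≤ n) {v : MinCosetRep n} (h : repCoeff v (oneRep n) ≠ 0) :
    v = oneRep n := by
  refine MinCosetRep.eq_of_signSeq_eq hn (funext fun k => ?_)
  rw [signSeq_oneRep]
  by_cases hk : k = 0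
  · rw [hk, (isSignSeq_signSeq hn v.1).zero]; simp
  by_cases hk' : k ≤ n
  · rw [cupCoeff_all_plus (fun k hk => by rw [signSeq_oneRep]; simp; omega) h k (by omega) hk']
    simp [hk]
  · rw [(isSignSeq_signSeq hn v.1).large k (by omega)]; simp [hk]

/-- Induction on the length of `w` along the local rules, with a descent `i` of `w`. -/
lemma repCoeff_triangular (hn : 2 ≤ n) {v w : MinCosetRep n} (h : repCoeff v w ≠ 0) :
    v = w ∨ seqLen n (signSeq v.1) < seqLen n (signSeq w.1) := by
  induction hk : seqLen n (signSeq w.1) generalizing v w with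
  | zero =>
    left
    have : w = oneRep n := by
      refine Subtype.ext ((coxeterMatrix n).toCoxeterSystem.length_eq_zero_iff.1 ?_)
      have := w.isGood hn
      rw [IsGood] at this
      exact this.trans hk
    subst this
    exact repCoeff_oneRep hn h
  | succ k ih =>
    have hw : w ≠ oneRep n := by
      rintro rfl
      rw [oneRep, seqLen_one] at hk; omega
    obtain ⟨i, u, ha, e, -⟩ := MinCosetRep.exists_isDesc hn hw
    have hd : IsDesc i (signSeq w.1) := by rw [e]; exact ha.isDesc_act
    have hl := ha.seqLen hn i.2
    rw [← e] at hl
    -- By `cupCoeff_act_act` one of the coefficients of `v'` and `v' s_i` for the shorter `u` is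
    -- nonzero. An ascent `v` is later reduced to `v s_i` by `cupCoeff_of_isAsc`.
    have main : ∀ v' : MinCosetRep n, IsDesc i (signSeq v'.1) → repCoeff v' w ≠ 0 →
        v' = w ∨ seqLen n (signSeq v'.1) < k + 1 := by
      intro v' hv' h'
      have e2 : signSeq v'.1 = act i (signSeq (actRep hn i v').1) := by
        rw [signSeq_actRep, act_act]
      have ha' : IsAsc i (signSeq (actRep hn i v').1) := by
        rw [signSeq_actRep]; exact hv'.isAsc_act
      have hl' := ha'.seqLen hn i.2
      rw [← e2] at hl'
      rw [repCoeff, e, e2, cupCoeff_act_act hn i.2 ha ha', ← e2] at h'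
      by_cases h0 : cupCoeff n (signSeq u.1) (signSeq v'.1) = 0
      · rw [h0, mul_zero, add_zero] at h'
        rcases ih h' (by omega) with h3 | h3
        · left
          refine MinCosetRep.eq_of_signSeq_eq hn ?_
          rw [e2, h3, e]
        · right; omega
      · rcases ih (v := v') h0 (by omega) with h3 | h3
        · right; rw [h3]; omega
        · right; omega
    rcases isDesc_or_isAsc_or_eq i (signSeq v.1) with hv | hv | hv
    · exact main v hv h
    · right
      rw [repCoeff, cupCoeff_of_isAsc hn i.2 hd hv, ← signSeq_actRep hn i v] at h
      have h1 := main (actRep hn i v) (by rw [signSeq_actRep]; exact hv.isDesc_act)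
        (right_ne_zero_of_mul h)
      have h2 := hv.seqLen hn i.2
      rw [← signSeq_actRep hn i v] at h2
      rcases h1 with h1 | h1
      · rw [h1] at h2; omega
      · omega
    · exact absurd (cupCoeff_eq_zero hn i.2 hd hv) h

lemma repCoeff_eq_q_mul (hn : 2 ≤ n) {v w : MinCosetRep n} (h : v ≠ w) :
    ∃ p : Polynomial ℤ, repCoeff v w = q * Polynomial.toLaurent p := by
  rcases cupCoeff_trichotomy (isSignSeq_signSeq hn w.1) (isSignSeq_signSeq hn v.1) with h' | h' | h'
  · exact absurd (MinCosetRep.eq_of_signSeq_eq hn h'.symm) h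
  · exact ⟨0, by rw [repCoeff, h', map_zero, mul_zero]⟩
  · obtain ⟨j, hj⟩ := h'
    exact ⟨Polynomial.X ^ j, by
      rw [repCoeff, hj, map_pow, Polynomial.toLaurent_X, pow_succ, mul_comm]⟩

variable [Fintype (MinCosetRep n)]

/-- The Kazhdan-Lusztig basis element of `w`. -/
noncomputable def klElement (w : MinCosetRep n) : ParabolicModule n := ∑ v, repCoeff v w • N v

lemma klElement_oneRep (hn : 2 ≤ n) : klElement (oneRep n) = N (oneRep n) := by
  rw [klElement, Finset.sum_eq_single (oneRep n)]
  · rw [repCoeff_self, one_smul]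
  · intro v _ hv
    rw [not_not.1 (mt (repCoeff_oneRep hn) hv), zero_smul]
  · simp

/-- The coefficients of `N_v` are compared. On the right `N_v` arises from `v s_i` with factor `1`
and from `v` with factor `q` or `q⁻¹`, unless `s_i` fixes `v`; the three local rules are exactly the
three cases. -/
lemma klElement_eq_rightMul (hn : 2 ≤ n) {i : Fin n} {u w : MinCosetRep n}
    (ha : IsAsc i (signSeq u.1)) (e : signSeq w.1 = act i (signSeq u.1)) :
    klElement w = rightMul (C i) (klElement u) := by
  classical
  have hd : IsDesc i (signSeq w.1) := by rw [e]; exact ha.isDesc_act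
  have key : ∀ v : MinCosetRep n, rightMul (C i) (N v) =
      (if act i (signSeq v.1) = signSeq v.1 then (0 : L) else 1) • N (actRep hn i v) +
      (if act i (signSeq v.1) = signSeq v.1 then (0 : L) else
        if IsAsc i (signSeq v.1) then q else T (-1)) • N v := by
    intro v
    rcases isDesc_or_isAsc_or_eq i (signSeq v.1) with hv | hv | hv
    · rw [rightMul_C_of_isDesc hn hv (signSeq_actRep hn i v), if_neg hv.ne, if_neg hv.ne,
        if_neg hv.not_isAsc, one_smul]
    · rw [rightMul_C_of_isAsc hn hv (signSeq_actRep hn i v), if_neg hv.ne, if_neg hv.ne,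
        if_pos hv, one_smul]
    · rw [rightMul_C_of_eq hn hv, if_pos hv, if_pos hv, zero_smul, zero_smul, add_zero]
  have hinv : Function.Involutive (actRep hn i) := actRep_actRep hn i
  rw [klElement, klElement, map_sum]
  simp only [map_smul, key, smul_add, Finset.sum_add_distrib, smul_smul]
  -- Reindexing by `v ↦ v s_i` collects the contributions to a fixed `N_v`.
  rw [← Equiv.sum_comp (Function.Involutive.toPerm _ hinv)
    (fun v => (repCoeff v u * if act i (signSeq v.1) = signSeq v.1 then (0 : L) else 1) •
      N (actRep hn i v)), ← Finset.sum_add_distrib]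
  refine Finset.sum_congr rfl fun v _ => ?_
  rw [Function.Involutive.coe_toPerm, actRep_actRep, ← add_smul, signSeq_actRep, act_act]
  congr 1
  have e2 : signSeq v.1 = act i (signSeq (actRep hn i v).1) := by rw [signSeq_actRep, act_act]
  rcases isDesc_or_isAsc_or_eq i (signSeq v.1) with hv | hv | hv
  · have ha' : IsAsc i (signSeq (actRep hn i v).1) := by rw [signSeq_actRep]; exact hv.isAsc_act
    rw [if_neg hv.ne.symm, if_neg hv.ne, if_neg hv.not_isAsc, repCoeff, repCoeff, repCoeff, e, e2,
      cupCoeff_act_act hn i.2 ha ha', ← e2]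
    ring
  · rw [if_neg hv.ne.symm, if_neg hv.ne, if_pos hv, repCoeff, repCoeff, repCoeff,
      cupCoeff_of_isAsc hn i.2 hd hv, e, cupCoeff_act_act hn i.2 ha hv, signSeq_actRep]
    linear_combination cupCoeff n (signSeq u.1) (act i (signSeq v.1)) * T_neg_one_mul_q
  · rw [if_pos hv.symm, if_pos hv, repCoeff, cupCoeff_eq_zero hn i.2 hd hv]
    ring

lemma barParabolic_klElement (hn : 2 ≤ n) (w : MinCosetRep n) :
    barParabolic n (klElement w) = klElement w := by
  induction hk : seqLen n (signSeq w.1) using Nat.strong_induction_on generalizing w with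
  | _ k ih =>
  by_cases hw : w = oneRep n
  · rw [hw, klElement_oneRep hn, barParabolic_N_oneRep]
  · obtain ⟨i, u, ha, e, -⟩ := MinCosetRep.exists_isDesc hn hw
    have hl := ha.seqLen hn i.2
    rw [← e] at hl
    rw [klElement_eq_rightMul hn ha e, barParabolic_rightMul, bar_C, ih _ (by omega) u rfl]

lemma repr_klElement (hn : 2 ≤ n) (v w : MinCosetRep n) :
    (stdBasis hn).repr (klElement w) v = repCoeff v w := by
  have : klElement w = ∑ v, repCoeff v w • stdBasis hn v := by
    simp only [stdBasis_apply]; rfl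
  rw [this, Module.Basis.repr_sum_self]

/-- For `w` of at least the length of `v` the right side is the Kronecker delta by
`repCoeff_triangular`, so the bar involution is unitriangular. This follows by expanding the
bar-invariant `klElement v`, whose other terms are shorter and covered by induction. -/
lemma repr_barParabolic_N (hn : 2 ≤ n) {v w : MinCosetRep n}
    (h : seqLen n (signSeq v.1) ≤ seqLen n (signSeq w.1)) :
    (stdBasis hn).repr (barParabolic n (N v)) w = repCoeff w v := by
  classical
  induction hk : seqLen n (signSeq v.1) using Nat.strong_induction_on generalizing v with
  | _ k ih =>
  have h1 := barParabolic_klElement hn v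
  nth_rw 1 [klElement] at h1
  rw [← Finset.add_sum_erase _ _ (Finset.mem_univ v), map_add, repCoeff_self, one_smul,
    map_sum] at h1
  have h2 := congrArg (fun x => (stdBasis hn).repr x w) h1
  simp only [map_add, Finsupp.add_apply, repr_klElement, map_sum, Finsupp.finsetSum_apply] at h2
  rw [Finset.sum_eq_zero, add_zero] at h2
  · exact h2
  · intro u hu
    have hu := (Finset.mem_erase.1 hu).1
    by_cases h0 : repCoeff u v = 0
    · rw [h0, zero_smul, map_zero, map_zero]; rfl
    · have h3 := (repCoeff_triangular hn h0).resolve_left hu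
      rw [LinearMap.map_smulₛₗ, map_smul, Finsupp.smul_apply, ih _ (by omega) (by omega) rfl,
        smul_eq_mul]
      by_contra h4
      rcases repCoeff_triangular hn (right_ne_zero_of_mul h4) with h5 | h5
      · rw [h5] at h; omega
      · omega

/-- At a longest `w` in the support, unitriangularity makes the coefficient itself invariant under
`q ↦ q⁻¹`, so it vanishes by `eq_zero_of_sigma_eq`. -/
lemma eq_zero_of_barParabolic_eq (hn : 2 ≤ n) {x : ParabolicModule n}
    (hx : barParabolic n x = x)
    (hc : ∀ v, ∃ p : Polynomial ℤ, (stdBasis hn).repr x v = q * Polynomial.toLaurent p) :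
    x = 0 := by
  classical
  by_contra hne
  have hs : (Finset.univ.filter fun v => (stdBasis hn).repr x v ≠ 0).Nonempty := by
    by_contra hs
    rw [Finset.not_nonempty_iff_eq_empty, Finset.filter_eq_empty_iff] at hs
    refine hne ((stdBasis hn).repr.map_eq_zero_iff.1 (Finsupp.ext fun v => ?_))
    simpa using hs (Finset.mem_univ v)
  obtain ⟨w, hw, hmax⟩ := Finset.exists_max_image _ (fun v => seqLen n (signSeq v.1)) hs
  have hw := (Finset.mem_filter.1 hw).2
  apply hw
  obtain ⟨p, hp⟩ := hc w
  refine eq_zero_of_sigma_eq hp ?_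
  have h1 : barParabolic n x =
      ∑ v, sigma ((stdBasis hn).repr x v) • barParabolic n (N v) := by
    conv_lhs => rw [← (stdBasis hn).sum_repr x]
    rw [map_sum]
    simp only [LinearMap.map_smulₛₗ, stdBasis_apply]
  conv_rhs => rw [← hx, h1]
  simp only [map_sum, Finsupp.finsetSum_apply, map_smul, Finsupp.smul_apply, smul_eq_mul]
  rw [Finset.sum_eq_single w]
  · rw [repr_barParabolic_N hn le_rfl, repCoeff_self, mul_one]
  · intro v _ hv
    by_cases h0 : (stdBasis hn).repr x v = 0
    · rw [h0, map_zero, zero_mul]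
    · have h2 := hmax v (Finset.mem_filter.2 ⟨Finset.mem_univ v, h0⟩)
      rw [repr_barParabolic_N hn h2]
      by_contra h3
      rcases repCoeff_triangular hn (right_ne_zero_of_mul h3) with h4 | h4
      · exact hv h4.symm
      · omega
  · simp

lemma isKLFamily_klElement (hn : 2 ≤ n) : IsKLFamily n (klElement (n := n)) := by
  classical
  intro w
  refine ⟨barParabolic_klElement hn w, Finsupp.equivFunOnFinite.symm fun v =>
    if h : v = w then 0 else (repCoeff_eq_q_mul hn h).choose, by simp, ?_⟩
  rw [Finsupp.sum_fintype _ _ (by simp), klElement, ← Finset.add_sum_erase _ _ (Finset.mem_univ w),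
    repCoeff_self, one_smul, ← Finset.add_sum_erase _ _ (Finset.mem_univ w)]
  simp only [Finsupp.equivFunOnFinite_symm_apply_apply, dif_pos, map_zero, mul_zero, zero_smul,
    zero_add]
  congr 1
  refine Finset.sum_congr rfl fun v hv => ?_
  rw [dif_neg (Finset.mem_erase.1 hv).1,
    ← (repCoeff_eq_q_mul hn (Finset.mem_erase.1 hv).1).choose_spec]

lemma IsKLFamily.exists_repr (hn : 2 ≤ n) {B : MinCosetRep n → ParabolicModule n}
    (hB : IsKLFamily n B) (v w : MinCosetRep n) :
    ∃ p : Polynomial ℤ, (stdBasis hn).repr (B w - N w) v = q * Polynomial.toLaurent p := by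
  obtain ⟨-, c, -, hc⟩ := hB w
  refine ⟨c v, ?_⟩
  have : (c.sum fun v p => (q * Polynomial.toLaurent p) • N v : ParabolicModule n) =
      ∑ v, (q * Polynomial.toLaurent (c v)) • stdBasis hn v := by
    rw [Finsupp.sum_fintype _ _ (by simp)]
    simp only [stdBasis_apply]
  rw [hc, add_sub_cancel_left, this, Module.Basis.repr_sum_self]

lemma IsKLFamily.eq_klElement (hn : 2 ≤ n) {B : MinCosetRep n → ParabolicModule n}
    (hB : IsKLFamily n B) : B = klElement := by
  funext w
  refine sub_eq_zero.1 (eq_zero_of_barParabolic_eq hn ?_ fun v => ?_)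
  · rw [map_sub, (hB w).1, barParabolic_klElement hn]
  · obtain ⟨p₁, h₁⟩ := hB.exists_repr hn v w
    obtain ⟨p₂, h₂⟩ := (isKLFamily_klElement hn).exists_repr hn v w
    refine ⟨p₁ - p₂, ?_⟩
    rw [map_sub Polynomial.toLaurent, mul_sub, ← h₁, ← h₂, ← Finsupp.sub_apply, ← map_sub]
    congr 2
    abel

lemma span_klElement (hn : 2 ≤ n) :
    Submodule.span L (Set.range (klElement (n := n))) = ⊤ := by
  classical
  refine eq_top_iff.2 ((span_N hn).symm.le.trans (Submodule.span_le.2 ?_))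
  rintro _ ⟨w, rfl⟩
  induction hk : seqLen n (signSeq w.1) using Nat.strong_induction_on generalizing w with
  | _ k ih =>
  have h1 : klElement w = N w + ∑ v ∈ Finset.univ.erase w, repCoeff v w • N v := by
    rw [klElement, ← Finset.add_sum_erase _ _ (Finset.mem_univ w), repCoeff_self, one_smul]
  rw [eq_sub_of_add_eq h1.symm]
  refine Submodule.sub_mem _ (Submodule.subset_span ⟨w, rfl⟩) (Submodule.sum_mem _ fun v hv => ?_)
  by_cases h0 : repCoeff v w = 0
  · rw [h0, zero_smul]; exact Submodule.zero_mem _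
  · have := (repCoeff_triangular hn h0).resolve_left (Finset.mem_erase.1 hv).1
    exact Submodule.smul_mem _ _ (ih _ (by omega) v rfl)

/-- A surjective endomorphism of a finitely generated module over a commutative ring is injective,
so spanning is enough. -/
lemma bijective_constr_klElement (hn : 2 ≤ n) :
    Function.Bijective ((stdBasis hn).constr L (klElement (n := n))) := by
  have hs : Function.Surjective ((stdBasis hn).constr L (klElement (n := n))) := by
    rw [← LinearMap.range_eq_top, Module.Basis.constr_range]
    exact span_klElement hn
  have : Module.Finite L (ParabolicModule n) := Module.Finite.of_basis (stdBasis hn)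
  exact OrzechProperty.bijective_of_surjective_endomorphism _ hs

/-- The Kazhdan-Lusztig basis of the parabolic module. -/
noncomputable def klBasis (hn : 2 ≤ n) : Module.Basis (MinCosetRep n) L (ParabolicModule n) :=
  (stdBasis hn).map (LinearEquiv.ofBijective _ (bijective_constr_klElement hn))

lemma klBasis_apply (hn : 2 ≤ n) (w : MinCosetRep n) : klBasis hn w = klElement w := by
  rw [klBasis, Module.Basis.map_apply, LinearEquiv.ofBijective_apply, Module.Basis.constr_basis]

end KazhdanLusztig

/-! ### Symmetry of the matching and folded cups. -/

section CupDiagram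

variable {n : ℕ}

namespace IsMatching

variable {f : ℤ → ℤ} {A : Finset (ℤ × ℤ)}

lemma snd_mem_points (hA : IsMatching n f A) {p : ℤ × ℤ} (hp : p ∈ A) : p.2 ∈ points n :=
  (hA.mem_points p hp).2

lemma eq_of_snd_eq (hA : IsMatching n f A) {p p' : ℤ × ℤ} (hp : p ∈ A) (hp' : p' ∈ A)
    (h : p.2 = p'.2) : p = p' :=
  (hA.cover _ (hA.snd_mem_points hp)).unique ⟨hp, Or.inr rfl⟩ ⟨hp', Or.inr h.symm⟩

lemma eq_of_fst_eq (hA : IsMatching n f A) {p p' : ℤ × ℤ} (hp : p ∈ A) (hp' : p' ∈ A)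
    (h : p.1 = p'.1) : p = p' :=
  (hA.cover _ (hA.mem_points _ hp).1).unique ⟨hp, Or.inl rfl⟩ ⟨hp', Or.inl h.symm⟩

lemma exists_left_end (hA : IsMatching n f A) {k : ℤ} (hk : k ∈ points n) (hf : f k ≠ 1) :
    ∃ a, (a, k) ∈ A := by
  obtain ⟨⟨a, b⟩, ⟨hp, h | h⟩, -⟩ := hA.cover k hk
  · have := (hA.label _ hp).2.1
    rw [h] at this
    exact absurd this hf
  · simp only at h
    exact ⟨a, h ▸ hp⟩

lemma exists_right_end (hA : IsMatching n f A) {k : ℤ} (hk : k ∈ points n) (hf : f k = 1) :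
    ∃ b, (k, b) ∈ A ∧ k < b := by
  obtain ⟨⟨a, b⟩, ⟨hp, h | h⟩, -⟩ := hA.cover k hk
  · simp only at h
    subst h
    exact ⟨b, hp, (hA.label _ hp).1⟩
  · have := (hA.label _ hp).2.2
    rw [h] at this
    omega

/-- The matching of an odd sequence is symmetric. -/
lemma reflect_mem (hf : IsBallot n f) (hodd : ∀ k, f (-k) = -f k) (hA : IsMatching n f A)
    {a b : ℤ} (h : (a, b) ∈ A) : (-b, -a) ∈ A := by
  have hneg : ∀ k, -k ∈ points n ↔ k ∈ points n := fun k => by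
    rw [mem_points_iff, mem_points_iff]; omega
  have hA' : IsMatching n f (A.image fun p => (-p.2, -p.1)) := by
    have mem : ∀ p : ℤ × ℤ, p ∈ A.image (fun p => (-p.2, -p.1)) ↔ (-p.2, -p.1) ∈ A := by
      rintro ⟨x, y⟩
      rw [Finset.mem_image]
      constructor
      · rintro ⟨⟨c, d⟩, hp, he⟩
        simp only [Prod.mk.injEq] at he
        rw [← he.1, ← he.2, neg_neg, neg_neg]; exact hp
      · intro hp
        exact ⟨_, hp, by simp⟩
    refine ⟨fun p hp => ?_, fun p hp => ?_, fun k hk => ?_, fun p hp p' hp' => ?_⟩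
    · have := hA.mem_points _ ((mem p).1 hp)
      rw [hneg, hneg] at this
      exact this.symm
    · have := hA.label _ ((mem p).1 hp)
      simp only [hodd] at this
      omega
    · obtain ⟨p, ⟨hp, hk⟩, hu⟩ := hA.cover (-k) ((hneg k).2 hk)
      refine ⟨(-p.2, -p.1), ⟨(mem _).2 (by simpa using hp), by simp only; omega⟩, ?_⟩
      rintro ⟨x, y⟩ ⟨hxy, hk'⟩
      have := hu _ ⟨(mem _).1 hxy, by simp only at hk' ⊢; omega⟩
      rw [← this]; simp
    · have := hA.noncrossing _ ((mem p').1 hp') _ ((mem p).1 hp)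
      simp only at this
      omega
  -- The mirror image is a matching for the same odd sequence, and there is only one.
  have : A = A.image fun p => (-p.2, -p.1) := by
    rw [hA.eq_matching hf, ← hA.eq_matching hf]
    exact (hA.eq_matching hf).trans (hA'.eq_matching hf).symm
  rw [this]
  exact Finset.mem_image.2 ⟨(a, b), h, rfl⟩

end IsMatching

lemma mem_crossing {A : Finset (ℤ × ℤ)} {p : ℤ × ℤ} :
    p ∈ crossing A ↔ p ∈ A ∧ p.1 < 0 ∧ 0 < p.2 := Finset.mem_filter

/-- An arc over the middle would intersect its mirror image unless the two coincide. -/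
lemma IsMatching.fst_eq_neg_snd {f : ℤ → ℤ} {A : Finset (ℤ × ℤ)} (hf : IsBallot n f)
    (hodd : ∀ k, f (-k) = -f k) (hA : IsMatching n f A) {p : ℤ × ℤ} (hp : p ∈ crossing A) :
    p.1 = -p.2 := by
  obtain ⟨hp, h1, h2⟩ := mem_crossing.1 hp
  have hp' := hA.reflect_mem hf hodd hp
  have n1 := hA.noncrossing _ hp _ hp'
  have n2 := hA.noncrossing _ hp' _ hp
  simp only at n1 n2
  omega

/-- The number of arcs crossing the middle with right end before `x`. -/
def crossingsBefore (A : Finset (ℤ × ℤ)) (x : ℤ) : ℕ :=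
  ((crossing A).filter fun p => p.2 < x).card

lemma depth_eq_crossingsBefore (A : Finset (ℤ × ℤ)) (p : ℤ × ℤ) :
    depth A p = crossingsBefore A p.2 := rfl

lemma crossingsBefore_succ {A : Finset (ℤ × ℤ)} {k : ℤ} (h : ∀ p ∈ crossing A, p.2 ≠ k) :
    crossingsBefore A (k + 1) = crossingsBefore A k := by
  rw [crossingsBefore, crossingsBefore]
  congr 1
  refine Finset.filter_congr fun p hp => ?_
  have := h p hp
  omega

lemma crossingsBefore_lt {A : Finset (ℤ × ℤ)} {p : ℤ × ℤ} (hp : p ∈ crossing A) {x : ℤ}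
    (h : p.2 < x) : crossingsBefore A p.2 < crossingsBefore A x := by
  refine Finset.card_lt_card (Finset.ssubset_iff_of_subset ?_ |>.2 ⟨p, ?_, ?_⟩)
  · intro p' hp'
    rw [Finset.mem_filter] at hp' ⊢
    exact ⟨hp'.1, by omega⟩
  · exact Finset.mem_filter.2 ⟨hp, h⟩
  · simp

lemma IsMatching.crossingsBefore_succ_of_mem {f : ℤ → ℤ} {A : Finset (ℤ × ℤ)}
    (hA : IsMatching n f A) {p : ℤ × ℤ} (hp : p ∈ crossing A) :
    crossingsBefore A (p.2 + 1) = crossingsBefore A p.2 + 1 := by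
  have : (crossing A).filter (fun p' => p'.2 < p.2 + 1) =
      insert p ((crossing A).filter fun p' => p'.2 < p.2) := by
    ext p'
    simp only [Finset.mem_filter, Finset.mem_insert]
    constructor
    · rintro ⟨h1, h2⟩
      by_cases h : p'.2 = p.2
      · exact Or.inl (hA.eq_of_snd_eq (mem_crossing.1 h1).1 (mem_crossing.1 hp).1 h)
      · exact Or.inr ⟨h1, by omega⟩
    · rintro (rfl | ⟨h1, h2⟩)
      · exact ⟨hp, by omega⟩
      · exact ⟨h1, by omega⟩
  rw [crossingsBefore, this, Finset.card_insert_of_notMem (by simp)]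
  rfl

/-- The two arcs belong to a pair of linked cups, the first one being the inner one. -/
def IsLinked (A : Finset (ℤ × ℤ)) (p p' : ℤ × ℤ) : Prop :=
  Even (depth A p) ∧ depth A p' = depth A p + 1

instance (A : Finset (ℤ × ℤ)) (p p' : ℤ × ℤ) : Decidable (IsLinked A p p') := by
  unfold IsLinked; infer_instance

/-- The weight with signs `g` orients all folded cups with right end after `k`. -/
def OrientedFrom (A : Finset (ℤ × ℤ)) (g : ℤ → Bool) (k : ℤ) : Prop :=
  (∀ p ∈ A, 0 < p.1 → k < p.2 → g p.2 = !g p.1) ∧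
    ∀ p ∈ crossing A, ∀ p' ∈ crossing A, IsLinked A p p' → k < p'.2 → g p'.2 = g p.2

/-- The unlinked folded cups with right end after `k` and sign `+` at the right end. -/
def unlinkedFrom (A : Finset (ℤ × ℤ)) (g : ℤ → Bool) (k : ℤ) : Finset (ℤ × ℤ) :=
  A.filter fun p => 0 < p.1 ∧ k < p.2 ∧ g p.2 = true

/-- The pairs of arcs of the linked folded cups with right end after `k` and sign `+` at the right
end. -/
def linkedFrom (A : Finset (ℤ × ℤ)) (g : ℤ → Bool) (k : ℤ) : Finset ((ℤ × ℤ) × (ℤ × ℤ)) :=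
  (crossing A ×ˢ crossing A).filter fun z => IsLinked A z.1 z.2 ∧ k < z.2.2 ∧ g z.2.2 = true

/-- The number of clockwise folded cups with right end after `k`. -/
def clockFrom (A : Finset (ℤ × ℤ)) (g : ℤ → Bool) (k : ℤ) : ℕ :=
  (unlinkedFrom A g k).card + (linkedFrom A g k).card

/-- The open cups after reading the places `1, …, k`: `st` contains the left ends of the open
unlinked cups, `o` that of an open linked cup. -/
structure IsScanState (A : Finset (ℤ × ℤ)) (k : ℤ) (st : List ℤ) (o : Option ℤ) : Prop where
  sorted : st.Pairwise (· > ·)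
  mem : ∀ a, a ∈ st ↔ 0 < a ∧ a ≤ k ∧ ∃ b, k < b ∧ (a, b) ∈ A
  even : o = none → Even (crossingsBefore A (k + 1))
  pending : ∀ b, o = some b → (-b, b) ∈ A ∧ 0 < b ∧ b ≤ k ∧ Even (crossingsBefore A b) ∧
    crossingsBefore A (k + 1) = crossingsBefore A b + 1

lemma card_filter_lt {α : Type*} [DecidableEq α] (B : Finset α) (h : α → ℤ) (k : ℤ) {P : α → Prop}
    [DecidablePred P] : (B.filter fun x => k < h x ∧ P x).card =
      (B.filter fun x => k + 1 < h x ∧ P x).card + (B.filter fun x => h x = k + 1 ∧ P x).card := by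
  rw [← Finset.card_union_of_disjoint]
  · congr 1
    ext x
    simp only [Finset.mem_filter, Finset.mem_union]
    constructor
    · rintro ⟨h1, h2, h3⟩
      by_cases h4 : h x = k + 1
      · exact Or.inr ⟨h1, h4, h3⟩
      · exact Or.inl ⟨h1, by omega, h3⟩
    · rintro (⟨h1, h2, h3⟩ | ⟨h1, h2, h3⟩)
      · exact ⟨h1, by omega, h3⟩
      · exact ⟨h1, by omega, h3⟩
  · rw [Finset.disjoint_left]
    intro x h1 h2
    have := (Finset.mem_filter.1 h1).2.1
    have := (Finset.mem_filter.1 h2).2.1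
    omega

lemma card_unlinkedFrom (A : Finset (ℤ × ℤ)) (g : ℤ → Bool) (k : ℤ) :
    (unlinkedFrom A g k).card = (unlinkedFrom A g (k + 1)).card +
      ((A.filter fun p => 0 < p.1).filter fun p => p.2 = k + 1 ∧ g p.2 = true).card := by
  have := card_filter_lt (A.filter fun p => 0 < p.1) (fun p => p.2) k (P := fun p => g p.2 = true)
  rw [Finset.filter_filter, Finset.filter_filter] at this
  exact this

lemma card_linkedFrom (A : Finset (ℤ × ℤ)) (g : ℤ → Bool) (k : ℤ) :
    (linkedFrom A g k).card = (linkedFrom A g (k + 1)).card +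
      (((crossing A ×ˢ crossing A).filter fun z => IsLinked A z.1 z.2).filter
        fun z => z.2.2 = k + 1 ∧ g z.2.2 = true).card := by
  have := card_filter_lt ((crossing A ×ˢ crossing A).filter fun z => IsLinked A z.1 z.2)
    (fun z => z.2.2) k (P := fun z => g z.2.2 = true)
  rw [Finset.filter_filter, Finset.filter_filter] at this
  exact this

lemma card_filter_singleton {α : Type*} [DecidableEq α] {B : Finset α} {P : α → Prop}
    [DecidablePred P] {x : α} (hx : x ∈ B) {y : Bool} (h : ∀ z ∈ B, P z ↔ z = x ∧ y = true) :
    (B.filter P).card = if y then 1 else 0 := by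
  cases y
  · rw [Finset.filter_eq_empty_iff.2 fun z hz hP => by simpa using (h z hz).1 hP]
    rfl
  · rw [show B.filter P = {x} by
      ext z
      rw [Finset.mem_filter, Finset.mem_singleton]
      constructor
      · rintro ⟨h1, h2⟩; exact ((h z h1).1 h2).1
      · rintro rfl; exact ⟨hx, (h z hx).2 ⟨rfl, rfl⟩⟩]
    rfl

/-! ### The effect of one place on the orientation condition and the clockwise count. -/

section Step

variable {f : ℤ → ℤ} {A : Finset (ℤ × ℤ)} (g : ℤ → Bool) {k : ℤ}

lemma step_of_no_right_end (h : ∀ p ∈ A, p.2 ≠ k + 1) :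
    (OrientedFrom A g k ↔ OrientedFrom A g (k + 1)) ∧ clockFrom A g k = clockFrom A g (k + 1) := by
  constructor
  · refine and_congr (forall₂_congr fun p hp => ?_) (forall₂_congr fun p _ => forall₂_congr fun p' hp' => ?_)
    · have := h p hp
      rw [show k < p.2 ↔ k + 1 < p.2 by omega]
    · have := h p' (mem_crossing.1 hp').1
      rw [show k < p'.2 ↔ k + 1 < p'.2 by omega]
  · rw [clockFrom, clockFrom, card_unlinkedFrom, card_linkedFrom, Finset.filter_eq_empty_iff.2,
      Finset.filter_eq_empty_iff.2]
    · rfl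
    · intro z hz hz'
      exact h z.2 (mem_crossing.1 (Finset.mem_product.1 (Finset.mem_filter.1 hz).1).2).1 hz'.1
    · intro p hp hp'
      exact h p (Finset.mem_filter.1 hp).1 hp'.1

lemma step_of_unlinked (hA : IsMatching n f A) {a : ℤ} (ha : 0 < a) (h : (a, k + 1) ∈ A) :
    (OrientedFrom A g k ↔ g (k + 1) = !g a ∧ OrientedFrom A g (k + 1)) ∧
      clockFrom A g k = clockFrom A g (k + 1) + if g (k + 1) then 1 else 0 := by
  have uniq : ∀ p ∈ A, p.2 = k + 1 → p = (a, k + 1) := fun p hp hk => hA.eq_of_snd_eq hp h hk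
  have ncr : ∀ p ∈ crossing A, p.2 ≠ k + 1 := fun p hp hk => by
    obtain ⟨h1, h2, h3⟩ := mem_crossing.1 hp
    rw [uniq p h1 hk] at h2
    simp only at h2
    omega
  constructor
  · constructor
    · rintro ⟨h1, h2⟩
      refine ⟨h1 _ h ha (by simp only; omega), fun p hp hp1 hk => h1 p hp hp1 (by omega),
        fun p hp p' hp' hl hk => h2 p hp p' hp' hl (by omega)⟩
    · rintro ⟨h0, h1, h2⟩
      refine ⟨fun p hp hp1 hk => ?_, fun p hp p' hp' hl hk => ?_⟩
      · by_cases hk' : p.2 = k + 1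
        · rw [uniq p hp hk']; exact h0
        · exact h1 p hp hp1 (by omega)
      · have := ncr p' hp'
        exact h2 p hp p' hp' hl (by omega)
  · rw [clockFrom, clockFrom, card_unlinkedFrom, card_linkedFrom,
      card_filter_singleton (x := (a, k + 1)) (y := g (k + 1)) (Finset.mem_filter.2 ⟨h, ha⟩),
      Finset.filter_eq_empty_iff.2]
    · rw [Finset.card_empty]; ring
    · intro z hz hz'
      exact ncr z.2 (Finset.mem_product.1 (Finset.mem_filter.1 hz).1).2 hz'.1
    · intro p hp
      constructor
      · rintro ⟨h1, h2⟩
        rw [h1] at h2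
        exact ⟨uniq p (Finset.mem_filter.1 hp).1 h1, h2⟩
      · rintro ⟨rfl, h2⟩
        exact ⟨rfl, h2⟩

lemma not_unlinked_of_crossing (hA : IsMatching n f A) {p : ℤ × ℤ} (hp : p ∈ crossing A) :
    ∀ p' ∈ A, 0 < p'.1 → p'.2 ≠ p.2 := fun p' hp' h1 h2 => by
  obtain ⟨h3, h4, -⟩ := mem_crossing.1 hp
  rw [hA.eq_of_snd_eq hp' h3 h2] at h1
  omega

/-- The inner arc of a linked pair is the left end of the folded cup, which is counted only at its
right end. -/
lemma step_of_inner (hA : IsMatching n f A) (h : (-(k + 1), k + 1) ∈ crossing A)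
    (he : Even (crossingsBefore A (k + 1))) :
    (OrientedFrom A g k ↔ OrientedFrom A g (k + 1)) ∧ clockFrom A g k = clockFrom A g (k + 1) := by
  have nun := not_unlinked_of_crossing hA h
  have nli : ∀ p p', IsLinked A p p' → p'.2 ≠ k + 1 := fun p p' hl hk => by
    obtain ⟨h1, h2⟩ := hl
    rw [depth_eq_crossingsBefore A p', hk] at h2
    rw [h2] at he
    exact (Nat.even_add_one.1 he) h1
  constructor
  · refine and_congr (forall₂_congr fun p hp => forall_congr' fun hp1 => ?_)
      (forall₂_congr fun p _ => forall₂_congr fun p' hp' => forall_congr' fun hl => ?_)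
    · have := nun p hp hp1
      rw [show k < p.2 ↔ k + 1 < p.2 by simp only at this; omega]
    · have := nli p p' hl
      rw [show k < p'.2 ↔ k + 1 < p'.2 by omega]
  · rw [clockFrom, clockFrom, card_unlinkedFrom, card_linkedFrom, Finset.filter_eq_empty_iff.2,
      Finset.filter_eq_empty_iff.2]
    · rfl
    · intro z hz hz'
      exact nli _ _ (Finset.mem_filter.1 hz).2 hz'.1
    · intro p hp hp'
      exact nun p (Finset.mem_filter.1 hp).1 (Finset.mem_filter.1 hp).2 hp'.1

/-- The outer arc closes the folded linked cup from `b` to `k + 1`. The inner partner is unique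
because depth increases strictly with the right end. -/
lemma step_of_outer (hA : IsMatching n f A) {b : ℤ} (hb : (-b, b) ∈ crossing A)
    (h : (-(k + 1), k + 1) ∈ crossing A) (he : Even (crossingsBefore A b))
    (hd : crossingsBefore A (k + 1) = crossingsBefore A b + 1) :
    (OrientedFrom A g k ↔ g (k + 1) = g b ∧ OrientedFrom A g (k + 1)) ∧
      clockFrom A g k = clockFrom A g (k + 1) + if g (k + 1) then 1 else 0 := by
  have nun := not_unlinked_of_crossing hA h
  have lk : IsLinked A (-b, b) (-(k + 1), k + 1) := ⟨he, hd⟩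
  have uniq : ∀ p ∈ crossing A, ∀ p' ∈ crossing A, IsLinked A p p' → p'.2 = k + 1 →
      p = (-b, b) ∧ p' = (-(k + 1), k + 1) := by
    intro p hp p' hp' hl hk
    have e' : p' = (-(k + 1), k + 1) :=
      hA.eq_of_snd_eq (mem_crossing.1 hp').1 (mem_crossing.1 h).1 hk
    refine ⟨hA.eq_of_snd_eq (mem_crossing.1 hp).1 (mem_crossing.1 hb).1 ?_, e'⟩
    have h2 := hl.2
    rw [e', depth_eq_crossingsBefore, depth_eq_crossingsBefore, hd] at h2
    rcases lt_trichotomy p.2 b with h3 | h3 | h3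
    · have := crossingsBefore_lt hp h3
      omega
    · exact h3
    · have := crossingsBefore_lt hb h3
      simp only at this
      omega
  constructor
  · constructor
    · rintro ⟨h1, h2⟩
      exact ⟨h2 _ hb _ h lk (by simp only; omega), fun p hp hp1 hk => h1 p hp hp1 (by omega),
        fun p hp p' hp' hl hk => h2 p hp p' hp' hl (by omega)⟩
    · rintro ⟨h0, h1, h2⟩
      refine ⟨fun p hp hp1 hk => ?_, fun p hp p' hp' hl hk => ?_⟩
      · have := nun p hp hp1
        exact h1 p hp hp1 (by simp only at this; omega)
      · by_cases hk' : p'.2 = k + 1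
        · obtain ⟨rfl, rfl⟩ := uniq p hp p' hp' hl hk'
          exact h0
        · exact h2 p hp p' hp' hl (by omega)
  · rw [clockFrom, clockFrom, card_unlinkedFrom, card_linkedFrom, Finset.filter_eq_empty_iff.2,
      card_filter_singleton (x := ((-b, b), (-(k + 1), k + 1))) (y := g (k + 1))
        (Finset.mem_filter.2 ⟨Finset.mem_product.2 ⟨hb, h⟩, lk⟩)]
    · rw [Finset.card_empty]; ring
    · rintro ⟨p, p'⟩ hz
      obtain ⟨hz, hl⟩ := Finset.mem_filter.1 hz
      obtain ⟨h1, h2⟩ := Finset.mem_product.1 hz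
      constructor
      · rintro ⟨h3, h4⟩
        obtain ⟨rfl, rfl⟩ := uniq p h1 p' h2 hl h3
        exact ⟨rfl, h4⟩
      · rintro ⟨h3, h4⟩
        simp only [Prod.mk.injEq] at h3
        obtain ⟨rfl, rfl⟩ := h3
        exact ⟨rfl, h4⟩
    · intro p hp hp'
      exact nun p (Finset.mem_filter.1 hp).1 (Finset.mem_filter.1 hp).2 hp'.1

end Step

lemma cupWeight_mul_ite {P : Prop} [Decidable P] (y : Bool) (m : ℕ) :
    cupWeight y * (if P then q ^ m else 0) =
      if P then q ^ (m + if y then 1 else 0) else 0 := by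
  cases y
  · simp [cupWeight]
  · rw [cupWeight, if_pos rfl, if_pos rfl, mul_ite, mul_zero, pow_succ, mul_comm]

open Classical in
-- The scan state lists the open folded cups, so the rest of the scan evaluates exactly the cups
-- with right end after `k`. Each of its branches is matched with one of the step lemmas.
lemma scan_eq_ite {f : ℤ → ℤ} {A : Finset (ℤ × ℤ)} (hA : IsMatching n f A)
    (hsymm : ∀ p ∈ crossing A, p.1 = -p.2) (g : ℤ → Bool) (m k : ℕ) (hk : k + m = 2 * n)
    {st : List ℤ} {o : Option ℤ} (hst : IsScanState A k st o) :
    scan ((List.range' (k + 1) m).map fun j : ℕ => (decide (f j = 1), g j)) (st.map g) (o.map g) =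
      if OrientedFrom A g k then q ^ clockFrom A g k else 0 := by
  induction m generalizing k st o with
  | zero =>
    have h2 : ∀ p ∈ A, p.2 ≤ k := fun p hp => by
      have := (mem_points_iff.1 (hA.snd_mem_points hp)).2.2; omega
    rw [List.range'_zero, List.map_nil, scan, if_pos, clockFrom, unlinkedFrom, linkedFrom,
      Finset.filter_eq_empty_iff.2, Finset.filter_eq_empty_iff.2]
    · simp
    · intro z hz h
      have := h2 z.2 (mem_crossing.1 (Finset.mem_product.1 hz).2).1
      omega
    · intro p hp h
      have := h2 p hp
      omega
    · exact ⟨fun p hp _ h => absurd h (by have := h2 p hp; omega),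
        fun p _ p' hp' _ h => absurd h (by have := h2 p' (mem_crossing.1 hp').1; omega)⟩
  | succ m ih =>
    have hkp : ((k : ℤ) + 1) ∈ points n := mem_points_iff.2 (by omega)
    rw [List.range'_succ, List.map_cons]
    have hcast : ((k + 1 : ℕ) : ℤ) = (k : ℤ) + 1 := by push_cast; rfl
    have ih' := fun st o h => ih (k + 1) (st := st) (o := o) (by omega) h
    rw [hcast] at ih' ⊢
    by_cases hfk : f ((k : ℤ) + 1) = 1
    · have hne : ∀ p ∈ A, p.2 ≠ (k : ℤ) + 1 := fun p hp h => by
        have := (hA.label p hp).2.2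
        rw [h] at this; omega
      have hD := crossingsBefore_succ (A := A) (k := (k : ℤ) + 1)
        fun p hp => hne p (mem_crossing.1 hp).1
      obtain ⟨s1, s2⟩ := step_of_no_right_end g hne
      have hst' : IsScanState A ((k : ℤ) + 1) (((k : ℤ) + 1) :: st) o := by
        refine ⟨List.pairwise_cons.2 ⟨fun a ha => ?_, hst.sorted⟩, fun a => ?_, fun h => ?_,
          fun b h => ?_⟩
        · have := (hst.mem a).1 ha; omega
        · rw [List.mem_cons, hst.mem]
          constructor
          · rintro (rfl | ⟨h1, h2, b, h3, h4⟩)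
            · obtain ⟨b, hb, hb'⟩ := hA.exists_right_end hkp hfk
              exact ⟨by omega, le_rfl, b, hb', hb⟩
            · have := hne _ h4
              exact ⟨h1, by omega, b, by simp only at this; omega, h4⟩
          · rintro ⟨h1, h2, b, h3, h4⟩
            by_cases ha : a = (k : ℤ) + 1
            · exact Or.inl ha
            · exact Or.inr ⟨h1, by omega, b, by omega, h4⟩
        · rw [hD]; exact hst.even h
        · obtain ⟨h1, h2, h3, h4, h5⟩ := hst.pending b h
          exact ⟨h1, h2, by omega, h4, by rw [hD, h5]⟩
      have := ih' _ _ hst'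
      simp only [hfk, decide_true, scan, s1, s2]
      exact this
    · obtain ⟨a, ha⟩ := hA.exists_left_end hkp hfk
      have hfk' : decide (f ((k : ℤ) + 1) = 1) = false := decide_eq_false hfk
      have uniq : ∀ c, (c, (k : ℤ) + 1) ∈ A → c = a := fun c hc =>
        congrArg Prod.fst (hA.eq_of_snd_eq hc ha rfl)
      have nright : ∀ b, ((k : ℤ) + 1, b) ∉ A := fun b hb => hfk (hA.label _ hb).2.1
      have ha0 : a ≠ 0 := (mem_points_iff.1 (hA.mem_points _ ha).1).1
      have hak : a < (k : ℤ) + 1 := (hA.label _ ha).1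
      have memst : ∀ c, c ∈ st ↔ c = a ∧ 0 < a ∨
          (0 < c ∧ c ≤ (k : ℤ) + 1 ∧ ∃ b, (k : ℤ) + 1 < b ∧ (c, b) ∈ A) := by
        intro c
        rw [hst.mem]
        constructor
        · rintro ⟨h1, h2, b, h3, h4⟩
          by_cases hb : b = (k : ℤ) + 1
          · subst hb
            have := uniq c h4
            exact Or.inl ⟨this, this ▸ h1⟩
          · exact Or.inr ⟨h1, by omega, b, by omega, h4⟩
        · rintro (⟨rfl, h1⟩ | ⟨h1, h2, b, h3, h4⟩)
          · exact ⟨h1, by omega, _, by omega, ha⟩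
          · have : c ≠ (k : ℤ) + 1 := by rintro rfl; exact nright _ h4
            exact ⟨h1, by omega, b, by omega, h4⟩
      -- Since arcs do not intersect, no open cup starts inside the arc that ends here. So if `a >
      -- 0`, it is the top of the stack.
      have hle : ∀ c ∈ st, c ≤ a := by
        intro c hc
        rcases (memst c).1 hc with h | ⟨h1, h2, b, h3, h4⟩
        · exact h.1.le
        · by_contra h5
          have : c ≠ (k : ℤ) + 1 := by rintro rfl; exact nright _ h4
          have := hA.noncrossing _ ha _ h4
          simp only at this
          omega
      rw [hfk']
      rcases lt_or_gt_of_ne ha0 with hneg | hpos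
      · have hcr : (a, (k : ℤ) + 1) ∈ crossing A :=
          mem_crossing.2 ⟨ha, hneg, by simp only; omega⟩
        obtain rfl : a = -((k : ℤ) + 1) := hsymm _ hcr
        have hD := hA.crossingsBefore_succ_of_mem hcr
        simp only at hD
        -- Stack entries are positive but at most `a < 0`.
        obtain rfl : st = [] := List.eq_nil_iff_forall_not_mem.2 fun c hc => by
          have := hle c hc
          have := ((hst.mem c).1 hc).1
          omega
        have hmem : ∀ c, c ∈ ([] : List ℤ) ↔
            0 < c ∧ c ≤ (k : ℤ) + 1 ∧ ∃ b, (k : ℤ) + 1 < b ∧ (c, b) ∈ A := by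
          intro c
          rw [memst]
          constructor
          · rintro (h | h)
            · omega
            · exact h
          · exact Or.inr
        rcases o with _ | b
        · have he := hst.even rfl
          obtain ⟨s1, s2⟩ := step_of_inner g hA hcr he
          have hst' : IsScanState A ((k : ℤ) + 1) [] (some ((k : ℤ) + 1)) := by
            refine ⟨List.Pairwise.nil, hmem, by simp, fun b hb => ?_⟩
            obtain rfl : (k : ℤ) + 1 = b := by simpa using hb
            exact ⟨ha, by omega, le_rfl, he, hD⟩
          have := ih' _ _ hst'
          simp only [List.map_nil, Option.map_none, scan, s1, s2]
          exact this
        · obtain ⟨h1, h2, h3, h4, h5⟩ := hst.pending b rfl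
          obtain ⟨s1, s2⟩ := step_of_outer g hA
            (mem_crossing.2 ⟨h1, by simp only; omega, h2⟩) hcr h4 h5
          have hst' : IsScanState A ((k : ℤ) + 1) [] none := by
            refine ⟨List.Pairwise.nil, hmem, fun _ => ?_, by simp⟩
            rw [hD, h5]
            -- Both arcs of the pair have been passed, so the number of crossing arcs read is even
            -- again.
            exact (Nat.even_add_one.2 (Nat.not_even_iff_odd.2 (h4.add_one)))
          have := ih' _ _ hst'
          simp only [List.map_nil, Option.map_some, Option.map_none] at this ⊢
          rw [scan, this, cupWeight_mul_ite, s2]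
          simp only [s1, ite_and]
      · have hmema : a ∈ st := (memst a).2 (Or.inl ⟨rfl, hpos⟩)
        obtain ⟨s1, s2⟩ := step_of_unlinked g hA hpos ha
        rcases st with _ | ⟨c, st⟩
        · simp at hmema
        · have hsort := List.pairwise_cons.1 hst.sorted
          obtain rfl : c = a := by
            rcases List.mem_cons.1 hmema with h | h
            · exact h.symm
            · have := hsort.1 a h
              have := hle c List.mem_cons_self
              omega
          have hnc : ∀ p ∈ crossing A, p.2 ≠ (k : ℤ) + 1 := fun p hp h => by
            obtain ⟨h1, h2, -⟩ := mem_crossing.1 hp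
            have := congrArg Prod.fst (hA.eq_of_snd_eq h1 ha h)
            simp only at this
            omega
          have hD := crossingsBefore_succ hnc
          have hst' : IsScanState A ((k : ℤ) + 1) st o := by
            refine ⟨hsort.2, fun x => ?_, fun h => ?_, fun b h => ?_⟩
            · constructor
              · intro hx
                rcases (memst x).1 (List.mem_cons_of_mem _ hx) with h | h
                · have := hsort.1 x hx; omega
                · exact h
              · intro hx
                rcases List.mem_cons.1 ((memst x).2 (Or.inr hx)) with h | h
                · subst h
                  obtain ⟨-, -, b, h1, h2⟩ := hx
                  have := congrArg Prod.snd (hA.eq_of_fst_eq h2 ha rfl)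
                  simp only at this
                  omega
                · exact h
            · rw [hD]; exact hst.even h
            · obtain ⟨h1, h2, h3, h4, h5⟩ := hst.pending b h
              exact ⟨h1, h2, by omega, h4, by rw [hD, h5]⟩
          have := ih' _ _ hst'
          rw [List.map_cons, scan, this, cupWeight_mul_ite, s2]
          simp only [s1, ite_and]

/-! ### Unfolding: orientation and clockwise cups of the full diagram. -/

/-- The sign of `w` at the place `k`. -/
def placeSign (w : W n) (k : ℤ) : Bool := decide (extSeq w k = 1)

lemma extSeq_neg (w : W n) (k : ℤ) : extSeq w (-k) = -extSeq w k := by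
  unfold extSeq
  rw [abs_neg, Psi_neg, Int.sign_neg, Int.sign_neg]
  split_ifs <;> simp

lemma placeSign_neg (w : W n) {k : ℤ} (hk : k ∈ points n) :
    placeSign w (-k) = !placeSign w k := by
  rw [placeSign, placeSign, extSeq_neg]
  rcases (isBallot_extSeq w).sign k hk with h | h <;> rw [h] <;> rfl

lemma placeList_eq_map (v w : W n) : placeList n (signSeq w) (signSeq v) =
    (List.range' 1 (2 * n)).map fun j : ℕ => (decide (extSeq w j = 1), placeSign v j) := by
  have h1 : ∀ (x : W n) (k : ℕ), k ≤ n → decide (extSeq x k = 1) = signSeq x k := by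
    intro x k hk
    symm
    rw [signSeq, extSeq, if_pos (by rw [abs_of_nonneg (by omega)]; omega)]
    exact (decide_eq_decide.2 Int.sign_eq_one_iff_pos).symm
  have h2 : ∀ (x : W n) (k : ℕ), n < k → decide (extSeq x k = 1) = false := by
    intro x k hk
    rw [extSeq, if_neg (by rw [abs_of_nonneg (by omega)]; omega),
      Int.sign_eq_one_of_pos (by omega)]
    split_ifs <;> rfl
  rw [placeList, two_mul, ← List.range'_append_1, List.map_append]
  congr 1
  · refine List.map_congr_left fun k hk => ?_
    rw [List.mem_range'_1] at hk
    rw [placeSign, h1 w k (by omega), h1 v k (by omega)]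
  · refine (List.eq_replicate_iff.2 ⟨by simp, fun e he => ?_⟩).symm
    obtain ⟨k, hk, rfl⟩ := List.mem_map.1 he
    rw [List.mem_range'_1] at hk
    rw [placeSign, h2 w k (by omega), h2 v k (by omega)]

lemma isMatching_extSeq (w : W n) : IsMatching n (extSeq w) (matching n (extSeq w)) :=
  isMatching_matching (isBallot_extSeq w)

lemma fst_eq_neg_snd_of_mem_crossing {w : W n} {p : ℤ × ℤ}
    (hp : p ∈ crossing (matching n (extSeq w))) : p.1 = -p.2 :=
  (isMatching_extSeq w).fst_eq_neg_snd (isBallot_extSeq w) (extSeq_neg w) hp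

open Classical in
lemma repCoeff_eq_ite (v w : MinCosetRep n) : repCoeff v w =
    if OrientedFrom (matching n (extSeq w.1)) (placeSign v.1) 0 then
      q ^ clockFrom (matching n (extSeq w.1)) (placeSign v.1) 0 else 0 := by
  rw [repCoeff, cupCoeff, placeList_eq_map]
  have hst : IsScanState (matching n (extSeq w.1)) ((0 : ℕ) : ℤ) [] none := by
    refine ⟨List.Pairwise.nil, fun a => ?_, fun _ => ?_, by simp⟩
    · simp only [List.not_mem_nil, false_iff]
      push_cast
      omega
    · rw [crossingsBefore, Finset.filter_eq_empty_iff.2]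
      · exact Even.zero
      · intro p hp h
        have := (mem_crossing.1 hp).2.2
        push_cast at h
        omega
  have := scan_eq_ite (isMatching_extSeq w.1)
    (fun p hp => fst_eq_neg_snd_of_mem_crossing hp) (placeSign v.1) (2 * n) 0 (by omega) hst
  exact this

lemma diagWeight_eq_down_iff (v : W n) (k : ℤ) : diagWeight v k = Arrow.down ↔ placeSign v k = true := by
  rw [diagWeight, placeSign, decide_eq_true_iff]
  split_ifs with h <;> simp [h]

lemma diagWeight_eq_up_iff (v : W n) (k : ℤ) : diagWeight v k = Arrow.up ↔ placeSign v k = false := by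
  rw [diagWeight, placeSign, decide_eq_false_iff_not]
  split_ifs with h <;> simp [h]

lemma diagWeight_ne_iff (v : W n) (k l : ℤ) :
    diagWeight v k ≠ diagWeight v l ↔ placeSign v l = !placeSign v k := by
  simp only [diagWeight, placeSign]
  split_ifs with h1 h2 h2 <;> simp [h1, h2]

/-- Different crossing arcs have different depths, so two of them with the same half are `2m` and
`2m + 1`. -/
lemma linked_iff {w : W n} {p p' : ℤ × ℤ} (hp : p ∈ crossing (matching n (extSeq w)))
    (hp' : p' ∈ crossing (matching n (extSeq w))) :
    p ≠ p' ∧ depth (matching n (extSeq w)) p / 2 = depth (matching n (extSeq w)) p' / 2 ↔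
      IsLinked (matching n (extSeq w)) p p' ∨ IsLinked (matching n (extSeq w)) p' p := by
  have hA := isMatching_extSeq w
  simp only [IsLinked, Nat.even_iff]
  constructor
  · rintro ⟨h1, h2⟩
    have h3 : depth (matching n (extSeq w)) p ≠ depth (matching n (extSeq w)) p' := by
      intro h
      rw [depth_eq_crossingsBefore, depth_eq_crossingsBefore] at h
      rcases lt_trichotomy p.2 p'.2 with h3 | h3 | h3
      · have := crossingsBefore_lt hp h3; omega
      · exact h1 (hA.eq_of_snd_eq (mem_crossing.1 hp).1 (mem_crossing.1 hp').1 h3)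
      · have := crossingsBefore_lt hp' h3; omega
    omega
  · intro h
    refine ⟨?_, by omega⟩
    rintro rfl
    omega

/-- Signs at `k` and `-k` are opposite. So a cup and its mirror image are oriented simultaneously,
and a linked cup from `-b` to `b'` requires equal signs at `b` and `b'`. -/
lemma isOriented_iff (v w : MinCosetRep n) :
    IsOriented v w ↔ OrientedFrom (matching n (extSeq w.1)) (placeSign v.1) 0 := by
  have hA := isMatching_extSeq w.1
  simp only [IsOriented, diagWeight_ne_iff, cupDiagram]
  constructor
  · intro h
    refine ⟨fun p hp hp1 _ => ?_, fun p hp p' hp' hl _ => ?_⟩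
    · refine h p (Finset.mem_union_left _ (Finset.mem_sdiff.2 ⟨hp, fun hc => ?_⟩))
      have := (mem_crossing.1 hc).2.1
      omega
    · have := h (p.1, p'.2) (Finset.mem_union_right _ (Finset.mem_image.2 ⟨(p, p'),
        Finset.mem_filter.2 ⟨Finset.mem_product.2 ⟨hp, hp'⟩, (linked_iff hp hp').2 (Or.inl hl)⟩,
          rfl⟩))
      simp only at this
      rw [this, fst_eq_neg_snd_of_mem_crossing hp,
        placeSign_neg _ (hA.snd_mem_points (mem_crossing.1 hp).1), Bool.not_not]
  · rintro ⟨h1, h2⟩ p hp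
    rcases Finset.mem_union.1 hp with hp | hp
    · obtain ⟨hp, hc⟩ := Finset.mem_sdiff.1 hp
      obtain ⟨m1, m2⟩ := hA.mem_points p hp
      have hlt := (hA.label p hp).1
      by_cases h0 : 0 < p.1
      · exact h1 p hp h0 (by omega)
      -- The arc lies on the negative side and is handled through its mirror image.
      · have h3 : ¬ (p.1 < 0 ∧ 0 < p.2) := fun h => hc (mem_crossing.2 ⟨hp, h⟩)
        have z1 := (mem_points_iff.1 m1).1
        have z2 := (mem_points_iff.1 m2).1
        have := h1 _ (hA.reflect_mem (isBallot_extSeq w.1) (extSeq_neg w.1) hp)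
          (by simp only; omega) (by simp only; omega)
        simp only [placeSign_neg _ m1, placeSign_neg _ m2, Bool.not_not] at this
        exact this.symm
    · obtain ⟨⟨z1, z2⟩, hz, rfl⟩ := Finset.mem_image.1 hp
      obtain ⟨hz, hl⟩ := Finset.mem_filter.1 hz
      obtain ⟨m1, m2⟩ := Finset.mem_product.1 hz
      simp only at m1 m2 hl ⊢
      rw [fst_eq_neg_snd_of_mem_crossing m1,
        placeSign_neg _ (hA.snd_mem_points (mem_crossing.1 m1).1), Bool.not_not]
      rcases (linked_iff m1 m2).1 hl with hl | hl
      · exact h2 _ m1 _ m2 hl (mem_crossing.1 m2).2.2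
      · exact (h2 _ m2 _ m1 hl (mem_crossing.1 m1).2.2).symm

/-- Each clockwise folded cup unfolds to two clockwise cups: a cup and its mirror image, or the two
linked cups of a pair. -/
lemma cl_eq {v w : MinCosetRep n} (h : OrientedFrom (matching n (extSeq w.1)) (placeSign v.1) 0) :
    cl v w = 2 * clockFrom (matching n (extSeq w.1)) (placeSign v.1) 0 := by
  have hA := isMatching_extSeq w.1
  have hsym := fun p => fst_eq_neg_snd_of_mem_crossing (w := w.1) (p := p)
  have hrefl := fun {a b : ℤ} =>
    hA.reflect_mem (isBallot_extSeq w.1) (extSeq_neg w.1) (a := a) (b := b)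
  rw [cl, cupDiagram]
  simp only [diagWeight_eq_up_iff, diagWeight_eq_down_iff]
  set A := matching n (extSeq w.1)
  set g := placeSign v.1
  have gneg : ∀ p ∈ A, g (-p.1) = !g p.1 ∧ g (-p.2) = !g p.2 := fun p hp =>
    ⟨placeSign_neg _ (hA.mem_points p hp).1, placeSign_neg _ (hA.mem_points p hp).2⟩
  obtain ⟨h1, h2⟩ := h
  rw [Finset.filter_union, Finset.card_union_of_disjoint]
  swap
  · rw [Finset.disjoint_left]
    intro p hp hp'
    obtain ⟨hp, hc⟩ := Finset.mem_sdiff.1 (Finset.mem_filter.1 hp).1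
    obtain ⟨⟨z1, z2⟩, hz, rfl⟩ := Finset.mem_image.1 (Finset.mem_filter.1 hp').1
    obtain ⟨m1, m2⟩ := Finset.mem_product.1 (Finset.mem_filter.1 hz).1
    exact hc (mem_crossing.2 ⟨hp, (mem_crossing.1 m1).2.1, (mem_crossing.1 m2).2.2⟩)
  have e1 : ((A \ crossing A).filter fun p => g p.1 = false ∧ g p.2 = true) =
      unlinkedFrom A g 0 ∪ (unlinkedFrom A g 0).image fun p => (-p.2, -p.1) := by
    ext ⟨a, b⟩
    simp only [Finset.mem_filter, Finset.mem_sdiff, Finset.mem_union, Finset.mem_image,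
      unlinkedFrom, mem_crossing]
    constructor
    · rintro ⟨⟨hp, hc⟩, g1, g2⟩
      have m1 := (mem_points_iff.1 (hA.mem_points _ hp).1).1
      have m2 := (mem_points_iff.1 (hA.mem_points _ hp).2).1
      have hlt := (hA.label _ hp).1
      simp only at m1 m2 hlt
      by_cases h0 : 0 < a
      · exact Or.inl ⟨hp, h0, by omega, g2⟩
      · right
        have h3 : ¬ (a < 0 ∧ 0 < b) := fun h => hc ⟨hp, h⟩
        have gg := (gneg _ hp).1
        simp only at gg
        exact ⟨(-b, -a), ⟨hrefl hp, by simp only; omega, by simp only; omega, by simp [gg, g1]⟩,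
          by simp⟩
    · rintro (⟨hp, p1, p2, p3⟩ | ⟨⟨c, d⟩, ⟨hp, p1, p2, p3⟩, he⟩)
      · refine ⟨⟨hp, by omega⟩, ?_, p3⟩
        have := h1 _ hp p1 p2
        simp only [p3] at this
        simpa using this.symm
      · simp only [Prod.mk.injEq] at he
        obtain ⟨rfl, rfl⟩ := he
        simp only at p1 p2 p3
        have g1 := gneg _ hp
        simp only at g1
        have := h1 _ hp p1 p2
        simp only [p3] at this
        refine ⟨⟨hrefl hp, by omega⟩, by rw [g1.2, p3]; rfl, by rw [g1.1]; exact this.symm⟩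
  have c1 : ((A \ crossing A).filter fun p => g p.1 = false ∧ g p.2 = true).card =
      2 * (unlinkedFrom A g 0).card := by
    rw [e1, Finset.card_union_of_disjoint, Finset.card_image_of_injective]
    · ring
    · rintro ⟨a, b⟩ ⟨c, d⟩ h
      simp only [Prod.mk.injEq, neg_inj] at h
      rw [h.1, h.2]
    · rw [Finset.disjoint_left]
      intro p hp hp'
      obtain ⟨p', hp'', rfl⟩ := Finset.mem_image.1 hp'
      have a1 := (Finset.mem_filter.1 hp).2
      have a2 := (Finset.mem_filter.1 hp'').2
      simp only at a1
      omega
  -- The pair of arcs taken in its two orders gives the two linked cups.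
  have e2 : ((((crossing A ×ˢ crossing A).filter fun z =>
      z.1 ≠ z.2 ∧ depth A z.1 / 2 = depth A z.2 / 2).image fun z => (z.1.1, z.2.2)).filter
        fun p => g p.1 = false ∧ g p.2 = true) =
      (linkedFrom A g 0 ∪ (linkedFrom A g 0).image Prod.swap).image fun z => (z.1.1, z.2.2) := by
    rw [Finset.filter_image]
    congr 1
    ext ⟨z1, z2⟩
    simp only [Finset.mem_filter, Finset.mem_product, Finset.mem_union, Finset.mem_image,
      linkedFrom, Prod.exists, Prod.swap_prod_mk, Prod.mk.injEq]
    constructor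
    · rintro ⟨⟨⟨m1, m2⟩, hl⟩, g1, g2⟩
      have p1 := (mem_crossing.1 m1).2.2
      have p2 := (mem_crossing.1 m2).2.2
      rw [hsym _ m1, (gneg _ (mem_crossing.1 m1).1).2] at g1
      rcases (linked_iff m1 m2).1 hl with hl | hl
      · exact Or.inl ⟨⟨m1, m2⟩, hl, p2, g2⟩
      · exact Or.inr ⟨z2.1, z2.2, z1.1, z1.2, ⟨⟨m2, m1⟩, hl, p1, by simpa using g1⟩, rfl, rfl⟩
    · rintro (⟨⟨m1, m2⟩, hl, p2, g2⟩ | ⟨a, b, c, d, ⟨⟨m2, m1⟩, hl, p2, g2⟩, rfl, rfl⟩)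
      · refine ⟨⟨⟨m1, m2⟩, (linked_iff m1 m2).2 (Or.inl hl)⟩, ?_, g2⟩
        rw [hsym _ m1, (gneg _ (mem_crossing.1 m1).1).2, ← h2 _ m1 _ m2 hl p2, g2]
        rfl
      · refine ⟨⟨⟨m1, m2⟩, (linked_iff m1 m2).2 (Or.inr hl)⟩, ?_, ?_⟩
        · rw [hsym _ m1, (gneg _ (mem_crossing.1 m1).1).2]
          simp only
          rw [g2]; rfl
        · exact (h2 _ m2 _ m1 hl p2).symm.trans g2
  have c2 : ((((crossing A ×ˢ crossing A).filter fun z =>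
      z.1 ≠ z.2 ∧ depth A z.1 / 2 = depth A z.2 / 2).image fun z => (z.1.1, z.2.2)).filter
        fun p => g p.1 = false ∧ g p.2 = true).card = 2 * (linkedFrom A g 0).card := by
    rw [e2, Finset.card_image_of_injOn, Finset.card_union_of_disjoint,
      Finset.card_image_of_injective _ Prod.swap_injective]
    · ring
    · rw [Finset.disjoint_left]
      intro z hz hz'
      obtain ⟨z', hz'', rfl⟩ := Finset.mem_image.1 hz'
      have a1 := (Finset.mem_filter.1 hz).2.1.2
      have a2 := (Finset.mem_filter.1 hz'').2.1.2
      simp only [Prod.fst_swap, Prod.snd_swap] at a1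
      omega
    · have hmem : ∀ z ∈ linkedFrom A g 0 ∪ (linkedFrom A g 0).image Prod.swap,
          z.1 ∈ A ∧ z.2 ∈ A := by
        intro z hz
        rcases Finset.mem_union.1 hz with hz | hz
        · obtain ⟨m1, m2⟩ := Finset.mem_product.1 (Finset.mem_filter.1 hz).1
          exact ⟨(mem_crossing.1 m1).1, (mem_crossing.1 m2).1⟩
        · obtain ⟨z', hz', rfl⟩ := Finset.mem_image.1 hz
          obtain ⟨m1, m2⟩ := Finset.mem_product.1 (Finset.mem_filter.1 hz').1
          exact ⟨(mem_crossing.1 m2).1, (mem_crossing.1 m1).1⟩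
      -- A cup determines the ordered pair of arcs, since an arc is determined by either of its
      -- ends.
      intro z hz z' hz' he
      simp only [Prod.mk.injEq] at he
      exact Prod.ext (hA.eq_of_fst_eq (hmem z hz).1 (hmem z' hz').1 he.1)
        (hA.eq_of_snd_eq (hmem z hz).2 (hmem z' hz').2 he.2)
  rw [c1, c2, clockFrom]
  ring

lemma repCoeff_of_isOriented {v w : MinCosetRep n} (h : IsOriented v w) :
    Even (cl v w) ∧ repCoeff v w = q ^ (cl v w / 2) := by
  rw [isOriented_iff] at h
  rw [cl_eq h, repCoeff_eq_ite, if_pos h, Nat.mul_div_cancel_left _ two_pos]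
  exact ⟨even_two_mul _, rfl⟩

lemma repCoeff_of_not_isOriented {v w : MinCosetRep n} (h : ¬ IsOriented v w) :
    repCoeff v w = 0 := by
  rw [isOriented_iff] at h
  rw [repCoeff_eq_ite, if_neg h]

end CupDiagram

end GraphicalKL

/-! ### The graphical Kazhdan–Lusztig basis. -/

theorem theorem2p1 (n : ℕ) (hn : 4 ≤ n) :
    Function.Bijective (GraphicalKL.Phi n) ∧
    ∃ Nstd NKL : Module.Basis (GraphicalKL.MinCosetRep n) GraphicalKL.L
        (GraphicalKL.ParabolicModule n),
      (∀ w, Nstd w = GraphicalKL.N w) ∧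
      GraphicalKL.IsKLFamily n NKL ∧
      (∀ B : GraphicalKL.MinCosetRep n → GraphicalKL.ParabolicModule n,
        GraphicalKL.IsKLFamily n B → B = NKL) ∧
      (∀ w, GraphicalKL.Phi n (GraphicalKL.cupElement w) = NKL w) ∧
      (∀ v w, GraphicalKL.IsOriented v w → Even (GraphicalKL.cl v w) ∧
        Nstd.repr (NKL w) v = GraphicalKL.q ^ (GraphicalKL.cl v w / 2)) ∧
      (∀ v w, ¬ GraphicalKL.IsOriented v w → Nstd.repr (NKL w) v = 0) := by
  classical
  have h2 : 2 ≤ n := by omega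
  have : Finite (GraphicalKL.MinCosetRep n) := GraphicalKL.finite_minCosetRep h2
  let _ : Fintype (GraphicalKL.MinCosetRep n) := Fintype.ofFinite _
  have hkl : (GraphicalKL.klBasis h2 : GraphicalKL.MinCosetRep n → _) = GraphicalKL.klElement :=
    funext (GraphicalKL.klBasis_apply h2)
  -- Linear independence of the `N_w` is by definition the injectivity of `Phi`.
  refine ⟨⟨GraphicalKL.linearIndependent_N_signSeq h2, ?_⟩, GraphicalKL.stdBasis h2,
    GraphicalKL.klBasis h2, GraphicalKL.stdBasis_apply h2, ?_, fun B hB => ?_, fun w => ?_,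
    fun v w h => ?_, fun v w h => ?_⟩
  · rw [← LinearMap.range_eq_top, GraphicalKL.Phi, Finsupp.range_linearCombination]
    exact GraphicalKL.span_N h2
  · rw [hkl]; exact GraphicalKL.isKLFamily_klElement h2
  · rw [hkl]; exact hB.eq_klElement h2
  · rw [hkl, GraphicalKL.cupElement, finsum_eq_sum_of_fintype, map_sum, GraphicalKL.klElement]
    refine Finset.sum_congr rfl fun v _ => ?_
    by_cases h : GraphicalKL.IsOriented v w
    · rw [finsum_eq_if, if_pos h, GraphicalKL.Phi, Finsupp.linearCombination_single,
        (GraphicalKL.repCoeff_of_isOriented h).2]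
    · rw [finsum_eq_if, if_neg h, map_zero, GraphicalKL.repCoeff_of_not_isOriented h, zero_smul]
  · rw [hkl, GraphicalKL.repr_klElement]
    exact GraphicalKL.repCoeff_of_isOriented h
  · rw [hkl, GraphicalKL.repr_klElement]
    exact GraphicalKL.repCoeff_of_not_isOriented h
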